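/- **Setting.** Fix $r\ge 0$, $\omega\ge 0$ with $\omega\ne r^2$, $\pi_1\in(0,1)$, $\pi_2=1-\pi_1$, and $\xi\ge 1$. For $n\ge 2$ nodes the true label vector $c\in\{-1,1\}^n$ is $+1$ on the first $\bar n_1$ nodes (community 1) and $-1$ on the others (community 2), where $\bar n_1$ is an integer with $|\bar n_1-n\pi_1|<1$. Let $\lambda_n>0$ and $$P=\frac{\lambda_n}{n}\begin{pmatrix}1&r\\ r&\omega\end{pmatrix}.$$ The degree parameters $\theta_1,\dots,\theta_n$ are i.i.d. from a distribution on $[1/\xi,\xi]$ with mean $1$, such that $\theta_i\theta_jP_{kl}\le 1$ almost surely for all $i,j,k,l$. The adjacency matrix $A$ is symmetric with entries in $\{0,1\}$; given $\theta$, its entries $A_{ij}$, $i>j$, are independent Bernoulli variables with means $\theta_i\theta_jP_{c_ic_j}$ (the diagonal of $A$ may be arbitrary, e.g. $0$). Let $\bar A=(\theta_i\theta_jP_{c_ic_j})_{i,j}$, the expectation of $A$ given $\theta$, which has rank at most two. For $e\in\mathbb R^n$ put $O_{11}=\frac14(\mathbf 1+e)^TA(\mathbf 1+e)$, $O_{22}=\frac14(\mathbf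 1-e)^TA(\mathbf 1-e)$, $O_{12}=\frac14(\mathbf 1+e)^TA(\mathbf 1-e)$, $O_1=O_{11}+O_{12}$, $O_2=O_{22}+O_{12}$, and, with $0\log 0=0$, $$Q_{DC}(e)=O_{11}\log O_{11}+O_{22}\log O_{22}+2O_{12}\log O_{12}-2O_1\log O_1-2O_2\log O_2 .$$ For a real $2\times n$ matrix $U_A$, let $\mathcal E_A$ be the set of $e\in\{-1,1\}^n$ such that $U_Ae$ is an extreme point of $U_A[-1,1]^n$, and let $e^*$ be any maximizer of $Q_{DC}$ over $\mathcal E_A$. Let $U_{\bar A}$ be any $2\times n$ matrix whose rows are orthonormal eigenvectors of $\bar A$ for its two eigenvalues of largest absolute value. Since $Q_{DC}(e)=Q_{DC}(-e)$, labels are identified up to a global change of sign. $\|\cdot\|$ is the Euclidean norm of vectors and the spectral norm of matrices. **Theorem.** For every $\delta\in(0,1)$ there is a constant $M=M(r,\omega,\pi_1,\xi,\delta)>0$ such that, whenever $\log^2 n=O(\lambda_n)$ as $n\to\infty$, the following holds for every $n\ge 2$. There is an event of probability at least $1-\delta$ on which, for all $U_A$ (in particular for every $U_A$ computed from $A$),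 all $U_{\bar A}$ and all $e^*$ as above, $$\frac1n\min\left(\|c-e^*\|^2,\|c+e^*\|^2\right)\le M\log n\left(\lambda_n^{-1/2}+\|U_A-U_{\bar A}\|\right),$$ and on which, moreover, if the rows of $U_A$ are orthonormal eigenvectors of $A$ for its two leading eigenvalues (the two largest in absolute value or, when $\omega>r^2$, also the two largest), then the fraction of nodes misclustered by $e^*$, up to exchanging the two labels, is at most $M\log n/\sqrt{\lambda_n}$. -/

import Mathlib

namespace DCSBM

open MeasureTheory ProbabilityTheory

noncomputable section

/-! ### The two-community degree-corrected stochastic block model -/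

/-- The community of a node: the first `n₁` nodes are in community `0`, the others in `1`. -/
def comm {n : ℕ} (n₁ : ℕ) (i : Fin n) : Fin 2 := if (i : ℕ) < n₁ then 0 else 1

/-- The true label vector `c ∈ {-1, 1}ⁿ`: `+1` on the first community, `-1` on the second. -/
def trueLabel (n n₁ : ℕ) : Fin n → ℝ := fun i => if (i : ℕ) < n₁ then 1 else -1

/-- The `2 × 2` matrix of edge probabilities `(lam / n) [[1, r], [r, w]]`. -/
def blockProb (n : ℕ) (lam r w : ℝ) : Matrix (Fin 2) (Fin 2) ℝ :=
  (lam / n) • !![1, r; r, w]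

/-- The conditional expectation of the adjacency matrix given the degree parameters `θ`:
its entries are `θ i * θ j * P (c i) (c j)`. -/
def meanMatrix {n : ℕ} (n₁ : ℕ) (lam r w : ℝ) (θ : Fin n → ℝ) : Matrix (Fin n) (Fin n) ℝ :=
  Matrix.of fun i j => θ i * θ j * blockProb n lam r w (comm n₁ i) (comm n₁ j)

/-- Conditional probability, given the degree parameters `θ`, that the part of the adjacency
matrix below the diagonal is equal to `a`: independent Bernoulli entries. -/
def graphProb {n : ℕ} (n₁ : ℕ) (lam r w : ℝ) (θ : Fin n → ℝ) (a : Fin n → Fin n → Bool) : ℝ :=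
  ∏ i, ∏ j ∈ Finset.Iio i,
    if a i j then meanMatrix n₁ lam r w θ i j else 1 - meanMatrix n₁ lam r w θ i j

/-- `θ` and `A` are the degree parameters and the adjacency matrix of a degree-corrected
stochastic block model on `n` nodes, the first `n₁` of which form the first community.
The diagonal of `A` may be any measurable `0`-`1` vector (for instance `0`: no self-loops). -/
structure IsModel {Ω : Type*} [MeasurableSpace Ω] (Pr : Measure Ω) (n n₁ : ℕ)
    (lam r w ξ : ℝ) (ν : Measure ℝ) (θ : Ω → Fin n → ℝ)
    (A : Ω → Matrix (Fin n) (Fin n) ℝ) : Prop where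
  /-- The degree parameters are an i.i.d. sample from `ν`. -/
  measurable_θ : ∀ i, Measurable fun x => θ x i
  indep_θ : iIndepFun (fun i x => θ x i) Pr
  law_θ : ∀ i, Pr.map (fun x => θ x i) = ν
  /-- `ν` is supported by `[1 / ξ, ξ]` and has mean one. -/
  bound_ν : ∀ᵐ t ∂ν, t ∈ Set.Icc (1 / ξ) ξ
  mean_ν : ∫ t, t ∂ν = 1
  /-- The numbers `θ i * θ j * P k l` are probabilities. -/
  prob_le_one : ∀ᵐ x ∂Pr, ∀ i j k l, θ x i * θ x j * blockProb n lam r w k l ≤ 1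
  /-- `A` is a random symmetric matrix with entries in `{0, 1}`. -/
  measurable_A : ∀ i j, Measurable fun x => A x i j
  symm_A : ∀ x, (A x).IsSymm
  zero_one_A : ∀ x i j, A x i j = 0 ∨ A x i j = 1
  /-- Given `θ`, the entries of `A` below the diagonal are independent Bernoulli variables with
  means `θ i * θ j * P (c i) (c j)`. -/
  law_A : ∀ S : Set (Fin n → ℝ), MeasurableSet S → ∀ a : Fin n → Fin n → Bool,
    Pr.real {x | θ x ∈ S ∧ ∀ i j, j < i → A x i j = if a i j then 1 else 0} =
      ∫ x in θ ⁻¹' S, graphProb n₁ lam r w (θ x) a ∂Pr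

/-! ### The profile log-likelihood -/

section Likelihood

open scoped Matrix

variable {n : ℕ} (A : Matrix (Fin n) (Fin n) ℝ) (e : Fin n → ℝ)

def O11 : ℝ := (1 / 4) * ((1 + e) ⬝ᵥ (A *ᵥ (1 + e)))

def O22 : ℝ := (1 / 4) * ((1 - e) ⬝ᵥ (A *ᵥ (1 - e)))

def O12 : ℝ := (1 / 4) * ((1 + e) ⬝ᵥ (A *ᵥ (1 - e)))

def O1 : ℝ := O11 A e + O12 A e

def O2 : ℝ := O22 A e + O12 A e

/-- The profile log-likelihood of the model (with `0 log 0 = 0`). -/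
def QDC : ℝ :=
  O11 A e * Real.log (O11 A e) + O22 A e * Real.log (O22 A e)
    + 2 * O12 A e * Real.log (O12 A e)
    - 2 * O1 A e * Real.log (O1 A e) - 2 * O2 A e * Real.log (O2 A e)

end Likelihood

/-! ### The projected cube and the estimator -/

section Estimator

open scoped Matrix

/-- The projection `U [-1, 1]ⁿ` of the cube. -/
def projectedCube {n : ℕ} (U : Matrix (Fin 2) (Fin n) ℝ) : Set (Fin 2 → ℝ) :=
  (fun e : Fin n → ℝ => U *ᵥ e) '' {e | ∀ i, e i ∈ Set.Icc (-1 : ℝ) 1}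

/-- The label vectors `e ∈ {-1, 1}ⁿ` that project to extreme points of `U [-1, 1]ⁿ`. -/
def extremeLabels {n : ℕ} (U : Matrix (Fin 2) (Fin n) ℝ) : Set (Fin n → ℝ) :=
  {e | (∀ i, e i = -1 ∨ e i = 1) ∧ U *ᵥ e ∈ (projectedCube U).extremePoints ℝ}

/-- `e` maximizes the profile log-likelihood of `A` over the extreme labels of `U`. -/
def IsEstimate {n : ℕ} (A : Matrix (Fin n) (Fin n) ℝ) (U : Matrix (Fin 2) (Fin n) ℝ)
    (e : Fin n → ℝ) : Prop :=
  e ∈ extremeLabels U ∧ ∀ e' ∈ extremeLabels U, QDC A e' ≤ QDC A e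

/-- The rows of `U` are orthonormal eigenvectors of the symmetric matrix `B` for its two
leading eigenvalues, eigenvalues being compared through `key` (`key = abs`: by absolute value;
`key = id`: by value). All choices of the eigenvectors are admitted. -/
def IsLeadingEigenvectors {n : ℕ} (key : ℝ → ℝ) (B : Matrix (Fin n) (Fin n) ℝ)
    (U : Matrix (Fin 2) (Fin n) ℝ) : Prop :=
  U * Uᵀ = 1 ∧
    ∃ ρ : Fin 2 → ℝ, (∀ k, B *ᵥ U k = ρ k • U k) ∧
      ∀ (v : Fin n → ℝ) (μ : ℝ), v ≠ 0 → B *ᵥ v = μ • v → U *ᵥ v = 0 → ∀ k, key μ ≤ key (ρ k)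

end Estimator

/-! ### Norms and errors -/

section Norms

open scoped Matrix.Norms.L2Operator

/-- The spectral norm. -/
def specNorm {n : ℕ} (U : Matrix (Fin 2) (Fin n) ℝ) : ℝ := ‖U‖

end Norms

/-- The square of the Euclidean norm. -/
def sqNorm {n : ℕ} (v : Fin n → ℝ) : ℝ := ‖WithLp.toLp 2 v‖ ^ 2

/-- The fraction of nodes misclustered by `e`, up to exchanging the two labels. -/
def misclustered {n : ℕ} (c e : Fin n → ℝ) : ℝ :=
  min ({i | e i ≠ c i} : Set (Fin n)).ncard ({i | -e i ≠ c i} : Set (Fin n)).ncard / (n : ℝ)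

end

end DCSBM

namespace DCSBM
open MeasureTheory ProbabilityTheory

noncomputable section

/-! ### Entropy inequalities -/

/-! Up to a term that depends only on the sum of all entries of `A`, the likelihood `QDC A e` is the
mutual information of the two by two table of block sums, so the proof studies what relabelling does
to this information. For the mean matrix, mislabelling proportions α and β of the degree masses of
the two communities sends both rows and columns of the true table through a channel with flip
probabilities α, β. The column channel cannot increase the information. The row channel is `1 - α -
β` times the identity plus a part that forgets the row (after exchanging the rows if α + β > 1), so
by convexity the information drops by at least the proportion `min (α + β) (2 - α - β)`
(`profile_mislabel_le`). The true table has positive information because its determinant is a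
positive multiple of `w - r ^ 2` (`profile_info_ge`). Hence the mean likelihood loses an amount
linear in the mislabelled mass (`exists_profile_gap`).

The estimate beats every extreme label, so one good competitor is enough. A linear functional `a` on
the projected cube is maximized at an extreme label with the signs of `Uᵀ a`; if `Uᵀ a` is close to
the signed degree vector θc, each wrong sign costs at least `1 / ξ ^ 2` in squared distance
(`exists_extremeLabels_near`). The normalized block sums of `A` are within O(1/√lam) of their means
for all labels at once, by Chernoff bounds and a union over 4ⁿ pairs of sets. The modulus of
continuity of x log x turns this into log n/√lam, and `exists_misclustered_le` combines the gap, the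
competitor and the noise.

It remains to approximate θc from the row space of `U`. It lies in the range of the rank-two mean
matrix, hence in the row space of `V`, and the residual is controlled by `U - V`. If `U` comes from
`A`, then θc = B z with B the mean matrix and z of norm O(√n/lam), and projecting off the leading
eigenvectors of `A` leaves at most 2‖A - B‖‖z‖ (`leading_residual_le`). As the number of errors is
quadratic in the residual, the crude noise bound O(lam^(3/4)) suffices. It follows from trace
moments of order about 2 log n: integration by parts in each Bernoulli variable bounds a moment by
the preceding even one times the maximal degree (`bernE_trace_pow_le`, `bernE_trace_pow_le_pow`). -/

/-- The function `x log x`. -/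
def xlog (x : ℝ) : ℝ := x * Real.log x

/-- The profile log-likelihood as a function of the block sums. -/
def profile (a b d : ℝ) : ℝ :=
  xlog a + xlog d + 2 * xlog b - 2 * xlog (a + b) - 2 * xlog (d + b)

/-- Tangent plane of the convex function x log (x / y), touching along x = t y. Being linear in (x,
y), such bounds can be added, which gives the log-sum inequality; with y = 1 they give tangent lines
of x log x. The hypothesis `h` is absolute continuity. -/
lemma tangent_mul_log {x y t : ℝ} (hx : 0 ≤ x) (hy : 0 ≤ y) (h : y = 0 → x = 0) (ht : 0 < t) :
    x * Real.log t + x - t * y ≤ x * (Real.log x - Real.log y) := by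
  rcases hx.eq_or_lt with rfl | hx
  · have := mul_nonneg ht.le hy
    simp; exact this
  have hy' : 0 < y := lt_of_le_of_ne hy fun h0 => hx.ne' (h h0.symm)
  have h1 : Real.log (t * y / x) ≤ t * y / x - 1 :=
    Real.log_le_sub_one_of_pos (by positivity)
  rw [Real.log_div (by positivity) hx.ne', Real.log_mul ht.ne' hy'.ne'] at h1
  have h2 := mul_le_mul_of_nonneg_left h1 hx.le
  have h3 : x * (t * y / x - 1) = t * y - x := by field_simp
  rw [h3] at h2
  linarith

/-- The log-sum inequality for two summands. -/
lemma log_sum_two {x₁ x₂ y₁ y₂ : ℝ} (hx₁ : 0 ≤ x₁) (hx₂ : 0 ≤ x₂) (hy₁ : 0 ≤ y₁) (hy₂ : 0 ≤ y₂)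
    (h₁ : y₁ = 0 → x₁ = 0) (h₂ : y₂ = 0 → x₂ = 0) :
    (x₁ + x₂) * (Real.log (x₁ + x₂) - Real.log (y₁ + y₂)) ≤
      x₁ * (Real.log x₁ - Real.log y₁) + x₂ * (Real.log x₂ - Real.log y₂) := by
  rcases (add_nonneg hx₁ hx₂).eq_or_lt with h | h
  · have e1 : x₁ = 0 := by linarith
    have e2 : x₂ = 0 := by linarith
    simp [e1, e2]
  have hy : 0 < y₁ + y₂ := by
    rcases (add_nonneg hy₁ hy₂).eq_or_lt with h' | h'
    · have e1 := h₁ (by linarith)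
      have e2 := h₂ (by linarith)
      rw [e1, e2] at h; simp at h
    · exact h'
  -- Both summands use the tangent at the common ratio, for which the linear corrections cancel in
  -- the sum.
  have ht : 0 < (x₁ + x₂) / (y₁ + y₂) := div_pos h hy
  have t1 := tangent_mul_log hx₁ hy₁ h₁ ht
  have t2 := tangent_mul_log hx₂ hy₂ h₂ ht
  rw [Real.log_div h.ne' hy.ne'] at t1 t2
  have : (x₁ + x₂) / (y₁ + y₂) * y₁ + (x₁ + x₂) / (y₁ + y₂) * y₂ = x₁ + x₂ := by
    field_simp
  linarith

/-- Merging a mixture of two classes does not increase the relative entropy. -/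
lemma log_sum_mixture {x₁ x₂ y₁ y₂ s t : ℝ} (hx₁ : 0 ≤ x₁) (hx₂ : 0 ≤ x₂) (hy₁ : 0 < y₁)
    (hy₂ : 0 < y₂) (hs : 0 ≤ s) (ht : 0 ≤ t) :
    (s * x₁ + t * x₂) * (Real.log (s * x₁ + t * x₂) - Real.log (s * y₁ + t * y₂)) ≤
      s * (x₁ * (Real.log x₁ - Real.log y₁)) + t * (x₂ * (Real.log x₂ - Real.log y₂)) := by
  have key : ∀ {s x y : ℝ}, 0 ≤ s → 0 ≤ x → 0 < y →
      s * x * (Real.log (s * x) - Real.log (s * y)) = s * (x * (Real.log x - Real.log y)) := by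
    intro s x y hs hx hy
    rcases hs.eq_or_lt with rfl | hs
    · simp
    rcases hx.eq_or_lt with rfl | hx
    · simp
    rw [Real.log_mul hs.ne' hx.ne', Real.log_mul hs.ne' hy.ne']; ring
  have := log_sum_two (mul_nonneg hs hx₁) (mul_nonneg ht hx₂) (mul_nonneg hs hy₁.le)
    (mul_nonneg ht hy₂.le)
    (fun h => by rcases mul_eq_zero.1 h with h | h; · simp [h]
                 · exact absurd h hy₁.ne')
    (fun h => by rcases mul_eq_zero.1 h with h | h; · simp [h]
                 · exact absurd h hy₂.ne')
  rwa [key hs hx₁ hy₁, key ht hx₂ hy₂] at this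

/-- The mutual information (up to normalization) of a two by two table. -/
def tableInfo (a b c d : ℝ) : ℝ :=
  a * (Real.log a - Real.log (a + b) - Real.log (a + c))
    + b * (Real.log b - Real.log (a + b) - Real.log (b + d))
    + c * (Real.log c - Real.log (c + d) - Real.log (a + c))
    + d * (Real.log d - Real.log (c + d) - Real.log (b + d))

/-- For a symmetric table the row sums and column sums agree. Adding `xlog` of the total gives the
usual unnormalized mutual information, which is nonnegative. -/
lemma profile_eq_tableInfo (a b d : ℝ) : profile a b d = tableInfo a b b d := by
  unfold profile tableInfo xlog
  rw [add_comm b d]; ring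

lemma tableInfo_swap (a b c d : ℝ) : tableInfo a b c d = tableInfo c d a b := by
  unfold tableInfo
  rw [add_comm c a, add_comm d b]; ring

/-- Data processing: splitting and merging the columns of a table does not increase its
information. -/
lemma tableInfo_columns_le {a b c d α β : ℝ} (ha : 0 ≤ a) (hb : 0 ≤ b) (hc : 0 ≤ c) (hd : 0 ≤ d)
    (h1 : 0 < a + c) (h2 : 0 < b + d) (hα : 0 ≤ α) (hα' : α ≤ 1) (hβ : 0 ≤ β) (hβ' : β ≤ 1) :
    tableInfo ((1 - α) * a + β * b) (α * a + (1 - β) * b) ((1 - α) * c + β * d)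
      (α * c + (1 - β) * d) ≤ tableInfo a b c d := by
  have hα1 := sub_nonneg.2 hα'
  have hβ1 := sub_nonneg.2 hβ'
  -- The reference measure is the vector of column sums, which is mixed in the same way as the
  -- columns; the row sums do not change.
  have e1 := log_sum_mixture ha hb h1 h2 hα1 hβ
  have e2 := log_sum_mixture ha hb h1 h2 hα hβ1
  have e3 := log_sum_mixture hc hd h1 h2 hα1 hβ
  have e4 := log_sum_mixture hc hd h1 h2 hα hβ1
  unfold tableInfo
  rw [show (1 - α) * a + β * b + (α * a + (1 - β) * b) = a + b by ring,
    show (1 - α) * c + β * d + (α * c + (1 - β) * d) = c + d by ring,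
    show (1 - α) * a + β * b + ((1 - α) * c + β * d) = (1 - α) * (a + c) + β * (b + d) by ring,
    show α * a + (1 - β) * b + (α * c + (1 - β) * d) = α * (a + c) + (1 - β) * (b + d) by ring]
  linarith

/-- A table whose rows are mixed with the total has its information reduced linearly. -/
lemma tableInfo_rows_le {a b c d s t u : ℝ} (ha : 0 ≤ a) (hb : 0 ≤ b) (hc : 0 ≤ c) (hd : 0 ≤ d)
    (h1 : 0 < a + c) (h2 : 0 < b + d) (h3 : 0 < a + b) (h4 : 0 < c + d) (hs : 0 ≤ s)
    (ht : 0 ≤ t) (hu : 0 ≤ u) (hsum : s + t + u = 1) :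
    tableInfo (s * a + t * (a + c)) (s * b + t * (b + d)) (s * c + u * (a + c))
      (s * d + u * (b + d)) ≤ s * tableInfo a b c d - (t + u) * xlog (a + b + c + d) := by
  have hL : 0 < a + c + (b + d) := by linarith
  -- Each new row is a mixture of an old row and the row of column totals. Relative to the column
  -- sums, the latter component contributes only minus the logarithm of the grand total, so it
  -- carries no information.
  have e1 := log_sum_mixture (x₂ := a + c) ha h1.le h3 hL hs ht
  have e2 := log_sum_mixture (x₂ := b + d) hb h2.le h3 hL hs ht
  have e3 := log_sum_mixture (x₂ := a + c) hc h1.le h4 hL hs hu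
  have e4 := log_sum_mixture (x₂ := b + d) hd h2.le h4 hL hs hu
  unfold tableInfo xlog
  rw [show s * a + t * (a + c) + (s * b + t * (b + d)) = s * (a + b) + t * (a + c + (b + d)) by
      ring,
    show s * c + u * (a + c) + (s * d + u * (b + d)) = s * (c + d) + u * (a + c + (b + d)) by ring,
    show s * a + t * (a + c) + (s * c + u * (a + c)) = (s + t + u) * (a + c) by ring,
    show s * b + t * (b + d) + (s * d + u * (b + d)) = (s + t + u) * (b + d) by ring, hsum,
    show a + b + c + d = a + c + (b + d) by ring, one_mul, one_mul]
  linarith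

/-- The block sums obtained from true block sums `a, b, d` when a proportion `α` of the first and
a proportion `β` of the second class is mislabelled have a likelihood smaller by an amount
linear in these proportions. -/
lemma profile_mislabel_le {a b d α β : ℝ} (ha : 0 ≤ a) (hb : 0 ≤ b) (hd : 0 ≤ d)
    (h1 : 0 < a + b) (h2 : 0 < b + d) (hα : 0 ≤ α) (hα' : α ≤ 1) (hβ : 0 ≤ β) (hβ' : β ≤ 1)
    (hI : 0 ≤ profile a b d + xlog (a + 2 * b + d)) :
    min (α + β) (2 - α - β) * (profile a b d + xlog (a + 2 * b + d)) ≤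
      profile a b d -
      profile ((1 - α) * ((1 - α) * a + β * b) + β * ((1 - α) * b + β * d))
        (α * ((1 - α) * a + β * b) + (1 - β) * ((1 - α) * b + β * d))
        (α * (α * a + (1 - β) * b) + (1 - β) * (α * b + (1 - β) * d)) := by
  have hα1 := sub_nonneg.2 hα'
  have hβ1 := sub_nonneg.2 hβ'
  -- The columns are first left unmixed: only the row channel acts on the right-hand side, and
  -- merging columns loses information.
  have step1 : profile ((1 - α) * ((1 - α) * a + β * b) + β * ((1 - α) * b + β * d))
        (α * ((1 - α) * a + β * b) + (1 - β) * ((1 - α) * b + β * d))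
        (α * (α * a + (1 - β) * b) + (1 - β) * (α * b + (1 - β) * d)) ≤
      tableInfo ((1 - α) * a + β * b) ((1 - α) * b + β * d) (α * a + (1 - β) * b)
        (α * b + (1 - β) * d) := by
    have := tableInfo_columns_le (a := (1 - α) * a + β * b) (b := (1 - α) * b + β * d)
      (c := α * a + (1 - β) * b) (d := α * b + (1 - β) * d) (α := α) (β := β) (by positivity)
      (by positivity) (by positivity) (by positivity) (by linarith) (by linarith) hα hα' hβ hβ'
    rw [profile_eq_tableInfo]
    convert this using 2
    ring
  have hs : xlog (a + b + b + d) = xlog (a + 2 * b + d) := by ring_nf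
  have h1' : 0 < b + d := h2
  rw [profile_eq_tableInfo a b d] at *
  -- Write the row channel as `1 - α - β` times the identity plus weights β, α on the total row. If
  -- α + β > 1 the first coefficient is negative, and the same is done after exchanging the two
  -- output rows.
  rcases le_total (α + β) 1 with h | h
  · have := tableInfo_rows_le (a := a) (b := b) (c := b) (d := d) (s := 1 - α - β) (t := β)
      (u := α) ha hb hb hd h1 h2 h1 h2 (by linarith) hβ hα (by ring)
    rw [hs] at this
    have e : tableInfo ((1 - α) * a + β * b) ((1 - α) * b + β * d) (α * a + (1 - β) * b)
        (α * b + (1 - β) * d) = tableInfo ((1 - α - β) * a + β * (a + b))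
        ((1 - α - β) * b + β * (b + d)) ((1 - α - β) * b + α * (a + b))
        ((1 - α - β) * d + α * (b + d)) := by
      congr 1 <;> ring
    have hm := mul_le_mul_of_nonneg_right (min_le_left (α + β) (2 - α - β)) hI
    rw [e] at step1
    linarith
  · have := tableInfo_rows_le (a := a) (b := b) (c := b) (d := d) (s := α + β - 1) (t := 1 - β)
      (u := 1 - α) ha hb hb hd h1 h2 h1 h2 (by linarith) hβ1 hα1 (by ring)
    rw [hs] at this
    have e : tableInfo ((1 - α) * a + β * b) ((1 - α) * b + β * d) (α * a + (1 - β) * b)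
        (α * b + (1 - β) * d) = tableInfo ((α + β - 1) * a + (1 - β) * (a + b))
        ((α + β - 1) * b + (1 - β) * (b + d)) ((α + β - 1) * b + (1 - α) * (a + b))
        ((α + β - 1) * d + (1 - α) * (b + d)) := by
      rw [tableInfo_swap]
      congr 1 <;> ring
    have hm := mul_le_mul_of_nonneg_right (min_le_right (α + β) (2 - α - β)) hI
    rw [e] at step1
    linarith

/-- Relative entropy dominates the squared Hellinger distance. -/
lemma hellinger_le {x y : ℝ} (hx : 0 ≤ x) (hy : 0 < y) :
    x - y + (√x - √y) ^ 2 ≤ x * (Real.log x - Real.log y) := by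
  rcases hx.eq_or_lt with rfl | hx
  · simp [Real.sq_sqrt hy.le]
  have h1 : Real.log (√y / √x) ≤ √y / √x - 1 := Real.log_le_sub_one_of_pos (by positivity)
  rw [Real.log_div (by positivity) (by positivity), Real.log_sqrt hx.le, Real.log_sqrt hy.le] at h1
  have h2 := mul_le_mul_of_nonneg_left h1 hx.le
  have h3 : x * (√y / √x - 1) = √x * √y - x := by
    have : x = √x * √x := (Real.mul_self_sqrt hx.le).symm
    have h0 : √x ≠ 0 := by positivity
    field_simp
    linear_combination √y * this
  rw [h3] at h2
  have := Real.sq_sqrt hx.le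
  have := Real.sq_sqrt hy.le
  nlinarith

lemma sq_le_hellinger {x y B : ℝ} (hx : 0 ≤ x) (hy : 0 ≤ y) (hB : 0 < B) (hxB : x ≤ B)
    (hyB : y ≤ B) : (x - y) ^ 2 / (4 * B) ≤ (√x - √y) ^ 2 := by
  rw [div_le_iff₀ (by positivity)]
  have h1 := Real.sq_sqrt hx
  have h2 := Real.sq_sqrt hy
  have h3 : (x - y) ^ 2 = (√x - √y) ^ 2 * (√x + √y) ^ 2 := by
    rw [← mul_pow]; congr 1; nlinarith
  rw [h3]
  apply mul_le_mul_of_nonneg_left _ (sq_nonneg _)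
  nlinarith [sq_nonneg (√x - √y)]

/-- A lower bound for the information of a table with nonzero determinant. -/
lemma profile_info_ge {a b d B : ℝ} (ha : 0 ≤ a) (hb : 0 ≤ b) (hd : 0 ≤ d)
    (h1 : 0 < a + b) (h2 : 0 < b + d) (hB : a + 2 * b + d ≤ B) :
    (a * d - b ^ 2) ^ 2 / B ^ 3 ≤ profile a b d + xlog (a + 2 * b + d) := by
  obtain ⟨L, hL⟩ : ∃ L, L = a + 2 * b + d := ⟨_, rfl⟩
  have hLp : 0 < L := by linarith
  have hBp : 0 < B := by linarith
  -- Compare an entry x with the product u v / L of its marginals. For a symmetric table the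
  -- difference s is ± det / L; the linear terms s cancel over the four entries, and the four
  -- Hellinger terms remain.
  have dev : ∀ {x u v s : ℝ}, 0 ≤ x → x ≤ L → 0 < u → 0 < v → u ≤ L → v ≤ L →
      x - u * v / L = s → s ^ 2 = ((a * d - b ^ 2) / L) ^ 2 →
      s + (a * d - b ^ 2) ^ 2 / L ^ 2 / (4 * L) ≤
        x * (Real.log x - Real.log u - Real.log v + Real.log L) := by
    intro x u v s hx hxL hu hv huL hvL hs hsq
    rw [div_pow] at hsq
    have hy : 0 < u * v / L := by positivity
    have e1 := hellinger_le hx hy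
    have hyL : u * v / L ≤ L := by
      rw [div_le_iff₀ hLp]; exact mul_le_mul huL hvL hv.le hLp.le
    have e2 := sq_le_hellinger hx hy.le hLp hxL hyL
    rw [hs, hsq] at e2
    rw [Real.log_div (by positivity) hLp.ne', Real.log_mul hu.ne' hv.ne'] at e1
    have e3 : x * (Real.log x - Real.log u - Real.log v + Real.log L) =
        x * (Real.log x - (Real.log u + Real.log v - Real.log L)) := by ring
    rw [e3]; linarith
  have k1 := dev (x := a) (u := a + b) (v := a + b) (s := (a * d - b ^ 2) / L) ha (by linarith)
    h1 h1 (by linarith) (by linarith)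
    (by rw [eq_div_iff hLp.ne', sub_mul, div_mul_cancel₀ _ hLp.ne', hL]; ring) rfl
  have k2 := dev (x := b) (u := a + b) (v := b + d) (s := - ((a * d - b ^ 2) / L)) hb (by linarith)
    h1 h2 (by linarith) (by linarith)
    (by rw [← neg_div, eq_div_iff hLp.ne', sub_mul, div_mul_cancel₀ _ hLp.ne', hL]; ring)
    (by ring)
  have k3 := dev (x := d) (u := b + d) (v := b + d) (s := (a * d - b ^ 2) / L) hd (by linarith)
    h2 h2 (by linarith) (by linarith)
    (by rw [eq_div_iff hLp.ne', sub_mul, div_mul_cancel₀ _ hLp.ne', hL]; ring) rfl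
  have hfin : profile a b d + xlog (a + 2 * b + d) =
      a * (Real.log a - Real.log (a + b) - Real.log (a + b) + Real.log L)
      + 2 * (b * (Real.log b - Real.log (a + b) - Real.log (b + d) + Real.log L))
      + d * (Real.log d - Real.log (b + d) - Real.log (b + d) + Real.log L) := by
    unfold profile xlog
    rw [← hL, add_comm d b]
    conv_lhs => rw [hL]
    rw [← hL]
    nth_rewrite 1 [hL]
    ring
  rw [hfin]
  have hle : (a * d - b ^ 2) ^ 2 / B ^ 3 ≤ (a * d - b ^ 2) ^ 2 / L ^ 3 := by
    apply div_le_div_of_nonneg_left (sq_nonneg _) (by positivity)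
    exact pow_le_pow_left₀ hLp.le (by linarith) 3
  have h4 : (a * d - b ^ 2) ^ 2 / L ^ 2 / (4 * L) * 4 = (a * d - b ^ 2) ^ 2 / L ^ 3 := by
    field_simp
  linarith

/-! ### The modulus of continuity of `x log x` -/

/-- An increase is bounded by the tangent at the larger point, with slope at most 1 + log B. A
decrease is bounded by superadditivity, xlog x + xlog t ≤ xlog (x + t), and then by the tangent of x
log x at ε. The absolute value of log ε avoids any smallness assumption on ε. -/
lemma xlog_sub_le {x y B ε : ℝ} (hx : 0 ≤ x) (hy : 0 ≤ y) (hxB : x ≤ B) (hyB : y ≤ B)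
    (hB : 1 ≤ B) (hε : |x - y| ≤ ε) : |xlog x - xlog y| ≤ ε * (1 + |Real.log ε| + Real.log B) := by
  wlog h : x ≤ y generalizing x y
  · rw [abs_sub_comm]
    exact this hy hx hyB hxB (by rwa [abs_sub_comm]) (by linarith)
  have hlogB : 0 ≤ Real.log B := Real.log_nonneg hB
  obtain ⟨t, ht⟩ : ∃ t, t = y - x := ⟨_, rfl⟩
  have ht0 : 0 ≤ t := by linarith
  rw [abs_sub_comm, abs_of_nonneg (by linarith), ← ht] at hε
  have hε0 : 0 ≤ ε := ht0.trans hε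
  have hpos : 0 ≤ ε * |Real.log ε| := by positivity
  rcases ht0.eq_or_lt with h0 | h0
  · have : x = y := by linarith
    rw [this, sub_self, abs_zero]; positivity
  have hyp : 0 < y := by linarith
  have hεp : 0 < ε := by linarith
  have up : xlog y - xlog x ≤ t * (1 + Real.log B) := by
    have := tangent_mul_log (x := x) (y := 1) (t := y) hx zero_le_one (by simp) hyp
    simp only [Real.log_one, sub_zero, mul_one] at this
    unfold xlog
    have h2 : Real.log y ≤ Real.log B := Real.log_le_log hyp hyB
    have h3 := mul_le_mul_of_nonneg_left h2 h0.le
    have h4 : y * Real.log y - x * Real.log y = t * Real.log y := by rw [ht]; ring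
    linarith
  have lo : - (ε + ε * |Real.log ε|) ≤ xlog y - xlog x := by
    have h1 : xlog x + xlog t ≤ xlog y := by
      unfold xlog
      have hy' : y = x + t := by linarith
      have : x * Real.log x ≤ x * Real.log y := by
        rcases hx.eq_or_lt with rfl | hx
        · simp
        · exact mul_le_mul_of_nonneg_left (Real.log_le_log hx h) hx.le
      have h3 : t * Real.log t ≤ t * Real.log y :=
        mul_le_mul_of_nonneg_left (Real.log_le_log h0 (by linarith)) h0.le
      have h4 : y * Real.log y = x * Real.log y + t * Real.log y := by rw [ht]; ring
      linarith
    have h2 : t * Real.log ε + t - ε ≤ xlog t := by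
      have := tangent_mul_log (x := t) (y := 1) (t := ε) h0.le zero_le_one (by simp) hεp
      simp only [Real.log_one, sub_zero, mul_one] at this
      exact this
    have h3 : - (ε * |Real.log ε|) ≤ t * Real.log ε := by
      have : -|Real.log ε| ≤ Real.log ε := neg_abs_le _
      have h5 := mul_le_mul_of_nonneg_left this h0.le
      have h6 := mul_le_mul_of_nonneg_right hε (abs_nonneg (Real.log ε))
      linarith
    linarith
  rw [abs_sub_comm, abs_le]
  constructor
  · have : 0 ≤ ε * Real.log B := by positivity
    linarith
  · have : t * (1 + Real.log B) ≤ ε * (1 + Real.log B) :=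
      mul_le_mul_of_nonneg_right hε (by linarith)
    linarith

/-- The entries move by ε with weights 1, 1, 2 and the two marginals by 2ε with weight 2 each, a
total of 12; the constant 16 leaves slack. -/
lemma profile_sub_le {a b d a' b' d' B ε : ℝ} (ha : 0 ≤ a) (hb : 0 ≤ b) (hd : 0 ≤ d)
    (ha' : 0 ≤ a') (hb' : 0 ≤ b') (hd' : 0 ≤ d') (hB : 1 ≤ B) (hab : a + b ≤ B) (hbd : d + b ≤ B)
    (hab' : a' + b' ≤ B) (hbd' : d' + b' ≤ B) (h1 : |a - a'| ≤ ε) (h2 : |b - b'| ≤ ε)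
    (h3 : |d - d'| ≤ ε) :
    |profile a b d - profile a' b' d'| ≤ 16 * ε * (1 + |Real.log (2 * ε)| + |Real.log ε|
      + Real.log B) := by
  have e1 := xlog_sub_le ha ha' (by linarith) (by linarith) hB h1
  have e2 := xlog_sub_le hb hb' (by linarith) (by linarith) hB h2
  have e3 := xlog_sub_le hd hd' (by linarith) (by linarith) hB h3
  have e4 := xlog_sub_le (x := a + b) (y := a' + b') (ε := 2 * ε) (by positivity) (by positivity)
    hab hab' hB (by rw [add_sub_add_comm]; exact (abs_add_le _ _).trans (by linarith))
  have e5 := xlog_sub_le (x := d + b) (y := d' + b') (ε := 2 * ε) (by positivity) (by positivity)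
    hbd hbd' hB (by rw [add_sub_add_comm]; exact (abs_add_le _ _).trans (by linarith))
  have hε0 : 0 ≤ ε := (abs_nonneg _).trans h1
  have p1 : 0 ≤ ε * |Real.log ε| := by positivity
  have p2 : 0 ≤ ε * |Real.log (2 * ε)| := by positivity
  have p3 : 0 ≤ ε * Real.log B := mul_nonneg hε0 (Real.log_nonneg hB)
  unfold profile
  rw [abs_le] at *
  constructor <;> nlinarith

/-- Rescaling the block sums changes the likelihood by a quantity that depends on the total only. -/
lemma profile_mul {s a b d : ℝ} (hs : 0 < s) :
    profile (s * a) (s * b) (s * d) =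
      s * profile a b d - s * Real.log s * (a + 2 * b + d) := by
  have key : ∀ x, xlog (s * x) = s * xlog x + s * Real.log s * x := by
    intro x
    unfold xlog
    by_cases hx : x = 0
    · simp [hx]
    rw [Real.log_mul hs.ne' hx]; ring
  unfold profile
  rw [← mul_add, ← mul_add, key, key, key, key, key]
  ring

/-! ### Spectral estimates for real symmetric matrices -/

section Spectral

open scoped Matrix

variable {m : Type*} [Fintype m]

/-- A real symmetric matrix is diagonalized by an orthogonal matrix. -/
lemma exists_orthogonal_diagonalization [DecidableEq m] {B : Matrix m m ℝ} (hB : B.IsSymm) :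
    ∃ (Q : Matrix m m ℝ) (d : m → ℝ), Qᵀ * Q = 1 ∧ Q * Qᵀ = 1 ∧
      B = Q * Matrix.diagonal d * Qᵀ := by
  have hH : B.IsHermitian := by
    rw [Matrix.IsHermitian, Matrix.conjTranspose_eq_transpose_of_trivial]; exact hB
  refine ⟨hH.eigenvectorUnitary, hH.eigenvalues, ?_, ?_, ?_⟩
  · have := Unitary.coe_star_mul_self hH.eigenvectorUnitary
    rwa [Matrix.star_eq_conjTranspose, Matrix.conjTranspose_eq_transpose_of_trivial] at this
  · have := Unitary.coe_mul_star_self hH.eigenvectorUnitary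
    rwa [Unitary.coe_star, Matrix.star_eq_conjTranspose, Matrix.conjTranspose_eq_transpose_of_trivial] at this
  · conv_lhs => rw [hH.spectral_theorem]
    rw [Unitary.conjStarAlgAut_apply, Matrix.star_eq_conjTranspose,
      Matrix.conjTranspose_eq_transpose_of_trivial]
    rfl

lemma dotProduct_mulVec_comm {B : Matrix m m ℝ} (hB : B.IsSymm) (x y : m → ℝ) :
    x ⬝ᵥ (B *ᵥ y) = (B *ᵥ x) ⬝ᵥ y := by
  rw [Matrix.dotProduct_mulVec, ← Matrix.mulVec_transpose, hB.eq]

lemma transpose_mulVec_dotProduct {k : Type*} [Fintype k] (Q : Matrix k m ℝ) (x : k → ℝ)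
    (y : m → ℝ) : (Qᵀ *ᵥ x) ⬝ᵥ y = x ⬝ᵥ (Q *ᵥ y) := by
  rw [Matrix.mulVec_transpose, Matrix.dotProduct_mulVec]

lemma dotProduct_self_nonneg' (x : m → ℝ) : 0 ≤ x ⬝ᵥ x :=
  Finset.sum_nonneg fun i _ => mul_self_nonneg (x i)

/-- A symmetric matrix all of whose eigenvalues are at most `b` in absolute value has norm at
most `b`. -/
lemma sq_mulVec_le_of_eigenvalues [DecidableEq m] {B : Matrix m m ℝ} (hB : B.IsSymm) {b : ℝ}
    (h : ∀ (v : m → ℝ) (μ : ℝ), v ≠ 0 → B *ᵥ v = μ • v → |μ| ≤ b) (x : m → ℝ) :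
    (B *ᵥ x) ⬝ᵥ (B *ᵥ x) ≤ b ^ 2 * (x ⬝ᵥ x) := by
  obtain ⟨Q, d, hQ, hQ', rfl⟩ := exists_orthogonal_diagonalization hB
  have hd : ∀ j, |d j| ≤ b := by
    intro j
    apply h (Q *ᵥ Pi.single j 1) (d j)
    · intro h0
      have := congrArg (fun v => Qᵀ *ᵥ v) h0
      simp only [Matrix.mulVec_mulVec, hQ, Matrix.one_mulVec, Matrix.mulVec_zero] at this
      have := congrFun this j
      simp at this
    · rw [Matrix.mulVec_mulVec, Matrix.mul_assoc, hQ, Matrix.mul_one, ← Matrix.mulVec_mulVec,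
        Matrix.diagonal_mulVec_single, mul_one, ← Matrix.mulVec_smul]
      congr 1
      ext i
      simp [Pi.single_apply]
  have iso : ∀ y : m → ℝ, (Q *ᵥ y) ⬝ᵥ (Q *ᵥ y) = y ⬝ᵥ y := by
    intro y
    have := transpose_mulVec_dotProduct Qᵀ y (Q *ᵥ y)
    rw [Matrix.transpose_transpose] at this
    rw [this, Matrix.mulVec_mulVec, hQ, Matrix.one_mulVec]
  have iso' : (Qᵀ *ᵥ x) ⬝ᵥ (Qᵀ *ᵥ x) = x ⬝ᵥ x := by
    rw [← iso, Matrix.mulVec_mulVec, hQ', Matrix.one_mulVec]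
  rw [← Matrix.mulVec_mulVec, ← Matrix.mulVec_mulVec, iso, ← iso', dotProduct, dotProduct,
    Finset.mul_sum]
  apply Finset.sum_le_sum
  intro j _
  rw [Matrix.mulVec_diagonal]
  have := sq_le_sq' (by linarith [neg_abs_le (d j), hd j]) ((le_abs_self _).trans (hd j))
  nlinarith [mul_self_nonneg ((Qᵀ *ᵥ x) j)]

end Spectral

/-! ### Perturbation of leading eigenvectors -/

section Perturbation

open scoped Matrix

variable {n : ℕ}

lemma row_dotProduct_row {U : Matrix (Fin 2) (Fin n) ℝ} (hU : U * Uᵀ = 1) (k l : Fin 2) :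
    U k ⬝ᵥ U l = if k = l then 1 else 0 := by
  have := congrFun (congrFun hU k) l
  rwa [Matrix.mul_apply, Matrix.one_apply] at this

lemma dotProduct_sq_le (x y : Fin n → ℝ) : (x ⬝ᵥ y) ^ 2 ≤ (x ⬝ᵥ x) * (y ⬝ᵥ y) := by
  have := Finset.sum_mul_sq_le_sq_mul_sq Finset.univ x y
  simpa [dotProduct, pow_two] using this

/-- The eigenvalues of a symmetric matrix other than the two leading ones are bounded by its
distance to a matrix of rank two. -/
lemma abs_eigenvalue_le_of_leading {A B : Matrix (Fin n) (Fin n) ℝ}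
    {U : Matrix (Fin 2) (Fin n) ℝ} (g : Matrix (Fin 2) (Fin n) ℝ)
    (hg : ∀ x, g *ᵥ x = 0 → B *ᵥ x = 0) {b : ℝ} (hb : 0 ≤ b)
    (hAB : ∀ x, ((A - B) *ᵥ x) ⬝ᵥ ((A - B) *ᵥ x) ≤ b ^ 2 * (x ⬝ᵥ x))
    (hU : IsLeadingEigenvectors abs A U ∨
      ((∀ x, 0 ≤ x ⬝ᵥ (B *ᵥ x)) ∧ IsLeadingEigenvectors id A U))
    {v : Fin n → ℝ} {μ : ℝ} (hv : v ≠ 0) (hAv : A *ᵥ v = μ • v) (hUv : U *ᵥ v = 0) :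
    |μ| ≤ b := by
  have hvv : 0 < v ⬝ᵥ v := by
    refine lt_of_le_of_ne (dotProduct_self_nonneg' v) fun h => hv ?_
    exact dotProduct_self_eq_zero.1 h.symm
  have quad : ∀ x : Fin n → ℝ, |x ⬝ᵥ ((A - B) *ᵥ x)| ≤ b * (x ⬝ᵥ x) := by
    intro x
    have h1 := dotProduct_sq_le x ((A - B) *ᵥ x)
    have h2 := mul_le_mul_of_nonneg_left (hAB x) (dotProduct_self_nonneg' x)
    apply abs_le_of_sq_le_sq _ (mul_nonneg hb (dotProduct_self_nonneg' x))
    nlinarith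
  obtain ⟨hUU, ρ, hρ⟩ : U * Uᵀ = 1 ∧ ∃ ρ : Fin 2 → ℝ, ∀ k, A *ᵥ U k = ρ k • U k := by
    rcases hU with ⟨h1, ρ, h2, -⟩ | ⟨-, h1, ρ, h2, -⟩ <;> exact ⟨h1, ρ, h2⟩
  -- a combination of the three eigenvectors in the kernel of `B`
  obtain ⟨c, hc0, hc⟩ : ∃ c : Fin 3 → ℝ, c ≠ 0 ∧
      g *ᵥ (c 0 • U 0 + c 1 • U 1 + c 2 • v) = 0 := by
    let f : (Fin 3 → ℝ) →ₗ[ℝ] (Fin 2 → ℝ) :=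
      { toFun := fun c => g *ᵥ (c 0 • U 0 + c 1 • U 1 + c 2 • v)
        map_add' := by
          intro c d
          rw [← Matrix.mulVec_add]; congr 1
          simp only [Pi.add_apply, add_smul]; abel
        map_smul' := by
          intro s c
          rw [RingHom.id_apply, ← Matrix.mulVec_smul]; congr 1
          simp only [Pi.smul_apply, smul_add, smul_eq_mul, mul_smul] }
    have hker : LinearMap.ker f ≠ ⊥ := LinearMap.ker_ne_bot_of_finrank_lt (by simp)
    obtain ⟨c, hc, hc0⟩ := Submodule.exists_mem_ne_zero_of_ne_bot hker
    exact ⟨c, hc0, hc⟩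
  obtain ⟨x, hx⟩ : ∃ x, x = c 0 • U 0 + c 1 • U 1 + c 2 • v := ⟨_, rfl⟩
  rw [← hx] at hc
  have hBx := hg x hc
  have r00 := row_dotProduct_row hUU 0 0
  have r01 := row_dotProduct_row hUU 0 1
  have r10 := row_dotProduct_row hUU 1 0
  have r11 := row_dotProduct_row hUU 1 1
  have v0 : U 0 ⬝ᵥ v = 0 := congrFun hUv 0
  have v1 : U 1 ⬝ᵥ v = 0 := congrFun hUv 1
  have v0' : v ⬝ᵥ U 0 = 0 := by rw [dotProduct_comm, v0]
  have v1' : v ⬝ᵥ U 1 = 0 := by rw [dotProduct_comm, v1]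
  simp only [if_true] at r00 r11
  rw [if_neg (by decide)] at r01 r10
  have exx : x ⬝ᵥ x = c 0 ^ 2 + c 1 ^ 2 + c 2 ^ 2 * (v ⬝ᵥ v) := by
    rw [hx]
    simp only [add_dotProduct, dotProduct_add, smul_dotProduct, dotProduct_smul, r00, r01, r10,
      r11, v0, v1, v0', v1', smul_eq_mul]
    ring
  have hAx : (A - B) *ᵥ x = (c 0 * ρ 0) • U 0 + (c 1 * ρ 1) • U 1 + (c 2 * μ) • v := by
    rw [Matrix.sub_mulVec, hBx, sub_zero, hx, Matrix.mulVec_add, Matrix.mulVec_add,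
      Matrix.mulVec_smul, Matrix.mulVec_smul, Matrix.mulVec_smul, hρ, hρ, hAv, smul_smul,
      smul_smul, smul_smul]
  have hxx : 0 < x ⬝ᵥ x := by
    rw [exx]
    by_contra hcon
    have p0 := sq_nonneg (c 0)
    have p1 := sq_nonneg (c 1)
    have p2 := mul_nonneg (sq_nonneg (c 2)) hvv.le
    apply hc0
    have q0 : c 0 = 0 := pow_eq_zero_iff (two_ne_zero) |>.1 (by linarith)
    have q1 : c 1 = 0 := pow_eq_zero_iff (two_ne_zero) |>.1 (by linarith)
    have q2 : c 2 = 0 := by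
      have : c 2 ^ 2 * (v ⬝ᵥ v) = 0 := by linarith
      rcases mul_eq_zero.1 this with h | h
      · exact pow_eq_zero_iff (two_ne_zero) |>.1 h
      · exact absurd h hvv.ne'
    ext i
    fin_cases i <;> assumption
  rcases hU with ⟨-, ρ', hρ', hmax⟩ | ⟨hpos, -, ρ', hρ', hmax⟩
  · have hρρ : ∀ k, ρ' k = ρ k := by
      intro k
      have h1 : (A *ᵥ U k) ⬝ᵥ U k = ρ k := by
        rw [hρ k, smul_dotProduct, row_dotProduct_row hUU]; simp
      have h2 : (A *ᵥ U k) ⬝ᵥ U k = ρ' k := by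
        rw [hρ' k, smul_dotProduct, row_dotProduct_row hUU]; simp
      rw [← h1, ← h2]
    -- On the kernel of `B`, `A - B` acts as `A`, and all three eigenvalues involved are at least
    -- |μ| in absolute value; hence μ² ‖x‖² ≤ ‖(A - B) x‖².
    have m0 := sq_le_sq.2 (hmax v μ hv hAv hUv 0)
    have m1 := sq_le_sq.2 (hmax v μ hv hAv hUv 1)
    rw [hρρ] at m0 m1
    have hle := hAB x
    have : ((A - B) *ᵥ x) ⬝ᵥ ((A - B) *ᵥ x) =
        c 0 ^ 2 * ρ 0 ^ 2 + c 1 ^ 2 * ρ 1 ^ 2 + c 2 ^ 2 * (v ⬝ᵥ v) * μ ^ 2 := by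
      rw [hAx]
      simp only [add_dotProduct, dotProduct_add, smul_dotProduct, dotProduct_smul, r00, r01, r10,
        r11, v0, v1, v0', v1', smul_eq_mul]
      ring
    rw [this] at hle
    have k0 := mul_le_mul_of_nonneg_left m0 (sq_nonneg (c 0))
    have k1 := mul_le_mul_of_nonneg_left m1 (sq_nonneg (c 1))
    have : μ ^ 2 * (x ⬝ᵥ x) ≤ b ^ 2 * (x ⬝ᵥ x) := by
      refine le_trans ?_ hle
      rw [exx]; linarith
    have := le_of_mul_le_mul_right this hxx
    exact abs_le_of_sq_le_sq this hb
  · have hρρ : ∀ k, ρ' k = ρ k := by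
      intro k
      have h1 : (A *ᵥ U k) ⬝ᵥ U k = ρ k := by
        rw [hρ k, smul_dotProduct, row_dotProduct_row hUU]; simp
      have h2 : (A *ᵥ U k) ⬝ᵥ U k = ρ' k := by
        rw [hρ' k, smul_dotProduct, row_dotProduct_row hUU]; simp
      rw [← h1, ← h2]
    have m0 : μ ≤ ρ 0 := by rw [← hρρ]; exact hmax v μ hv hAv hUv 0
    have m1 : μ ≤ ρ 1 := by rw [← hρρ]; exact hmax v μ hv hAv hUv 1
    rw [abs_le]
    -- Ordering by value bounds μ only from above, through the quadratic form of `A - B` at `x`. The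
    -- lower bound comes from the form of `A` at `v`, because `B` is positive semidefinite.
    constructor
    · have h1 := (abs_le.1 (quad v)).1
      rw [Matrix.sub_mulVec, dotProduct_sub, hAv, dotProduct_smul, smul_eq_mul] at h1
      have h2 := hpos v
      have : -b * (v ⬝ᵥ v) ≤ μ * (v ⬝ᵥ v) := by linarith
      exact le_of_mul_le_mul_right this hvv
    · have h1 := (abs_le.1 (quad x)).2
      have : x ⬝ᵥ ((A - B) *ᵥ x) =
          c 0 ^ 2 * ρ 0 + c 1 ^ 2 * ρ 1 + c 2 ^ 2 * (v ⬝ᵥ v) * μ := by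
        rw [hAx, hx]
        simp only [add_dotProduct, dotProduct_add, smul_dotProduct, dotProduct_smul, r00, r01, r10,
          r11, v0, v1, v0', v1', smul_eq_mul]
        ring
      rw [this] at h1
      have k0 := mul_le_mul_of_nonneg_left m0 (sq_nonneg (c 0))
      have k1 := mul_le_mul_of_nonneg_left m1 (sq_nonneg (c 1))
      have : μ * (x ⬝ᵥ x) ≤ b * (x ⬝ᵥ x) := by
        refine le_trans ?_ h1
        rw [exx]; linarith
      exact le_of_mul_le_mul_right this hxx

/-- Vectors in the range of a matrix `B` of rank two are close to the span of the leading
eigenvectors of a perturbation of `B`. -/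
lemma leading_residual_le {A B : Matrix (Fin n) (Fin n) ℝ} (hA : A.IsSymm)
    {U : Matrix (Fin 2) (Fin n) ℝ} (g : Matrix (Fin 2) (Fin n) ℝ)
    (hg : ∀ x, g *ᵥ x = 0 → B *ᵥ x = 0) {b : ℝ} (hb : 0 ≤ b)
    (hAB : ∀ x, ((A - B) *ᵥ x) ⬝ᵥ ((A - B) *ᵥ x) ≤ b ^ 2 * (x ⬝ᵥ x))
    (hU : IsLeadingEigenvectors abs A U ∨
      ((∀ x, 0 ≤ x ⬝ᵥ (B *ᵥ x)) ∧ IsLeadingEigenvectors id A U)) (z : Fin n → ℝ) :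
    (Uᵀ *ᵥ (U *ᵥ (B *ᵥ z)) - B *ᵥ z) ⬝ᵥ (Uᵀ *ᵥ (U *ᵥ (B *ᵥ z)) - B *ᵥ z) ≤
      4 * b ^ 2 * (z ⬝ᵥ z) := by
  obtain ⟨hUU, ρ, hρ⟩ : U * Uᵀ = 1 ∧ ∃ ρ : Fin 2 → ℝ, ∀ k, A *ᵥ U k = ρ k • U k := by
    rcases hU with ⟨h1, ρ, h2, -⟩ | ⟨-, h1, ρ, h2, -⟩ <;> exact ⟨h1, ρ, h2⟩
  have hAU : A * Uᵀ = Uᵀ * Matrix.diagonal ρ := by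
    ext i k
    have := congrFun (hρ k) i
    rw [Matrix.mul_diagonal, Matrix.mul_apply]
    simp only [Matrix.mulVec, dotProduct, Pi.smul_apply, smul_eq_mul] at this
    simp only [Matrix.transpose_apply]
    rw [this, mul_comm]
  have hcomm : A * (Uᵀ * U) = Uᵀ * U * A := by
    have h1 : U * A = Matrix.diagonal ρ * U := by
      have := congrArg Matrix.transpose hAU
      rwa [Matrix.transpose_mul, Matrix.transpose_mul, Matrix.transpose_transpose, hA.eq,
        Matrix.diagonal_transpose] at this
    rw [← Matrix.mul_assoc, hAU, Matrix.mul_assoc, Matrix.mul_assoc, h1]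
  have hproj : Uᵀ * U * (Uᵀ * U) = Uᵀ * U := by
    rw [Matrix.mul_assoc, ← Matrix.mul_assoc U, hUU, Matrix.one_mul]
  have hsymm : (Uᵀ * U).IsSymm := by
    rw [Matrix.IsSymm, Matrix.transpose_mul, Matrix.transpose_transpose]
  -- R is the projection orthogonal to the leading eigenvectors. It commutes with `A`, and only its
  -- contraction property is needed against `A - B`.
  obtain ⟨R, hR⟩ : ∃ R : Matrix (Fin n) (Fin n) ℝ, R = 1 - Uᵀ * U := ⟨_, rfl⟩
  have hRR : R * R = R := by
    rw [hR, Matrix.sub_mul, Matrix.mul_sub, Matrix.mul_sub, hproj]; simp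
  have hRs : R.IsSymm := by
    rw [hR]; exact (Matrix.isSymm_one).sub hsymm
  have hAR : A * R = R * A := by
    rw [hR, Matrix.mul_sub, Matrix.sub_mul, hcomm]; simp
  have hUR : U * R = 0 := by
    rw [hR, Matrix.mul_sub, ← Matrix.mul_assoc, hUU]; simp
  have hcontr : ∀ w, (R *ᵥ w) ⬝ᵥ (R *ᵥ w) ≤ w ⬝ᵥ w := by
    intro w
    have h1 : (R *ᵥ w) ⬝ᵥ (R *ᵥ w) = w ⬝ᵥ (R *ᵥ w) := by
      rw [← dotProduct_mulVec_comm hRs, Matrix.mulVec_mulVec, hRR]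
    have h2 := dotProduct_self_nonneg' (w - R *ᵥ w)
    simp only [sub_dotProduct, dotProduct_sub] at h2
    rw [dotProduct_comm (R *ᵥ w) w] at h2
    linarith
  have hC : (A * R).IsSymm := by
    rw [Matrix.IsSymm, Matrix.transpose_mul, hRs.eq, hA.eq, hAR]
  -- An eigenvector of `A * R` for a nonzero eigenvalue lies in the range of `R`. It is therefore a
  -- non-leading eigenvector of `A`, orthogonal to the rows of `U`.
  have hbound := sq_mulVec_le_of_eigenvalues hC (b := b) (by
    intro v μ hv hev
    by_cases hμ : μ = 0
    · rw [hμ, abs_zero]; exact hb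
    have hRv : R *ᵥ v = v := by
      have h1 : R *ᵥ ((A * R) *ᵥ v) = (A * R) *ᵥ v := by
        rw [Matrix.mulVec_mulVec, hAR, ← Matrix.mul_assoc, hRR]
      rw [hev, Matrix.mulVec_smul] at h1
      exact smul_right_injective _ hμ h1
    apply abs_eigenvalue_le_of_leading g hg hb hAB hU hv
    · rw [← hev, ← Matrix.mulVec_mulVec, hRv]
    · rw [← hRv, Matrix.mulVec_mulVec, hUR, Matrix.zero_mulVec])
  -- R B z = R A z - R (A - B) z. Both terms have norm at most b‖z‖, and ‖p - q‖² ≤ 2‖p‖² + 2‖q‖²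
  -- gives the factor 4.
  have hsplit : Uᵀ *ᵥ (U *ᵥ (B *ᵥ z)) - B *ᵥ z = R *ᵥ ((A - B) *ᵥ z) - (A * R) *ᵥ z := by
    rw [hAR, Matrix.sub_mulVec, Matrix.mulVec_sub, Matrix.mulVec_mulVec _ R A, sub_sub_cancel_left,
      hR, Matrix.sub_mulVec, Matrix.one_mulVec, ← Matrix.mulVec_mulVec _ Uᵀ U]
    abel
  rw [hsplit]
  have h1 := (hcontr _).trans (hAB z)
  have h2 := hbound z
  have h3 := dotProduct_self_nonneg' (R *ᵥ ((A - B) *ᵥ z) + (A * R) *ᵥ z)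
  simp only [sub_dotProduct, dotProduct_sub, add_dotProduct, dotProduct_add] at h3 ⊢
  linarith

end Perturbation

/-! ### Extreme labels -/

section Extreme

open scoped Matrix

variable {n : ℕ}

/-- Every linear functional on the projected cube is maximized at the projection of an extreme
label vector, whose signs agree with those of the coefficients of the functional. -/
lemma exists_extremeLabels (U : Matrix (Fin 2) (Fin n) ℝ) (a : Fin 2 → ℝ) :
    ∃ e ∈ extremeLabels U, ∀ i, 0 ≤ e i * (Uᵀ *ᵥ a) i := by
  obtain ⟨K, hK⟩ : ∃ K : Set (Fin n → ℝ), K = Set.univ.pi fun _ => Set.Icc (-1 : ℝ) 1 := ⟨_, rfl⟩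
  have hKmem : ∀ e, e ∈ K ↔ ∀ i, e i ∈ Set.Icc (-1 : ℝ) 1 := by
    intro e; rw [hK, Set.mem_univ_pi]
  have hKc : IsCompact K := by rw [hK]; exact isCompact_univ_pi fun _ => isCompact_Icc
  have hUc : Continuous fun e : Fin n → ℝ => U *ᵥ e := by fun_prop
  have hPK : projectedCube U = (fun e : Fin n → ℝ => U *ᵥ e) '' K := by
    unfold projectedCube
    congr 1
    ext e; rw [hKmem]; rfl
  have hP : IsCompact (projectedCube U) := hPK ▸ hKc.image hUc
  have hPne : (projectedCube U).Nonempty := ⟨_, 0, by intro i; simp, rfl⟩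
  have hac : Continuous fun z : Fin 2 → ℝ => a ⬝ᵥ z := by fun_prop
  -- The face of maximizers of the functional is an extreme compact set, so by Krein–Milman it
  -- contains an extreme point of the projected cube.
  obtain ⟨F, hF⟩ : ∃ F : Set (Fin 2 → ℝ), F = {z ∈ projectedCube U |
    ∀ y ∈ projectedCube U, a ⬝ᵥ y ≤ a ⬝ᵥ z} := ⟨_, rfl⟩
  have hFext : IsExtreme ℝ (projectedCube U) F := by
    refine ⟨fun z hz => by rw [hF] at hz; exact hz.1, ?_⟩
    rintro x hx y hy z hz ⟨s, t, hs, ht, hst, rfl⟩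
    rw [hF] at hz ⊢
    refine ⟨hx, fun w hw => (hz.2 w hw).trans ?_⟩
    have h1 := hz.2 x hx
    have h2 := hz.2 y hy
    simp only [dotProduct_add, dotProduct_smul, smul_eq_mul] at h1 h2 ⊢
    have hxy : a ⬝ᵥ y ≤ a ⬝ᵥ x := by
      have : s * (a ⬝ᵥ y) + t * (a ⬝ᵥ y) ≤ s * (a ⬝ᵥ x) + t * (a ⬝ᵥ y) := by
        rw [← add_mul, hst, one_mul]; exact h2
      exact le_of_mul_le_mul_left (by linarith) hs
    have : t * (a ⬝ᵥ y) ≤ t * (a ⬝ᵥ x) := mul_le_mul_of_nonneg_left hxy ht.le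
    have h3 : s * (a ⬝ᵥ x) + t * (a ⬝ᵥ x) = a ⬝ᵥ x := by rw [← add_mul, hst, one_mul]
    linarith
  have hFc : IsCompact F := by
    have : F = projectedCube U ∩ ⋂ y ∈ projectedCube U, {z | a ⬝ᵥ y ≤ a ⬝ᵥ z} := by
      rw [hF]; ext z; simp
    rw [this]
    refine hP.inter_right (isClosed_biInter fun y _ => isClosed_le continuous_const hac)
  have hFne : F.Nonempty := by
    obtain ⟨z, hz, hmax⟩ := hP.exists_isMaxOn hPne hac.continuousOn
    exact ⟨z, by rw [hF]; exact ⟨hz, fun y hy => hmax hy⟩⟩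
  obtain ⟨z, hz⟩ := hFc.extremePoints_nonempty hFne
  have hzP := hFext.extremePoints_subset_extremePoints hz
  have hzF : z ∈ F := hz.1
  -- The fibre of the cube over an extreme point is itself an extreme subset, so it contains a
  -- vertex of the cube.
  obtain ⟨G, hG⟩ : ∃ G : Set (Fin n → ℝ), G = {e ∈ K | U *ᵥ e = z} := ⟨_, rfl⟩
  have hGext : IsExtreme ℝ K G := by
    refine ⟨fun e he => by rw [hG] at he; exact he.1, ?_⟩
    rintro x hx y hy e he hseg
    rw [hG] at he ⊢
    refine ⟨hx, ?_⟩
    apply hzP.2 (hPK ▸ ⟨x, hx, rfl⟩ : U *ᵥ x ∈ projectedCube U)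
      (hPK ▸ ⟨y, hy, rfl⟩ : U *ᵥ y ∈ projectedCube U)
    obtain ⟨s, t, hs, ht, hst, rfl⟩ := hseg
    refine ⟨s, t, hs, ht, hst, ?_⟩
    rw [← he.2, Matrix.mulVec_add, Matrix.mulVec_smul, Matrix.mulVec_smul]
  have hGc : IsCompact G := by
    have : G = K ∩ {e | U *ᵥ e = z} := by rw [hG]; rfl
    rw [this]
    exact hKc.inter_right (isClosed_eq hUc continuous_const)
  have hGne : G.Nonempty := by
    obtain ⟨e, he, hez⟩ : z ∈ (fun e : Fin n → ℝ => U *ᵥ e) '' K := hPK ▸ hzP.1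
    exact ⟨e, by rw [hG]; exact ⟨he, hez⟩⟩
  obtain ⟨e, he⟩ := hGc.extremePoints_nonempty hGne
  have heK := hGext.extremePoints_subset_extremePoints he
  have heG : e ∈ G := he.1
  rw [hG] at heG
  have hpm : ∀ i, e i = -1 ∨ e i = 1 := by
    rw [hK, extremePoints_pi] at heK
    intro i
    have := heK i trivial
    rw [Set.extremePoints_Icc (by norm_num)] at this
    simpa using this
  refine ⟨e, ⟨hpm, by rw [heG.2]; exact hzP⟩, ?_⟩
  by_contra hcon
  push Not at hcon
  obtain ⟨i, hi⟩ := hcon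
  -- Flipping a coordinate of the wrong sign would strictly increase the functional.
  have hlt : a ⬝ᵥ (U *ᵥ e) < a ⬝ᵥ (U *ᵥ (Function.update e i (-e i))) := by
    rw [← transpose_mulVec_dotProduct, ← transpose_mulVec_dotProduct, dotProduct, dotProduct]
    apply Finset.sum_lt_sum
    · intro j _
      by_cases hj : j = i
      · subst hj; rw [Function.update_self]; nlinarith
      · rw [Function.update_of_ne hj]
    · exact ⟨i, Finset.mem_univ _, by rw [Function.update_self]; nlinarith⟩
  rw [hF] at hzF
  have := hzF.2 (U *ᵥ (Function.update e i (-e i))) (by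
    refine ⟨_, ?_, rfl⟩
    intro j
    by_cases hj : j = i
    · subst hj; rw [Function.update_self]
      rcases hpm j with h | h <;> rw [h] <;> norm_num
    · rw [Function.update_of_ne hj]; exact (hKmem e).1 heK.1 j)
  rw [heG.2] at hlt
  linarith

end Extreme

/-! ### Block sums -/

section BlockSums

open scoped Matrix

variable {n : ℕ}

/-- The degree parameters arranged by community. -/
def massMatrix (n₁ : ℕ) (θ : Fin n → ℝ) : Matrix (Fin 2) (Fin n) ℝ :=
  Matrix.of fun k i => if comm n₁ i = k then θ i else 0

/-- The rank-two factorization: the mean block sums depend on the labels only through the degree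
masses, and the kernel of `massMatrix` lies in that of the mean matrix, as `leading_residual_le`
requires. -/
lemma meanMatrix_eq (n₁ : ℕ) (lam r w : ℝ) (θ : Fin n → ℝ) :
    meanMatrix n₁ lam r w θ = (massMatrix n₁ θ)ᵀ * blockProb n lam r w * massMatrix n₁ θ := by
  ext i j
  simp only [meanMatrix, massMatrix, Matrix.mul_apply, Matrix.of_apply, Matrix.transpose_apply,
    ite_mul, zero_mul, mul_ite, mul_zero, Finset.sum_ite_eq, Finset.mem_univ, if_true]
  ring

lemma meanMatrix_isSymm (n₁ : ℕ) (lam r w : ℝ) (θ : Fin n → ℝ) :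
    (meanMatrix n₁ lam r w θ).IsSymm := by
  have : (blockProb n lam r w).IsSymm := by
    unfold blockProb
    ext i j
    fin_cases i <;> fin_cases j <;> simp
  rw [Matrix.IsSymm, meanMatrix_eq, Matrix.transpose_mul, Matrix.transpose_mul, this.eq,
    Matrix.transpose_transpose, Matrix.mul_assoc]

/-- The bilinear form of the matrix `[[1, r], [r, w]]`. -/
def blockForm (r w y₁ y₂ z₁ z₂ : ℝ) : ℝ := y₁ * z₁ + r * (y₁ * z₂ + y₂ * z₁) + w * (y₂ * z₂)

lemma dotProduct_meanMatrix (n₁ : ℕ) (lam r w : ℝ) (θ : Fin n → ℝ) (y z : Fin n → ℝ) :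
    y ⬝ᵥ (meanMatrix n₁ lam r w θ *ᵥ z) = lam / n *
      blockForm r w ((massMatrix n₁ θ *ᵥ y) 0) ((massMatrix n₁ θ *ᵥ y) 1)
        ((massMatrix n₁ θ *ᵥ z) 0) ((massMatrix n₁ θ *ᵥ z) 1) := by
  rw [meanMatrix_eq, ← Matrix.mulVec_mulVec, ← Matrix.mulVec_mulVec, dotProduct_comm,
    transpose_mulVec_dotProduct]
  simp only [blockProb, blockForm, dotProduct, Fin.sum_univ_two, Matrix.mulVec, Matrix.smul_apply,
    Matrix.of_apply, Matrix.cons_val', Matrix.cons_val_zero, Matrix.cons_val_one, smul_eq_mul,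
    Matrix.cons_val_fin_one]
  ring

lemma meanMatrix_mulVec_eq_zero {n₁ : ℕ} {lam r w : ℝ} {θ : Fin n → ℝ} {x : Fin n → ℝ}
    (h : massMatrix n₁ θ *ᵥ x = 0) : meanMatrix n₁ lam r w θ *ᵥ x = 0 := by
  rw [meanMatrix_eq, ← Matrix.mulVec_mulVec, h, Matrix.mulVec_zero]

/-- The block form is (y₀ + r y₁)² + (w - r²) y₁². This is what allows eigenvalues ordered by value
when r² < w. -/
lemma meanMatrix_nonneg_form (n₁ : ℕ) {lam r w : ℝ} (hlam : 0 ≤ lam) (hrw : r ^ 2 ≤ w)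
    (θ : Fin n → ℝ) (x : Fin n → ℝ) : 0 ≤ x ⬝ᵥ (meanMatrix n₁ lam r w θ *ᵥ x) := by
  rw [dotProduct_meanMatrix]
  apply mul_nonneg (by positivity)
  unfold blockForm
  nlinarith [sq_nonneg ((massMatrix n₁ θ *ᵥ x) 0 + r * (massMatrix n₁ θ *ᵥ x) 1),
    mul_nonneg (sub_nonneg.2 hrw) (sq_nonneg ((massMatrix n₁ θ *ᵥ x) 1))]

/-- The indicator of the nodes with label `1`. -/
def labelSet (e : Fin n → ℝ) : Fin n → ℝ := fun i => (1 + e i) / 2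

lemma one_add_eq (e : Fin n → ℝ) : 1 + e = (2 : ℝ) • labelSet e := by
  ext i; simp [labelSet]; ring

lemma one_sub_eq (e : Fin n → ℝ) : 1 - e = (2 : ℝ) • (1 - labelSet e) := by
  ext i; simp [labelSet]; ring

lemma O11_eq (A : Matrix (Fin n) (Fin n) ℝ) (e : Fin n → ℝ) :
    O11 A e = labelSet e ⬝ᵥ (A *ᵥ labelSet e) := by
  rw [O11, one_add_eq, Matrix.mulVec_smul, smul_dotProduct, dotProduct_smul, smul_eq_mul,
    smul_eq_mul]
  ring

lemma O12_eq (A : Matrix (Fin n) (Fin n) ℝ) (e : Fin n → ℝ) :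
    O12 A e = labelSet e ⬝ᵥ (A *ᵥ (1 - labelSet e)) := by
  rw [O12, one_add_eq, one_sub_eq, Matrix.mulVec_smul, smul_dotProduct, dotProduct_smul,
    smul_eq_mul, smul_eq_mul]
  ring

lemma O22_eq (A : Matrix (Fin n) (Fin n) ℝ) (e : Fin n → ℝ) :
    O22 A e = (1 - labelSet e) ⬝ᵥ (A *ᵥ (1 - labelSet e)) := by
  rw [O22, one_sub_eq, Matrix.mulVec_smul, smul_dotProduct, dotProduct_smul,
    smul_eq_mul, smul_eq_mul]
  ring

lemma QDC_eq_profile (A : Matrix (Fin n) (Fin n) ℝ) (e : Fin n → ℝ) :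
    QDC A e = profile (O11 A e) (O12 A e) (O22 A e) := by
  unfold QDC profile xlog O1 O2
  ring

/-- Since the total does not depend on the labels, rescaling the block sums changes the likelihood
by a constant factor and an additive constant, and preserves comparisons of labels. -/
lemma O_total {A : Matrix (Fin n) (Fin n) ℝ} (hA : A.IsSymm) (e : Fin n → ℝ) :
    O11 A e + 2 * O12 A e + O22 A e = 1 ⬝ᵥ (A *ᵥ 1) := by
  have h : labelSet e ⬝ᵥ (A *ᵥ (1 - labelSet e)) = (1 - labelSet e) ⬝ᵥ (A *ᵥ labelSet e) := by
    rw [dotProduct_mulVec_comm hA, dotProduct_comm]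
  rw [two_mul]
  nth_rewrite 2 [O12_eq]
  rw [h, O11_eq, O12_eq, O22_eq]
  simp only [Matrix.mulVec_sub, dotProduct_sub, sub_dotProduct]
  ring

lemma labelSet_mem {e : Fin n → ℝ} (he : ∀ i, e i = -1 ∨ e i = 1) (i : Fin n) :
    labelSet e i = 0 ∨ labelSet e i = 1 := by
  rcases he i with h | h <;> simp [labelSet, h]

lemma O_nonneg {A : Matrix (Fin n) (Fin n) ℝ} (hA : ∀ i j, 0 ≤ A i j) {e : Fin n → ℝ}
    (he : ∀ i, e i = -1 ∨ e i = 1) : 0 ≤ O11 A e ∧ 0 ≤ O12 A e ∧ 0 ≤ O22 A e := by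
  have h0 : ∀ i, 0 ≤ labelSet e i := fun i => by
    rcases labelSet_mem he i with h | h <;> simp [h]
  have h1 : ∀ i, 0 ≤ (1 - labelSet e) i := fun i => by
    rcases labelSet_mem he i with h | h <;> simp [h]
  have key : ∀ y z : Fin n → ℝ, (∀ i, 0 ≤ y i) → (∀ i, 0 ≤ z i) → 0 ≤ y ⬝ᵥ (A *ᵥ z) := by
    intro y z hy hz
    simp only [Matrix.mulVec, dotProduct]
    exact Finset.sum_nonneg fun i _ => mul_nonneg (hy i) <|
      Finset.sum_nonneg fun j _ => mul_nonneg (hA i j) (hz j)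
  rw [O11_eq, O12_eq, O22_eq]
  exact ⟨key _ _ h0 h0, key _ _ h0 h1, key _ _ h1 h1⟩

lemma massMatrix_nonneg (n₁ : ℕ) {θ : Fin n → ℝ} (hθ : ∀ i, 0 ≤ θ i) (k : Fin 2) (i : Fin n) :
    0 ≤ massMatrix n₁ θ k i := by
  simp only [massMatrix, Matrix.of_apply]
  split_ifs
  · exact hθ i
  · exact le_rfl

/-- The degree mass of the mislabelled nodes. -/
lemma mass_mislabelled (n₁ : ℕ) (θ : Fin n → ℝ) {e : Fin n → ℝ} (he : ∀ i, e i = -1 ∨ e i = 1) :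
    (massMatrix n₁ θ *ᵥ (1 - labelSet e)) 0 + (massMatrix n₁ θ *ᵥ labelSet e) 1 =
      ∑ i, if e i ≠ trueLabel n n₁ i then θ i else 0 := by
  simp only [Matrix.mulVec, dotProduct]
  rw [← Finset.sum_add_distrib]
  apply Finset.sum_congr rfl
  intro i _
  simp only [massMatrix, comm, trueLabel, Matrix.of_apply, Pi.sub_apply, Pi.one_apply, labelSet]
  by_cases hi : (i : ℕ) < n₁ <;> rcases he i with h | h <;> simp [hi, h] <;> norm_num

lemma ncard_eq_sum (p : Fin n → Prop) [DecidablePred p] :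
    (({i | p i} : Set (Fin n)).ncard : ℝ) = ∑ i, if p i then (1 : ℝ) else 0 := by
  rw [Set.ncard_eq_toFinset_card', Finset.sum_boole]
  congr 2
  ext i; simp

lemma ncard_mislabelled_le (n₁ : ℕ) {θ : Fin n → ℝ} {ξ : ℝ} (hξ : 0 < ξ) (hθ : ∀ i, 1 / ξ ≤ θ i)
    {e : Fin n → ℝ} (he : ∀ i, e i = -1 ∨ e i = 1) :
    (({i | e i ≠ trueLabel n n₁ i} : Set (Fin n)).ncard : ℝ) ≤
      ξ * ((massMatrix n₁ θ *ᵥ (1 - labelSet e)) 0 + (massMatrix n₁ θ *ᵥ labelSet e) 1) := by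
  rw [mass_mislabelled n₁ θ he, ncard_eq_sum, Finset.mul_sum]
  apply Finset.sum_le_sum
  intro i _
  split_ifs
  · have := mul_le_mul_of_nonneg_left (hθ i) hξ.le
    rwa [mul_one_div_cancel hξ.ne'] at this
  · simp

lemma mass_mislabelled_le (n₁ : ℕ) {θ : Fin n → ℝ} {ξ : ℝ} (hθ : ∀ i, θ i ≤ ξ)
    {e : Fin n → ℝ} (he : ∀ i, e i = -1 ∨ e i = 1) :
    (massMatrix n₁ θ *ᵥ (1 - labelSet e)) 0 + (massMatrix n₁ θ *ᵥ labelSet e) 1 ≤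
      ξ * ({i | e i ≠ trueLabel n n₁ i} : Set (Fin n)).ncard := by
  rw [mass_mislabelled n₁ θ he, ncard_eq_sum, Finset.mul_sum]
  apply Finset.sum_le_sum
  intro i _
  split_ifs
  · simpa using hθ i
  · simp

lemma labelSet_neg (e : Fin n → ℝ) : labelSet (-e) = 1 - labelSet e := by
  ext i; simp [labelSet]; ring

lemma trueLabel_mem (n n₁ : ℕ) (i : Fin n) : trueLabel n n₁ i = -1 ∨ trueLabel n n₁ i = 1 := by
  unfold trueLabel; split_ifs <;> simp

lemma card_comm_zero {n₁ : ℕ} (h : n₁ ≤ n) :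
    (∑ i : Fin n, if comm n₁ i = 0 then (1 : ℝ) else 0) = n₁ := by
  have : ∀ i : Fin n, (if comm n₁ i = 0 then (1 : ℝ) else 0) =
      (fun k : ℕ => if k < n₁ then (1 : ℝ) else 0) i := by
    intro i
    by_cases hi : (i : ℕ) < n₁ <;> simp [comm, hi]
  rw [Finset.sum_congr rfl fun i _ => this i,
    Fin.sum_univ_eq_sum_range (fun k : ℕ => if k < n₁ then (1 : ℝ) else 0), Finset.sum_boole]
  congr 1
  have : (Finset.range n).filter (fun k => k < n₁) = Finset.range n₁ := by
    ext k; simp; omega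
  rw [this, Finset.card_range]

lemma card_comm_one {n₁ : ℕ} (h : n₁ ≤ n) :
    (∑ i : Fin n, if comm n₁ i = 1 then (1 : ℝ) else 0) = n - n₁ := by
  have : (∑ i : Fin n, if comm n₁ i = 0 then (1 : ℝ) else 0) +
      (∑ i : Fin n, if comm n₁ i = 1 then (1 : ℝ) else 0) = n := by
    rw [← Finset.sum_add_distrib]
    have : ∀ i : Fin n, ((if comm n₁ i = 0 then (1 : ℝ) else 0) +
        if comm n₁ i = 1 then (1 : ℝ) else 0) = 1 := by
      intro i
      by_cases hi : (i : ℕ) < n₁ <;> simp [comm, hi]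
    rw [Finset.sum_congr rfl fun i _ => this i]; simp
  rw [card_comm_zero h] at this
  linarith

/-- Both communities carry a positive proportion of the degree mass. -/
lemma mass_ge {n₁ : ℕ} {ρ ξ : ℝ} (hξ : 0 < ξ) (h0 : ρ * n ≤ n₁) (h1 : ρ * n ≤ n - n₁)
    (hn₁ : n₁ ≤ n) {θ : Fin n → ℝ} (hθ : ∀ i, 1 / ξ ≤ θ i) (k : Fin 2) :
    ρ * n / ξ ≤ (massMatrix n₁ θ *ᵥ 1) k := by
  have hcard : ρ * n ≤ ∑ i : Fin n, if comm n₁ i = k then (1 : ℝ) else 0 := by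
    fin_cases k
    · exact h0.trans_eq (card_comm_zero hn₁).symm
    · exact h1.trans_eq (card_comm_one hn₁).symm
  calc ρ * n / ξ ≤ (∑ i : Fin n, if comm n₁ i = k then (1 : ℝ) else 0) / ξ := by gcongr
    _ ≤ _ := by
      simp only [Matrix.mulVec, dotProduct]
      rw [Finset.sum_div]
      apply Finset.sum_le_sum
      intro i _
      simp only [massMatrix, Matrix.of_apply, Pi.one_apply, mul_one]
      split_ifs
      · exact hθ i
      · simp

lemma mass_le {n₁ : ℕ} {ξ : ℝ} {θ : Fin n → ℝ} (hθ : ∀ i, θ i ≤ ξ) (hξ : 0 ≤ ξ) (k : Fin 2) :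
    (massMatrix n₁ θ *ᵥ 1) k ≤ ξ * n := by
  calc (massMatrix n₁ θ *ᵥ 1) k ≤ ∑ _i : Fin n, ξ := by
        simp only [Matrix.mulVec, dotProduct]
        apply Finset.sum_le_sum
        intro i _
        simp only [massMatrix, Matrix.of_apply, Pi.one_apply, mul_one]
        split_ifs
        · exact hθ i
        · exact hξ
    _ = ξ * n := by simp [mul_comm]

end BlockSums

/-! ### The loss of the mean likelihood -/

lemma blockForm_sub_le {r w ξ t : ℝ} (hr : 0 ≤ r) (hw : 0 ≤ w) {y₁ y₂ z₁ z₂ y₁' y₂' z₁' z₂' : ℝ}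
    (hy₁ : |y₁ - y₁'| ≤ t) (hy₂ : |y₂ - y₂'| ≤ t) (hz₁ : |z₁ - z₁'| ≤ t) (hz₂ : |z₂ - z₂'| ≤ t)
    (b₁ : |z₁| ≤ ξ) (b₂ : |z₂| ≤ ξ) (b₁' : |y₁'| ≤ ξ) (b₂' : |y₂'| ≤ ξ) :
    |blockForm r w y₁ y₂ z₁ z₂ - blockForm r w y₁' y₂' z₁' z₂'| ≤
      2 * ξ * (1 + 2 * r + w) * t := by
  have key : ∀ {y z y' z' : ℝ}, |y - y'| ≤ t → |z - z'| ≤ t → |z| ≤ ξ → |y'| ≤ ξ →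
      |y * z - y' * z'| ≤ 2 * ξ * t := by
    intro y z y' z' h1 h2 h3 h4
    have ht : 0 ≤ t := (abs_nonneg _).trans h1
    have : y * z - y' * z' = (y - y') * z + y' * (z - z') := by ring
    rw [this]
    refine (abs_add_le _ _).trans ?_
    rw [abs_mul, abs_mul]
    have e1 := mul_le_mul h1 h3 (abs_nonneg _) ht
    have e2 := mul_le_mul h4 h2 (abs_nonneg _) ((abs_nonneg _).trans h4)
    linarith
  have k1 := abs_le.1 (key hy₁ hz₁ b₁ b₁')
  have k2 := abs_le.1 (key hy₁ hz₂ b₂ b₁')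
  have k3 := abs_le.1 (key hy₂ hz₁ b₁ b₂')
  have k4 := abs_le.1 (key hy₂ hz₂ b₂ b₂')
  unfold blockForm
  rw [abs_le]
  constructor <;> nlinarith

lemma blockForm_nonneg {r w : ℝ} (hr : 0 ≤ r) (hw : 0 ≤ w) {y₁ y₂ z₁ z₂ : ℝ}
    (hy₁ : 0 ≤ y₁) (hy₂ : 0 ≤ y₂) (hz₁ : 0 ≤ z₁) (hz₂ : 0 ≤ z₂) :
    0 ≤ blockForm r w y₁ y₂ z₁ z₂ := by
  unfold blockForm; positivity

lemma blockForm_le {r w ξ : ℝ} (hr : 0 ≤ r) (hw : 0 ≤ w) {y₁ y₂ z₁ z₂ : ℝ}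
    (hy₁ : 0 ≤ y₁) (hz₁ : 0 ≤ z₁) (hz₂ : 0 ≤ z₂) (by₁ : y₁ ≤ ξ) (by₂ : y₂ ≤ ξ)
    (bz₁ : z₁ ≤ ξ) (bz₂ : z₂ ≤ ξ) :
    blockForm r w y₁ y₂ z₁ z₂ ≤ ξ ^ 2 * (1 + 2 * r + w) := by
  have hξ : 0 ≤ ξ := hy₁.trans by₁
  have k1 := mul_le_mul by₁ bz₁ hz₁ hξ
  have k2 := mul_le_mul by₁ bz₂ hz₂ hξ
  have k3 := mul_le_mul by₂ bz₁ hz₁ hξ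
  have k4 := mul_le_mul by₂ bz₂ hz₂ hξ
  unfold blockForm
  nlinarith [mul_le_mul_of_nonneg_left (add_le_add k2 k3) hr, mul_le_mul_of_nonneg_left k4 hw]

/-- The mean likelihood loses an amount linear in the mislabelled mass. -/
lemma exists_profile_gap {r w ξ ρ : ℝ} (hr : 0 ≤ r) (hw : 0 ≤ w) (hrw : r ^ 2 ≠ w) (hξ : 0 < ξ)
    (hρ : 0 < ρ) :
    ∃ c : ℝ, 0 < c ∧ ∀ x₁ x₂ y₁ y₂ : ℝ, 0 ≤ x₁ → 0 ≤ x₂ → 0 ≤ y₁ → 0 ≤ y₂ →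
      ρ ≤ x₁ + y₁ → ρ ≤ x₂ + y₂ → x₁ + y₁ ≤ ξ → x₂ + y₂ ≤ ξ →
      c * min (y₁ + x₂) (x₁ + y₂) ≤
        profile (blockForm r w (x₁ + y₁) 0 (x₁ + y₁) 0) (blockForm r w (x₁ + y₁) 0 0 (x₂ + y₂))
          (blockForm r w 0 (x₂ + y₂) 0 (x₂ + y₂)) -
        profile (blockForm r w x₁ x₂ x₁ x₂) (blockForm r w x₁ x₂ y₁ y₂)
          (blockForm r w y₁ y₂ y₁ y₂) := by
  have hdet : 0 < (w - r ^ 2) ^ 2 := by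
    have : w - r ^ 2 ≠ 0 := sub_ne_zero.2 hrw.symm
    positivity
  -- The bound of `profile_info_ge` with determinant s² t² (w - r²) and s, t ≥ ρ. The last division
  -- by ξ passes from proportions to masses.
  refine ⟨(ρ ^ 4 * (w - r ^ 2)) ^ 2 / (ξ ^ 2 * (1 + 2 * r + w)) ^ 3 / ξ, ?_, ?_⟩
  · rw [mul_pow]; positivity
  intro x₁ x₂ y₁ y₂ hx₁ hx₂ hy₁ hy₂ h1 h2 h3 h4
  obtain ⟨s, hs⟩ : ∃ s, s = x₁ + y₁ := ⟨_, rfl⟩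
  obtain ⟨t, ht⟩ : ∃ t, t = x₂ + y₂ := ⟨_, rfl⟩
  rw [← hs] at h1 h3 ⊢
  rw [← ht] at h2 h4 ⊢
  have hs0 : 0 < s := by linarith
  have ht0 : 0 < t := by linarith
  obtain ⟨a, ha⟩ : ∃ a, a = s ^ 2 := ⟨_, rfl⟩
  obtain ⟨b, hb⟩ : ∃ b, b = r * (s * t) := ⟨_, rfl⟩
  obtain ⟨d, hd⟩ : ∃ d, d = w * t ^ 2 := ⟨_, rfl⟩
  have e1 : blockForm r w s 0 s 0 = a := by unfold blockForm; rw [ha]; ring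
  have e2 : blockForm r w s 0 0 t = b := by unfold blockForm; rw [hb]; ring
  have e3 : blockForm r w 0 t 0 t = d := by unfold blockForm; rw [hd]; ring
  have ha0 : 0 < a := by rw [ha]; positivity
  have hb0 : 0 ≤ b := by rw [hb]; positivity
  have hd0 : 0 ≤ d := by rw [hd]; positivity
  -- The second marginal could vanish only for r = w = 0, which `hrw` excludes.
  have hbd : 0 < b + d := by
    rcases hr.eq_or_lt with h | h
    · have hw0 : 0 < w := lt_of_le_of_ne hw fun h' => hrw (by rw [← h, ← h']; norm_num)
      have : 0 < d := by rw [hd]; positivity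
      linarith
    · have : 0 < b := by rw [hb]; positivity
      linarith
  have hB : a + 2 * b + d ≤ ξ ^ 2 * (1 + 2 * r + w) := by
    have k1 : s ^ 2 ≤ ξ ^ 2 := pow_le_pow_left₀ hs0.le h3 2
    have k2 : t ^ 2 ≤ ξ ^ 2 := pow_le_pow_left₀ ht0.le h4 2
    have k3 : s * t ≤ ξ ^ 2 := by rw [pow_two]; exact mul_le_mul h3 h4 ht0.le hξ.le
    rw [ha, hb, hd]
    nlinarith [mul_le_mul_of_nonneg_left k3 hr, mul_le_mul_of_nonneg_left k2 hw]
  have hinfo := profile_info_ge ha0.le hb0 hd0 (by linarith) hbd hB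
  have hlow : (ρ ^ 4 * (w - r ^ 2)) ^ 2 / (ξ ^ 2 * (1 + 2 * r + w)) ^ 3 ≤
      (a * d - b ^ 2) ^ 2 / (ξ ^ 2 * (1 + 2 * r + w)) ^ 3 := by
    apply div_le_div_of_nonneg_right _ (by positivity)
    have : a * d - b ^ 2 = (s ^ 2 * t ^ 2) * (w - r ^ 2) := by rw [ha, hb, hd]; ring
    rw [this, mul_pow, mul_pow]
    apply mul_le_mul_of_nonneg_right _ hdet.le
    apply pow_le_pow_left₀ (by positivity)
    calc ρ ^ 4 = ρ ^ 2 * ρ ^ 2 := by ring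
      _ ≤ s ^ 2 * t ^ 2 := by gcongr
  have hI := hlow.trans hinfo
  have hpos : 0 ≤ (ρ ^ 4 * (w - r ^ 2)) ^ 2 / (ξ ^ 2 * (1 + 2 * r + w)) ^ 3 := by positivity
  -- x and y are the masses labelled + and -. Thus y₁ / s and x₂ / t are the mislabelled
  -- proportions, and x₁, y₂ play this role for the opposite labels.
  have hmain := profile_mislabel_le (a := a) (b := b) (d := d) (α := y₁ / s) (β := x₂ / t) ha0.le
    hb0 hd0 (by linarith) hbd (by positivity) (by rw [div_le_one hs0]; linarith) (by positivity)
    (by rw [div_le_one ht0]; linarith) (hpos.trans hI)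
  have f1 : (1 - y₁ / s) * ((1 - y₁ / s) * a + x₂ / t * b) +
      x₂ / t * ((1 - y₁ / s) * b + x₂ / t * d) = blockForm r w x₁ x₂ x₁ x₂ := by
    have : 1 - y₁ / s = x₁ / s := by rw [one_sub_div hs0.ne', hs]; ring
    rw [this, ha, hb, hd]; unfold blockForm; field_simp; ring
  have f2 : y₁ / s * ((1 - y₁ / s) * a + x₂ / t * b) +
      (1 - x₂ / t) * ((1 - y₁ / s) * b + x₂ / t * d) = blockForm r w x₁ x₂ y₁ y₂ := by
    have : 1 - y₁ / s = x₁ / s := by rw [one_sub_div hs0.ne', hs]; ring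
    have this' : 1 - x₂ / t = y₂ / t := by rw [one_sub_div ht0.ne', ht]; ring
    rw [this, this', ha, hb, hd]; unfold blockForm; field_simp; ring
  have f3 : y₁ / s * (y₁ / s * a + (1 - x₂ / t) * b) +
      (1 - x₂ / t) * (y₁ / s * b + (1 - x₂ / t) * d) = blockForm r w y₁ y₂ y₁ y₂ := by
    have : 1 - x₂ / t = y₂ / t := by rw [one_sub_div ht0.ne', ht]; ring
    rw [this, ha, hb, hd]; unfold blockForm; field_simp; ring
  rw [f1, f2, f3] at hmain
  rw [e1, e2, e3]
  refine le_trans ?_ hmain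
  have hmin : min (y₁ + x₂) (x₁ + y₂) / ξ ≤ min (y₁ / s + x₂ / t) (2 - y₁ / s - x₂ / t) := by
    have q1 : ∀ {u v : ℝ}, 0 ≤ u → 0 < v → v ≤ ξ → u / ξ ≤ u / v := fun hu hv hvξ =>
      div_le_div_of_nonneg_left hu hv hvξ
    have g1 : y₁ / s + x₁ / s = 1 := by rw [← add_div, hs, add_comm, div_self]; linarith
    have g2 : x₂ / t + y₂ / t = 1 := by rw [← add_div, ht, div_self]; linarith
    apply le_min
    · calc _ ≤ (y₁ + x₂) / ξ := by gcongr; exact min_le_left _ _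
        _ ≤ _ := by rw [add_div]; exact add_le_add (q1 hy₁ hs0 h3) (q1 hx₂ ht0 h4)
    · calc _ ≤ (x₁ + y₂) / ξ := by gcongr; exact min_le_right _ _
        _ ≤ x₁ / s + y₂ / t := by rw [add_div]; exact add_le_add (q1 hx₁ hs0 h3) (q1 hy₂ ht0 h4)
        _ = _ := by linarith
  have hm0 : 0 ≤ min (y₁ / s + x₂ / t) (2 - y₁ / s - x₂ / t) := by
    refine le_trans ?_ hmin
    exact div_nonneg (le_min (by positivity) (by positivity)) hξ.le
  calc _ = min (y₁ + x₂) (x₁ + y₂) / ξ *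
        ((ρ ^ 4 * (w - r ^ 2)) ^ 2 / (ξ ^ 2 * (1 + 2 * r + w)) ^ 3) := by ring
    _ ≤ min (y₁ / s + x₂ / t) (2 - y₁ / s - x₂ / t) *
        ((ρ ^ 4 * (w - r ^ 2)) ^ 2 / (ξ ^ 2 * (1 + 2 * r + w)) ^ 3) := by gcongr
    _ ≤ _ := by gcongr

/-! ### The estimation error -/

section Estimation

open scoped Matrix

variable {n : ℕ}

/-- Where the extreme label disagrees with c, `Uᵀ a` vanishes or has the sign opposite to θc. Such a
node contributes at least θ i ² ≥ 1 / ξ² to the squared residual. -/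
lemma exists_extremeLabels_near {n₁ : ℕ} {θ : Fin n → ℝ} {ξ κ : ℝ} (hξ : 0 < ξ)
    (hθ : ∀ i, 1 / ξ ≤ θ i) (U : Matrix (Fin 2) (Fin n) ℝ) (a : Fin 2 → ℝ)
    (h : (Uᵀ *ᵥ a - θ * trueLabel n n₁) ⬝ᵥ (Uᵀ *ᵥ a - θ * trueLabel n n₁) ≤ κ * n) :
    ∃ e ∈ extremeLabels U,
      (({i | e i ≠ trueLabel n n₁ i} : Set (Fin n)).ncard : ℝ) ≤ ξ ^ 2 * (κ * n) := by
  obtain ⟨e, he, hsign⟩ := exists_extremeLabels U a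
  refine ⟨e, he, le_trans ?_ (mul_le_mul_of_nonneg_left h (by positivity))⟩
  rw [ncard_eq_sum, dotProduct, Finset.mul_sum]
  apply Finset.sum_le_sum
  intro i _
  obtain ⟨y, hy⟩ : ∃ y, y = (Uᵀ *ᵥ a) i := ⟨_, rfl⟩
  have hs := hsign i
  simp only [Pi.sub_apply, Pi.mul_apply]
  rw [← hy] at hs ⊢
  split_ifs with hne
  · have h1 : 1 ≤ ξ * θ i := by
      have := mul_le_mul_of_nonneg_left (hθ i) hξ.le
      rwa [mul_one_div_cancel hξ.ne'] at this
    have hθ0 : 0 < θ i := lt_of_lt_of_le (by positivity) (hθ i)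
    have h2 : θ i ^ 2 ≤ (y - θ i * trueLabel n n₁ i) * (y - θ i * trueLabel n n₁ i) := by
      rcases he.1 i with h | h <;> rcases trueLabel_mem n n₁ i with h' | h' <;>
        rw [h, h'] at hne <;> first | exact absurd rfl hne | skip
      · rw [h] at hs; rw [h']; nlinarith
      · rw [h] at hs; rw [h']; nlinarith
    calc (1 : ℝ) ≤ (ξ * θ i) ^ 2 := one_le_pow₀ h1
      _ = ξ ^ 2 * θ i ^ 2 := by ring
      _ ≤ _ := by gcongr
  · exact mul_nonneg (sq_nonneg _) (mul_self_nonneg _)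

lemma profile_le_of_QDC_le {A : Matrix (Fin n) (Fin n) ℝ} (hA : A.IsSymm) {N : ℝ} (hN : 0 < N)
    {e e' : Fin n → ℝ} (h : QDC A e' ≤ QDC A e) :
    profile (O11 A e' / N) (O12 A e' / N) (O22 A e' / N) ≤
      profile (O11 A e / N) (O12 A e / N) (O22 A e / N) := by
  have key : ∀ f, QDC A f = N * profile (O11 A f / N) (O12 A f / N) (O22 A f / N)
      - Real.log N * (1 ⬝ᵥ (A *ᵥ 1)) := by
    intro f
    have h1 := profile_mul (a := O11 A f / N) (b := O12 A f / N) (d := O22 A f / N) hN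
    rw [mul_div_cancel₀ _ hN.ne', mul_div_cancel₀ _ hN.ne', mul_div_cancel₀ _ hN.ne'] at h1
    rw [QDC_eq_profile, h1, ← O_total hA f]
    field_simp
  rw [key, key] at h
  exact le_of_mul_le_mul_left (by linarith) hN

lemma O_meanMatrix (n₁ : ℕ) {lam : ℝ} (hlam : lam ≠ 0) (hn : (n : ℝ) ≠ 0) (r w : ℝ)
    (θ e : Fin n → ℝ) {x y : Fin 2 → ℝ} (hx : x = fun k => (massMatrix n₁ θ *ᵥ labelSet e) k / n)
    (hy : y = fun k => (massMatrix n₁ θ *ᵥ (1 - labelSet e)) k / n) :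
    O11 (meanMatrix n₁ lam r w θ) e / (lam * n) = blockForm r w (x 0) (x 1) (x 0) (x 1) ∧
    O12 (meanMatrix n₁ lam r w θ) e / (lam * n) = blockForm r w (x 0) (x 1) (y 0) (y 1) ∧
    O22 (meanMatrix n₁ lam r w θ) e / (lam * n) = blockForm r w (y 0) (y 1) (y 0) (y 1) := by
  subst hx hy
  rw [O11_eq, O12_eq, O22_eq, dotProduct_meanMatrix, dotProduct_meanMatrix, dotProduct_meanMatrix]
  unfold blockForm
  refine ⟨?_, ?_, ?_⟩ <;> field_simp

/-- The origin of the factor log n: the perturbation ε of the normalized block sums is at least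
1/√lam, hence at least of order 1/√n. -/
lemma abs_log_le_of_bounds {ε ξ E lam : ℝ} (hξ : 1 ≤ ξ) (hE : 1 ≤ E) (hlam : 1 ≤ lam)
    (hn : 1 ≤ (n : ℝ)) (hlamn : lam ≤ ξ ^ 2 * n) (h1 : 1 / √lam ≤ ε) (h2 : ε ≤ E) :
    |Real.log ε| ≤ Real.log E + Real.log ξ + Real.log n := by
  have hl : 0 < lam := by linarith
  have hε : 0 < ε := lt_of_lt_of_le (by positivity) h1
  have e1 := Real.log_le_log (by positivity) h1
  have e2 := Real.log_le_log hε h2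
  have e3 := Real.log_le_log hl hlamn
  rw [one_div, Real.log_inv, Real.log_sqrt hl.le] at e1
  rw [Real.log_mul (by positivity) (by positivity), Real.log_pow] at e3
  have := Real.log_nonneg hξ
  have := Real.log_nonneg hE
  have := Real.log_nonneg hn
  push_cast at e3
  rw [abs_le]
  constructor <;> linarith

set_option maxHeartbeats 2000000 in
/-- If the block sums of `A` are close to those of its mean, and the span of the rows of `U` comes
close to the vector of the signed degree parameters, then the estimate is close to the truth. -/
theorem exists_misclustered_le {r w ξ ρ K : ℝ} (hr : 0 ≤ r) (hw : 0 ≤ w) (hrw : r ^ 2 ≠ w)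
    (hξ : 1 ≤ ξ) (hρ : 0 < ρ) (hK : 1 ≤ K) :
    ∃ C : ℝ, 0 < C ∧ ∀ n : ℕ, 2 ≤ n → ∀ (n₁ : ℕ) (lam : ℝ) (θ : Fin n → ℝ)
      (A : Matrix (Fin n) (Fin n) ℝ), n₁ ≤ n → ρ * n ≤ n₁ → ρ * n ≤ n - n₁ → 1 ≤ lam →
      lam ≤ ξ ^ 2 * n → (∀ i, 1 / ξ ≤ θ i) → (∀ i, θ i ≤ ξ) → A.IsSymm → (∀ i j, 0 ≤ A i j) →
      (∀ e : Fin n → ℝ, (∀ i, e i = -1 ∨ e i = 1) →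
        |O11 A e - O11 (meanMatrix n₁ lam r w θ) e| ≤ K * n * √lam ∧
        |O12 A e - O12 (meanMatrix n₁ lam r w θ) e| ≤ K * n * √lam ∧
        |O22 A e - O22 (meanMatrix n₁ lam r w θ) e| ≤ K * n * √lam) →
      ∀ (U : Matrix (Fin 2) (Fin n) ℝ) (e : Fin n → ℝ) (a : Fin 2 → ℝ) (κ : ℝ),
      IsEstimate A U e →
      (Uᵀ *ᵥ a - θ * trueLabel n n₁) ⬝ᵥ (Uᵀ *ᵥ a - θ * trueLabel n n₁) ≤ κ * n →
      misclustered (trueLabel n n₁) e ≤ C * Real.log n * (κ + 1 / √lam) := by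
  have hξ0 : 0 < ξ := by linarith
  obtain ⟨c, hc, hgap⟩ := exists_profile_gap (ξ := ξ) (ρ := ρ / ξ) hr hw hrw hξ0 (by positivity)
  obtain ⟨H, hH⟩ : ∃ H, H = 1 + 2 * r + w := ⟨_, rfl⟩
  have hH1 : 1 ≤ H := by rw [hH]; linarith
  obtain ⟨B, hB⟩ : ∃ B, B = 2 * (ξ ^ 2 * H + K) := ⟨_, rfl⟩
  have hξH : 0 ≤ ξ ^ 2 * H := by positivity
  have hB1 : 1 ≤ B := by rw [hB]; linarith
  obtain ⟨E, hE⟩ : ∃ E, E = K + 2 * ξ ^ 2 * H := ⟨_, rfl⟩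
  have hE1 : 1 ≤ E := by rw [hE]; linarith
  have hlog2 : 0 < Real.log 2 := Real.log_pos (by norm_num)
  have hlE := Real.log_nonneg hE1
  have hlξ := Real.log_nonneg hξ
  have hlB := Real.log_nonneg hB1
  obtain ⟨D, hD⟩ : ∃ D, D = 1 + Real.log 2 + 2 * (Real.log E + Real.log ξ) + Real.log B :=
    ⟨_, rfl⟩
  have hD0 : 0 < D := by rw [hD]; linarith
  -- The factors are: from mass to number of nodes; two perturbations of 16 ε against the slope c of
  -- the gap; the logarithms as a multiple of log n; and ε as a multiple of κ + 1/√lam.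
  refine ⟨ξ * (32 / c) * (2 + D / Real.log 2) * (K + 2 * ξ ^ 2 * H * ξ ^ 2), by positivity, ?_⟩
  intro n hn n₁ lam θ A hn₁ hρ0 hρ1 hlam hlamn hθl hθu hAs hA0 hO U e a κ hest hκ
  have hn1 : (2 : ℝ) ≤ n := by exact_mod_cast hn
  have hn0 : (0 : ℝ) < n := by linarith
  have hlam0 : 0 < lam := by linarith
  have hN : 0 < lam * n := by positivity
  have hsq : 0 < √lam := by positivity
  have hsq1 : 1 ≤ √lam := by rw [Real.one_le_sqrt]; exact hlam
  have hθ0 : ∀ i, 0 ≤ θ i := fun i => le_trans (by positivity) (hθl i)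
  -- e' is the competitor near the truth, which the estimate must beat.
  obtain ⟨e', he', hcard⟩ := exists_extremeLabels_near hξ0 hθl U a hκ
  have hle := profile_le_of_QDC_le hAs hN (hest.2 e' he')
  have hes := hest.1.1
  have hes' := he'.1
  -- scaled masses
  have hmass : ∀ f : Fin n → ℝ, (∀ i, f i = -1 ∨ f i = 1) → ∀ k,
      0 ≤ (massMatrix n₁ θ *ᵥ labelSet f) k / n ∧
      0 ≤ (massMatrix n₁ θ *ᵥ (1 - labelSet f)) k / n ∧
      (massMatrix n₁ θ *ᵥ labelSet f) k / n + (massMatrix n₁ θ *ᵥ (1 - labelSet f)) k / n =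
        (massMatrix n₁ θ *ᵥ 1) k / n := by
    intro f hf k
    refine ⟨?_, ?_, ?_⟩
    · apply div_nonneg _ hn0.le
      simp only [Matrix.mulVec, dotProduct]
      refine Finset.sum_nonneg fun i _ => mul_nonneg (massMatrix_nonneg n₁ hθ0 k i) ?_
      rcases labelSet_mem hf i with h | h <;> simp [h]
    · apply div_nonneg _ hn0.le
      simp only [Matrix.mulVec, dotProduct]
      refine Finset.sum_nonneg fun i _ => mul_nonneg (massMatrix_nonneg n₁ hθ0 k i) ?_
      rcases labelSet_mem hf i with h | h <;> simp [h]
    · rw [← add_div, ← Pi.add_apply, ← Matrix.mulVec_add, add_sub_cancel]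
  have hτl : ∀ k, ρ / ξ ≤ (massMatrix n₁ θ *ᵥ 1) k / n := by
    intro k
    rw [le_div_iff₀ hn0, div_mul_eq_mul_div]
    exact mass_ge hξ0 hρ0 hρ1 hn₁ hθl k
  have hτu : ∀ k, (massMatrix n₁ θ *ᵥ 1) k / n ≤ ξ := by
    intro k
    rw [div_le_iff₀ hn0]
    exact mass_le hθu hξ0.le k
  obtain ⟨τ, hτ⟩ : ∃ τ : Fin 2 → ℝ, τ = fun k => (massMatrix n₁ θ *ᵥ 1) k / n := ⟨_, rfl⟩
  obtain ⟨x, hx⟩ : ∃ x : Fin 2 → ℝ, x = fun k => (massMatrix n₁ θ *ᵥ labelSet e) k / n := ⟨_, rfl⟩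
  obtain ⟨y, hy⟩ : ∃ y : Fin 2 → ℝ, y = fun k => (massMatrix n₁ θ *ᵥ (1 - labelSet e)) k / n :=
    ⟨_, rfl⟩
  obtain ⟨x', hx'⟩ : ∃ x : Fin 2 → ℝ, x = fun k => (massMatrix n₁ θ *ᵥ labelSet e') k / n :=
    ⟨_, rfl⟩
  obtain ⟨y', hy'⟩ : ∃ y : Fin 2 → ℝ, y = fun k => (massMatrix n₁ θ *ᵥ (1 - labelSet e')) k / n :=
    ⟨_, rfl⟩
  have hτl' : ∀ k, ρ / ξ ≤ τ k := by rw [hτ]; exact hτl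
  have hτu' : ∀ k, τ k ≤ ξ := by rw [hτ]; exact hτu
  have hxy : ∀ k, 0 ≤ x k ∧ 0 ≤ y k ∧ x k + y k = τ k := by rw [hx, hy, hτ]; exact hmass e hes
  have hxy' : ∀ k, 0 ≤ x' k ∧ 0 ≤ y' k ∧ x' k + y' k = τ k := by
    rw [hx', hy', hτ]; exact hmass e' hes'
  obtain ⟨q, hq⟩ : ∃ q : ℝ, q = ({i | e' i ≠ trueLabel n n₁ i} : Set (Fin n)).ncard / n :=
    ⟨_, rfl⟩
  have hq0 : 0 ≤ q := by rw [hq]; positivity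
  have hq1 : q ≤ 1 := by
    rw [hq, div_le_one hn0]
    have := Set.ncard_le_card ({i | e' i ≠ trueLabel n n₁ i} : Set (Fin n))
    rw [Nat.card_eq_fintype_card, Fintype.card_fin] at this
    exact_mod_cast this
  have hqκ : q ≤ ξ ^ 2 * κ := by
    rw [hq, div_le_iff₀ hn0, mul_assoc]; exact hcard
  have hnear : y' 0 + x' 1 ≤ ξ * q := by
    rw [hx', hy', hq, ← add_div, ← mul_div_assoc]
    gcongr
    exact mass_mislabelled_le n₁ hθu hes'
  -- A common bound: the noise of the block sums plus the distance of the mean block sums of e' from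
  -- the true ones.
  obtain ⟨ε, hε⟩ : ∃ ε, ε = K / √lam + 2 * ξ ^ 2 * H * q := ⟨_, rfl⟩
  have hKl : 0 ≤ K / √lam := by positivity
  have hDq : 0 ≤ 2 * ξ ^ 2 * H * q := by positivity
  have hsplit : K * n * √lam / (lam * n) = K / √lam := by
    have := Real.mul_self_sqrt hlam0.le
    field_simp
    rw [pow_two, this]
  have hOdiv : ∀ {u v : ℝ}, |u - v| ≤ K * n * √lam → |u / (lam * n) - v / (lam * n)| ≤ K / √lam := by
    intro u v h
    rw [← sub_div, abs_div, abs_of_pos hN, ← hsplit]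
    gcongr
  obtain ⟨o1, o2, o3⟩ := O_meanMatrix n₁ hlam0.ne' hn0.ne' r w θ e hx hy
  obtain ⟨o1', o2', o3'⟩ := O_meanMatrix n₁ hlam0.ne' hn0.ne' r w θ e' hx' hy'
  obtain ⟨d1, d2, d3⟩ := hO e hes
  obtain ⟨d1', d2', d3'⟩ := hO e' hes'
  replace d1 := hOdiv d1
  replace d2 := hOdiv d2
  replace d3 := hOdiv d3
  replace d1' := hOdiv d1'
  replace d2' := hOdiv d2'
  replace d3' := hOdiv d3'
  rw [o1] at d1
  rw [o2] at d2
  rw [o3] at d3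
  rw [o1'] at d1'
  rw [o2'] at d2'
  rw [o3'] at d3'
  have hnn := O_nonneg hA0 hes
  have hnn' := O_nonneg hA0 hes'
  have hx0 := hxy 0
  have hx1 := hxy 1
  have hx0' := hxy' 0
  have hx1' := hxy' 1
  have hτ0 := hτu' 0
  have hτ1 := hτu' 1
  have hτ0l := hτl' 0
  have hτ1l := hτl' 1
  have hρξ : 0 < ρ / ξ := by positivity
  have b1 : blockForm r w (x 0) (x 1) (x 0) (x 1) ≤ ξ ^ 2 * H := by
    rw [hH]; apply blockForm_le hr hw <;> linarith
  have b2 : blockForm r w (x 0) (x 1) (y 0) (y 1) ≤ ξ ^ 2 * H := by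
    rw [hH]; apply blockForm_le hr hw <;> linarith
  have b3 : blockForm r w (y 0) (y 1) (y 0) (y 1) ≤ ξ ^ 2 * H := by
    rw [hH]; apply blockForm_le hr hw <;> linarith
  have b1' : blockForm r w (x' 0) (x' 1) (x' 0) (x' 1) ≤ ξ ^ 2 * H := by
    rw [hH]; apply blockForm_le hr hw <;> linarith
  have b2' : blockForm r w (x' 0) (x' 1) (y' 0) (y' 1) ≤ ξ ^ 2 * H := by
    rw [hH]; apply blockForm_le hr hw <;> linarith
  have b3' : blockForm r w (y' 0) (y' 1) (y' 0) (y' 1) ≤ ξ ^ 2 * H := by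
    rw [hH]; apply blockForm_le hr hw <;> linarith
  have t1 : blockForm r w (τ 0) 0 (τ 0) 0 ≤ ξ ^ 2 * H := by
    rw [hH]; apply blockForm_le hr hw <;> linarith
  have t2 : blockForm r w (τ 0) 0 0 (τ 1) ≤ ξ ^ 2 * H := by
    rw [hH]; apply blockForm_le hr hw <;> linarith
  have t3 : blockForm r w 0 (τ 1) 0 (τ 1) ≤ ξ ^ 2 * H := by
    rw [hH]; apply blockForm_le hr hw <;> linarith
  have near1 : |blockForm r w (x' 0) (x' 1) (x' 0) (x' 1) - blockForm r w (τ 0) 0 (τ 0) 0| ≤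
      2 * ξ * (1 + 2 * r + w) * (ξ * q) := by
    apply blockForm_sub_le hr hw <;> rw [abs_le] <;> constructor <;> linarith
  have near2 : |blockForm r w (x' 0) (x' 1) (y' 0) (y' 1) - blockForm r w (τ 0) 0 0 (τ 1)| ≤
      2 * ξ * (1 + 2 * r + w) * (ξ * q) := by
    apply blockForm_sub_le hr hw <;> rw [abs_le] <;> constructor <;> linarith
  have near3 : |blockForm r w (y' 0) (y' 1) (y' 0) (y' 1) - blockForm r w 0 (τ 1) 0 (τ 1)| ≤
      2 * ξ * (1 + 2 * r + w) * (ξ * q) := by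
    apply blockForm_sub_le hr hw <;> rw [abs_le] <;> constructor <;> linarith
  have hDq' : 2 * ξ * (1 + 2 * r + w) * (ξ * q) = 2 * ξ ^ 2 * H * q := by rw [hH]; ring
  rw [hDq'] at near1 near2 near3
  have hKK : K / √lam ≤ K := div_le_self (by linarith) hsq1
  have dd1 := abs_le.1 d1
  have dd2 := abs_le.1 d2
  have dd3 := abs_le.1 d3
  have dd1' := abs_le.1 d1'
  have dd2' := abs_le.1 d2'
  have dd3' := abs_le.1 d3'
  have hP1 := profile_sub_le (a := O11 A e / (lam * n)) (b := O12 A e / (lam * n))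
    (d := O22 A e / (lam * n)) (a' := blockForm r w (x 0) (x 1) (x 0) (x 1))
    (b' := blockForm r w (x 0) (x 1) (y 0) (y 1)) (d' := blockForm r w (y 0) (y 1) (y 0) (y 1))
    (B := B) (ε := ε) (div_nonneg hnn.1 hN.le) (div_nonneg hnn.2.1 hN.le)
    (div_nonneg hnn.2.2 hN.le)
    (blockForm_nonneg hr hw hx0.1 hx1.1 hx0.1 hx1.1)
    (blockForm_nonneg hr hw hx0.1 hx1.1 hx0.2.1 hx1.2.1)
    (blockForm_nonneg hr hw hx0.2.1 hx1.2.1 hx0.2.1 hx1.2.1) hB1 (by rw [hB]; linarith)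
    (by rw [hB]; linarith) (by rw [hB]; linarith) (by rw [hB]; linarith)
    (by rw [hε]; linarith) (by rw [hε]; linarith) (by rw [hε]; linarith)
  have hP2 := profile_sub_le (a := O11 A e' / (lam * n)) (b := O12 A e' / (lam * n))
    (d := O22 A e' / (lam * n)) (a' := blockForm r w (τ 0) 0 (τ 0) 0)
    (b' := blockForm r w (τ 0) 0 0 (τ 1)) (d' := blockForm r w 0 (τ 1) 0 (τ 1))
    (B := B) (ε := ε) (div_nonneg hnn'.1 hN.le) (div_nonneg hnn'.2.1 hN.le)
    (div_nonneg hnn'.2.2 hN.le)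
    (blockForm_nonneg hr hw (by linarith) le_rfl (by linarith) le_rfl)
    (blockForm_nonneg hr hw (by linarith) le_rfl le_rfl (by linarith))
    (blockForm_nonneg hr hw le_rfl (by linarith) le_rfl (by linarith)) hB1 (by rw [hB]; linarith)
    (by rw [hB]; linarith) (by rw [hB]; linarith) (by rw [hB]; linarith)
    (by rw [hε]; exact (abs_sub_le _ _ _).trans (add_le_add d1' near1))
    (by rw [hε]; exact (abs_sub_le _ _ _).trans (add_le_add d2' near2))
    (by rw [hε]; exact (abs_sub_le _ _ _).trans (add_le_add d3' near3))
  have hg := hgap (x 0) (x 1) (y 0) (y 1) hx0.1 hx1.1 hx0.2.1 hx1.2.1 (by linarith) (by linarith)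
    (by linarith) (by linarith)
  rw [hx0.2.2, hx1.2.2] at hg
  have hεE : ε ≤ E := by
    rw [hε, hE]
    have : 2 * ξ ^ 2 * H * q ≤ 2 * ξ ^ 2 * H * 1 := by gcongr
    linarith
  have hεl : 1 / √lam ≤ ε := by
    have : 1 / √lam ≤ K / √lam := by gcongr
    linarith
  have hε0 : 0 < ε := lt_of_lt_of_le (by positivity) hεl
  have hlogε := abs_log_le_of_bounds hξ hE1 hlam (by linarith) hlamn hεl hεE
  have hlog2ε : |Real.log (2 * ε)| ≤ Real.log 2 + |Real.log ε| := by
    rw [Real.log_mul (by norm_num) hε0.ne']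
    refine (abs_add_le _ _).trans ?_
    rw [abs_of_pos hlog2]
  have hLn : Real.log 2 ≤ Real.log n := Real.log_le_log (by norm_num) hn1
  have hLn0 : 0 < Real.log n := by linarith
  -- n ≥ 2 lets the constant D be absorbed into a multiple of log n.
  have hlogs : 1 + |Real.log (2 * ε)| + |Real.log ε| + Real.log B ≤
      (2 + D / Real.log 2) * Real.log n := by
    have : D ≤ D / Real.log 2 * Real.log n := by
      rw [div_mul_eq_mul_div, le_div_iff₀ hlog2]
      gcongr
    linarith
  -- Mean likelihood of the truth ≤ likelihood of e' + error ≤ likelihood of e + error ≤ mean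
  -- likelihood of e + 2 errors; the gap bounds the difference of the two ends from below.
  have hmin : c * min (y 0 + x 1) (x 0 + y 1) ≤
      32 * ε * ((2 + D / Real.log 2) * Real.log n) := by
    have q1 := (abs_le.1 hP1).2
    have q2 := (abs_le.1 hP2).1
    have q3 := mul_le_mul_of_nonneg_left hlogs (by positivity : 0 ≤ 16 * ε)
    linarith
  have hεκ : ε ≤ (K + 2 * ξ ^ 2 * H * ξ ^ 2) * (κ + 1 / √lam) := by
    have hκ0 : 0 ≤ κ := by
      have : 0 ≤ ξ ^ 2 * κ := hq0.trans hqκ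
      exact nonneg_of_mul_nonneg_right this (by positivity)
    have h1 : 2 * ξ ^ 2 * H * q ≤ 2 * ξ ^ 2 * H * (ξ ^ 2 * κ) := by gcongr
    have h2 : 0 ≤ K * κ := by positivity
    have h3 : 0 ≤ 2 * ξ ^ 2 * H * ξ ^ 2 * (1 / √lam) := by positivity
    have h4 : K / √lam = K * (1 / √lam) := by ring
    rw [hε, h4]
    linarith
  have hmis : misclustered (trueLabel n n₁) e ≤ ξ * min (y 0 + x 1) (x 0 + y 1) := by
    unfold misclustered
    rw [div_le_iff₀ hn0, mul_assoc, Nat.cast_min, min_mul_of_nonneg _ _ hn0.le, mul_min_of_nonneg _ _ hξ0.le]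
    apply min_le_min
    · refine (ncard_mislabelled_le n₁ hξ0 hθl hes).trans_eq ?_
      rw [hx, hy, ← add_div, div_mul_cancel₀ _ hn0.ne']
    · have hneg : ∀ i, (-e) i = -1 ∨ (-e) i = 1 := by
        intro i
        rcases hes i with h | h <;> simp [h]
      refine (ncard_mislabelled_le n₁ hξ0 hθl hneg).trans_eq ?_
      rw [labelSet_neg, sub_sub_cancel, hx, hy, ← add_div, div_mul_cancel₀ _ hn0.ne']
  calc misclustered (trueLabel n n₁) e ≤ ξ * min (y 0 + x 1) (x 0 + y 1) := hmis
    _ = ξ / c * (c * min (y 0 + x 1) (x 0 + y 1)) := by field_simp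
    _ ≤ ξ / c * (32 * ((K + 2 * ξ ^ 2 * H * ξ ^ 2) * (κ + 1 / √lam)) *
        ((2 + D / Real.log 2) * Real.log n)) := by
      refine mul_le_mul_of_nonneg_left (hmin.trans ?_) (by positivity)
      gcongr
    _ = _ := by ring

end Estimation

/-! ### The range of the mean matrix -/

section Range

open scoped Matrix

variable {n : ℕ}

/-- The vector of the signed degree parameters is the image under the mean matrix of a vector of
norm `O(√n / lam)`. -/
lemma exists_meanMatrix_preimage {r w ξ ρ lam : ℝ} (hr : 0 ≤ r) (hw : 0 ≤ w) (hrw : r ^ 2 ≠ w)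
    (hξ : 1 ≤ ξ) (hρ : 0 < ρ) (hlam : 0 < lam) (hn : 0 < n) {n₁ : ℕ} (hn₁ : n₁ ≤ n)
    (h0 : ρ * n ≤ n₁) (h1 : ρ * n ≤ n - n₁) {θ : Fin n → ℝ} (hθ : ∀ i, 1 / ξ ≤ θ i) :
    ∃ z : Fin n → ℝ, meanMatrix n₁ lam r w θ *ᵥ z = θ * trueLabel n n₁ ∧
      z ⬝ᵥ z ≤ ((1 + r + w) / |w - r ^ 2| * (ξ / ρ)) ^ 2 / lam ^ 2 * n := by
  have hn0 : (0 : ℝ) < n := by exact_mod_cast hn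
  have hd : w - r ^ 2 ≠ 0 := sub_ne_zero.2 hrw.symm
  have hξ0 : 0 < ξ := by linarith
  obtain ⟨T, hT⟩ : ∃ T : Fin 2 → ℝ, T = massMatrix n₁ θ *ᵥ 1 := ⟨_, rfl⟩
  have hTl : ∀ k, ρ * n / ξ ≤ T k := by
    intro k; rw [hT]; exact mass_ge hξ0 h0 h1 hn₁ hθ k
  have hTp : ∀ k, 0 < T k := fun k => lt_of_lt_of_le (by positivity) (hTl k)
  -- s / (w - r²) is the inverse of `[[1, r], [r, w]]` applied to (1, -1). Dividing by the masses T
  -- gives a preimage that is constant on communities.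
  obtain ⟨s, hs⟩ : ∃ s : Fin 2 → ℝ, s = ![w + r, -(1 + r)] := ⟨_, rfl⟩
  obtain ⟨y, hy⟩ : ∃ y : Fin 2 → ℝ, y = fun k => n / lam * (s k / (w - r ^ 2)) / T k := ⟨_, rfl⟩
  have hs_le : ∀ k, |s k| ≤ 1 + r + w := by
    intro k
    rw [hs]
    fin_cases k
    · simp only [Fin.zero_eta, Matrix.cons_val_zero]
      rw [abs_of_nonneg (by linarith)]; linarith
    · simp only [Fin.mk_one, Matrix.cons_val_one, Matrix.cons_val_fin_one]
      rw [abs_neg, abs_of_nonneg (by linarith)]; linarith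
  have hyb : ∀ k, y k * y k ≤ ((1 + r + w) / |w - r ^ 2| * (ξ / ρ)) ^ 2 / lam ^ 2 := by
    intro k
    rw [← pow_two, ← div_pow, ← sq_abs (y k)]
    apply pow_le_pow_left₀ (abs_nonneg _)
    rw [hy]
    simp only
    rw [abs_div, abs_mul, abs_div (s k), abs_of_pos (hTp k), abs_of_pos (by positivity : 0 < n / lam)]
    calc n / lam * (|s k| / |w - r ^ 2|) / T k ≤
        n / lam * ((1 + r + w) / |w - r ^ 2|) / (ρ * n / ξ) := by
          gcongr
          · exact hs_le k
          · exact hTl k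
      _ = _ := by
          have : |w - r ^ 2| ≠ 0 := abs_ne_zero.2 hd
          field_simp
  obtain ⟨z, hz⟩ : ∃ z : Fin n → ℝ, z = fun i => y (comm n₁ i) := ⟨_, rfl⟩
  have hgz : ∀ k, (massMatrix n₁ θ *ᵥ z) k = T k * y k := by
    intro k
    rw [hT]
    simp only [Matrix.mulVec, dotProduct, Finset.sum_mul]
    apply Finset.sum_congr rfl
    intro i _
    simp only [massMatrix, Matrix.of_apply, hz, Pi.one_apply]
    split_ifs with h
    · rw [h]; ring
    · ring
  have hTy : ∀ k, T k * y k = n / lam * (s k / (w - r ^ 2)) := by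
    intro k; rw [hy]; exact mul_div_cancel₀ _ (hTp k).ne'
  refine ⟨z, ?_, ?_⟩
  · rw [meanMatrix_eq, ← Matrix.mulVec_mulVec, ← Matrix.mulVec_mulVec]
    obtain ⟨v, hv⟩ : ∃ v, v = blockProb n lam r w *ᵥ (massMatrix n₁ θ *ᵥ z) := ⟨_, rfl⟩
    have hv0 : v 0 = 1 := by
      rw [hv]
      simp only [blockProb, Matrix.mulVec, dotProduct, Fin.sum_univ_two] at hgz ⊢
      rw [hgz, hgz, hTy, hTy, hs]
      simp only [Matrix.smul_apply, Matrix.of_apply, Matrix.cons_val', Matrix.cons_val_zero,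
        Matrix.cons_val_one, smul_eq_mul, Matrix.cons_val_fin_one]
      field_simp; ring
    have hv1 : v 1 = -1 := by
      rw [hv]
      simp only [blockProb, Matrix.mulVec, dotProduct, Fin.sum_univ_two] at hgz ⊢
      rw [hgz, hgz, hTy, hTy, hs]
      simp only [Matrix.smul_apply, Matrix.of_apply, Matrix.cons_val', Matrix.cons_val_zero,
        Matrix.cons_val_one, smul_eq_mul, Matrix.cons_val_fin_one]
      field_simp; ring
    rw [← hv]
    ext i
    simp only [Matrix.mulVec, dotProduct, Fin.sum_univ_two, Matrix.transpose_apply, hv0, hv1,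
      massMatrix, Matrix.of_apply, comm, Pi.mul_apply, trueLabel]
    by_cases hi : (i : ℕ) < n₁ <;> simp [hi]
  · calc z ⬝ᵥ z ≤ ∑ _i : Fin n, ((1 + r + w) / |w - r ^ 2| * (ξ / ρ)) ^ 2 / lam ^ 2 := by
          apply Finset.sum_le_sum
          intro i _
          rw [hz]; exact hyb _
      _ = _ := by simp [mul_comm]

lemma signed_dotProduct_le (n₁ : ℕ) {θ : Fin n → ℝ} {ξ : ℝ} (h0 : ∀ i, 0 ≤ θ i)
    (hθ : ∀ i, θ i ≤ ξ) :
    (θ * trueLabel n n₁) ⬝ᵥ (θ * trueLabel n n₁) ≤ ξ ^ 2 * n := by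
  calc (θ * trueLabel n n₁) ⬝ᵥ (θ * trueLabel n n₁) ≤ ∑ _i : Fin n, ξ ^ 2 := by
        apply Finset.sum_le_sum
        intro i _
        have : θ i ^ 2 ≤ ξ ^ 2 := pow_le_pow_left₀ (h0 i) (hθ i) 2
        rcases trueLabel_mem n n₁ i with h | h <;> simp only [Pi.mul_apply, h] <;> linarith
    _ = _ := by simp [mul_comm]

lemma transpose_mulVec_sq_le (U : Matrix (Fin 2) (Fin n) ℝ) (a : Fin 2 → ℝ) :
    (Uᵀ *ᵥ a) ⬝ᵥ (Uᵀ *ᵥ a) ≤ specNorm U ^ 2 * (a ⬝ᵥ a) := by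
  open scoped Matrix.Norms.L2Operator in
  have h1 := Matrix.l2_opNorm_mulVec Uᵀ (WithLp.toLp 2 a)
  have h2 : ‖Uᵀ‖ = ‖U‖ := by
    rw [← Matrix.conjTranspose_eq_transpose_of_trivial, Matrix.l2_opNorm_conjTranspose]
  rw [h2] at h1
  have h3 := pow_le_pow_left₀ (norm_nonneg _) h1 2
  rw [mul_pow, EuclideanSpace.norm_sq_eq, EuclideanSpace.norm_sq_eq] at h3
  unfold specNorm
  simpa [dotProduct, pow_two] using h3

/-- The leading eigenvectors of the mean matrix span the vector of signed degree parameters, up to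
the distance between the eigenvectors. -/
lemma exists_residual_le_of_mean {r w ξ ρ lam : ℝ} (hr : 0 ≤ r) (hw : 0 ≤ w) (hrw : r ^ 2 ≠ w)
    (hξ : 1 ≤ ξ) (hρ : 0 < ρ) (hlam : 0 < lam) (hn : 0 < n) {n₁ : ℕ} (hn₁ : n₁ ≤ n)
    (h0 : ρ * n ≤ n₁) (h1 : ρ * n ≤ n - n₁) {θ : Fin n → ℝ} (hθ : ∀ i, 1 / ξ ≤ θ i)
    (hθu : ∀ i, θ i ≤ ξ) (U V : Matrix (Fin 2) (Fin n) ℝ)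
    (hV : IsLeadingEigenvectors abs (meanMatrix n₁ lam r w θ) V) :
    ∃ a : Fin 2 → ℝ, (Uᵀ *ᵥ a - θ * trueLabel n n₁) ⬝ᵥ (Uᵀ *ᵥ a - θ * trueLabel n n₁) ≤
      ξ ^ 2 * specNorm (U - V) ^ 2 * n := by
  have hθ0 : ∀ i, 0 ≤ θ i := fun i => le_trans (by positivity) (hθ i)
  obtain ⟨z, hz, -⟩ := exists_meanMatrix_preimage hr hw hrw hξ hρ hlam hn hn₁ h0 h1 hθ
  -- With zero perturbation the residual vanishes: the rows of `V` span the range of the mean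
  -- matrix.
  have hres := leading_residual_le (b := 0) (meanMatrix_isSymm n₁ lam r w θ) (massMatrix n₁ θ)
    (fun x hx => meanMatrix_mulVec_eq_zero (lam := lam) (r := r) (w := w) hx) le_rfl
    (fun x => by simp) (Or.inl hV) z
  rw [hz] at hres
  obtain ⟨v, hv⟩ : ∃ v, v = θ * trueLabel n n₁ := ⟨_, rfl⟩
  have hnorm := signed_dotProduct_le n₁ hθ0 hθu
  rw [← hv] at hres hnorm ⊢
  have hfix : Vᵀ *ᵥ (V *ᵥ v) - v = 0 := by
    rw [← dotProduct_self_eq_zero]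
    exact le_antisymm (hres.trans (by simp)) (dotProduct_self_nonneg' _)
  refine ⟨V *ᵥ v, ?_⟩
  have e1 : Uᵀ *ᵥ (V *ᵥ v) - v = (U - V)ᵀ *ᵥ (V *ᵥ v) := by
    rw [Matrix.transpose_sub, Matrix.sub_mulVec, sub_eq_zero.1 hfix]
  have e2 : (V *ᵥ v) ⬝ᵥ (V *ᵥ v) = v ⬝ᵥ v := by
    rw [← transpose_mulVec_dotProduct, sub_eq_zero.1 hfix]
  rw [e1]
  refine (transpose_mulVec_sq_le _ _).trans ?_
  rw [e2]
  calc _ ≤ specNorm (U - V) ^ 2 * (ξ ^ 2 * n) := by gcongr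
    _ = _ := by ring

/-- The leading eigenvectors of a perturbation of the mean matrix nearly span the vector of signed
degree parameters. -/
lemma exists_residual_le_of_perturbation {r w ξ ρ lam : ℝ} (hr : 0 ≤ r) (hw : 0 ≤ w)
    (hrw : r ^ 2 ≠ w) (hξ : 1 ≤ ξ) (hρ : 0 < ρ) (hlam : 0 < lam) (hn : 0 < n) {n₁ : ℕ}
    (hn₁ : n₁ ≤ n) (h0 : ρ * n ≤ n₁) (h1 : ρ * n ≤ n - n₁) {θ : Fin n → ℝ}
    (hθ : ∀ i, 1 / ξ ≤ θ i) {A : Matrix (Fin n) (Fin n) ℝ} (hA : A.IsSymm) {b : ℝ} (hb : 0 ≤ b)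
    (hAB : ∀ x, ((A - meanMatrix n₁ lam r w θ) *ᵥ x) ⬝ᵥ ((A - meanMatrix n₁ lam r w θ) *ᵥ x) ≤
      b ^ 2 * (x ⬝ᵥ x)) (U : Matrix (Fin 2) (Fin n) ℝ)
    (hU : IsLeadingEigenvectors abs A U ∨ (r ^ 2 < w ∧ IsLeadingEigenvectors id A U)) :
    ∃ a : Fin 2 → ℝ, (Uᵀ *ᵥ a - θ * trueLabel n n₁) ⬝ᵥ (Uᵀ *ᵥ a - θ * trueLabel n n₁) ≤
      4 * ((1 + r + w) / |w - r ^ 2| * (ξ / ρ)) ^ 2 * (b ^ 2 / lam ^ 2) * n := by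
  obtain ⟨z, hz, hzz⟩ := exists_meanMatrix_preimage hr hw hrw hξ hρ hlam hn hn₁ h0 h1 hθ
  have hres := leading_residual_le hA (massMatrix n₁ θ)
    (fun x hx => meanMatrix_mulVec_eq_zero (lam := lam) (r := r) (w := w) hx) hb hAB
    (hU.imp_right fun h => ⟨meanMatrix_nonneg_form n₁ hlam.le h.1.le θ, h.2⟩) z
  rw [hz] at hres
  refine ⟨_, hres.trans ?_⟩
  calc 4 * b ^ 2 * (z ⬝ᵥ z) ≤
      4 * b ^ 2 * (((1 + r + w) / |w - r ^ 2| * (ξ / ρ)) ^ 2 / lam ^ 2 * n) := by gcongr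
    _ = _ := by ring

end Range

/-! ### Errors -/

lemma sqNorm_sub_eq {n : ℕ} {c e : Fin n → ℝ} (hc : ∀ i, c i = -1 ∨ c i = 1)
    (he : ∀ i, e i = -1 ∨ e i = 1) :
    sqNorm (c - e) = 4 * (({i | e i ≠ c i} : Set (Fin n)).ncard : ℝ) := by
  unfold sqNorm
  rw [EuclideanSpace.norm_sq_eq, ncard_eq_sum, Finset.mul_sum]
  apply Finset.sum_congr rfl
  intro i _
  rcases hc i with h | h <;> rcases he i with h' | h' <;> simp [h, h'] <;> norm_num

lemma min_sqNorm_eq {n : ℕ} {c e : Fin n → ℝ} (hc : ∀ i, c i = -1 ∨ c i = 1)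
    (he : ∀ i, e i = -1 ∨ e i = 1) :
    1 / (n : ℝ) * min (sqNorm (c - e)) (sqNorm (c + e)) = 4 * misclustered c e := by
  have h1 := sqNorm_sub_eq hc he
  have h2 := sqNorm_sub_eq (e := -e) hc (fun i => by rcases he i with h | h <;> simp [h])
  rw [sub_neg_eq_add] at h2
  rw [h1, h2, ← mul_min_of_nonneg _ _ (by norm_num), misclustered, Nat.cast_min]
  simp only [Pi.neg_apply]
  ring

/-- The error counts of e and of -e add up to n. This settles every case in which the claimed bound
is not small. -/
lemma misclustered_le_half {n : ℕ} {c e : Fin n → ℝ} (hc : ∀ i, c i = -1 ∨ c i = 1)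
    (he : ∀ i, e i = -1 ∨ e i = 1) : misclustered c e ≤ 1 / 2 := by
  rcases Nat.eq_zero_or_pos n with rfl | hn
  · simp [misclustered]
  have hn0 : (0 : ℝ) < n := by exact_mod_cast hn
  rw [misclustered, Nat.cast_min, div_le_iff₀ hn0]
  have : ((({i | e i ≠ c i} : Set (Fin n)).ncard : ℝ) + ({i | -e i ≠ c i} : Set (Fin n)).ncard) =
      n := by
    rw [ncard_eq_sum, ncard_eq_sum, ← Finset.sum_add_distrib]
    have : ∀ i : Fin n, ((if e i ≠ c i then (1 : ℝ) else 0) + if -e i ≠ c i then (1 : ℝ) else 0) =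
        1 := by
      intro i
      rcases hc i with h | h <;> rcases he i with h' | h' <;> rw [h, h'] <;> norm_num
    rw [Finset.sum_congr rfl fun i _ => this i]; simp
  rcases min_cases ((({i | e i ≠ c i} : Set (Fin n)).ncard : ℝ))
    (({i | -e i ≠ c i} : Set (Fin n)).ncard : ℝ) with h | h <;> linarith

/-! ### Independent Bernoulli variables -/

section Bernoulli

variable {ι : Type*} [Fintype ι]

/-- The value of a Bernoulli variable. -/
def bit (b : Bool) : ℝ := if b then 1 else 0

/-- The probability of an outcome of independent Bernoulli variables of parameters `p`. -/
def bernWeight (p : ι → ℝ) (s : ι → Bool) : ℝ := ∏ i, if s i then p i else 1 - p i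

lemma bernWeight_nonneg {p : ι → ℝ} (hp : ∀ i, p i ∈ Set.Icc (0 : ℝ) 1) (s : ι → Bool) :
    0 ≤ bernWeight p s := by
  apply Finset.prod_nonneg
  intro i _
  split_ifs
  · exact (hp i).1
  · linarith [(hp i).2]

variable [DecidableEq ι]

/-- The expectation with respect to independent Bernoulli variables of parameters `p`. -/
def bernE (p : ι → ℝ) (F : (ι → Bool) → ℝ) : ℝ := ∑ s, bernWeight p s * F s

lemma bernE_mono {p : ι → ℝ} (hp : ∀ i, p i ∈ Set.Icc (0 : ℝ) 1) {F G : (ι → Bool) → ℝ}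
    (h : ∀ s, F s ≤ G s) : bernE p F ≤ bernE p G :=
  Finset.sum_le_sum fun s _ => mul_le_mul_of_nonneg_left (h s) (bernWeight_nonneg hp s)

lemma bernE_nonneg {p : ι → ℝ} (hp : ∀ i, p i ∈ Set.Icc (0 : ℝ) 1) {F : (ι → Bool) → ℝ}
    (h : ∀ s, 0 ≤ F s) : 0 ≤ bernE p F :=
  Finset.sum_nonneg fun s _ => mul_nonneg (bernWeight_nonneg hp s) (h s)

lemma bernE_add (p : ι → ℝ) (F G : (ι → Bool) → ℝ) :
    bernE p (fun s => F s + G s) = bernE p F + bernE p G := by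
  simp only [bernE, mul_add, Finset.sum_add_distrib]

lemma bernE_const_mul (p : ι → ℝ) (c : ℝ) (F : (ι → Bool) → ℝ) :
    bernE p (fun s => c * F s) = c * bernE p F := by
  simp only [bernE, Finset.mul_sum]
  exact Finset.sum_congr rfl fun s _ => by ring

lemma bernE_sum {κ : Type*} (t : Finset κ) (p : ι → ℝ) (F : κ → (ι → Bool) → ℝ) :
    bernE p (fun s => ∑ k ∈ t, F k s) = ∑ k ∈ t, bernE p (F k) := by
  simp only [bernE, Finset.mul_sum]
  exact Finset.sum_comm

lemma bernE_prod (p : ι → ℝ) (g : ι → Bool → ℝ) :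
    bernE p (fun s => ∏ i, g i (s i)) = ∏ i, (p i * g i true + (1 - p i) * g i false) := by
  have h : ∀ i, p i * g i true + (1 - p i) * g i false =
      ∑ b : Bool, (if b then p i else 1 - p i) * g i b := by
    intro i; simp
  rw [Finset.prod_congr rfl fun i _ => h i, Finset.prod_univ_sum, Fintype.piFinset_univ]
  simp only [bernE, bernWeight, Finset.prod_mul_distrib]

lemma bernE_const (p : ι → ℝ) (c : ℝ) : bernE p (fun _ => c) = c := by
  have h := bernE_prod p fun _ _ => 1
  simp only [mul_one, add_sub_cancel, Finset.prod_const_one] at h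
  have h2 := bernE_const_mul p c fun _ => 1
  rw [h, mul_one] at h2
  simpa using h2

/-- The law of total expectation with respect to one coordinate. -/
lemma bernE_condition (p : ι → ℝ) (e : ι) (F : (ι → Bool) → ℝ) :
    bernE p F = bernE p fun s => p e * F (Function.update s e true) +
      (1 - p e) * F (Function.update s e false) := by
  -- Both expectations are averaged over the flip of coordinate e, after which they agree term by
  -- term.
  have flip : Function.Involutive fun s : ι → Bool => Function.update s e (!(s e)) := by
    intro s
    ext i
    by_cases hi : i = e
    · subst hi; simp
    · simp [Function.update_of_ne hi]
  have dbl : ∀ G : (ι → Bool) → ℝ,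
      2 * ∑ s, G s = ∑ s, (G s + G (Function.update s e (!(s e)))) := by
    intro G
    rw [Finset.sum_add_distrib, two_mul]
    congr 1
    exact (Equiv.sum_comp flip.toPerm G).symm
  have hw : ∀ (s : ι → Bool) (b : Bool), bernWeight p (Function.update s e b) =
      (if b then p e else 1 - p e) * ∏ i ∈ Finset.univ.erase e, if s i then p i else 1 - p i := by
    intro s b
    unfold bernWeight
    rw [← Finset.mul_prod_erase Finset.univ _ (Finset.mem_univ e), Function.update_self]
    congr 1
    apply Finset.prod_congr rfl
    intro i hi
    rw [Function.update_of_ne (Finset.ne_of_mem_erase hi)]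
  have hw' : ∀ s : ι → Bool, bernWeight p s =
      (if s e then p e else 1 - p e) * ∏ i ∈ Finset.univ.erase e, if s i then p i else 1 - p i := by
    intro s
    have := hw s (s e)
    rwa [Function.update_eq_self] at this
  have h2 : (2 : ℝ) ≠ 0 := two_ne_zero
  apply mul_left_cancel₀ h2
  unfold bernE
  rw [dbl, dbl]
  apply Finset.sum_congr rfl
  intro s _
  rw [hw, hw' s]
  simp only [Function.update_idem]
  cases hs : s e
  · have : Function.update s e false = s := by rw [← hs, Function.update_eq_self]
    simp only [Bool.not_false, this, if_true, Bool.false_eq_true, if_false]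
    ring
  · have : Function.update s e true = s := by rw [← hs, Function.update_eq_self]
    simp only [Bool.not_true, this, if_true, Bool.false_eq_true, if_false]
    ring

/-- Markov's inequality. -/
lemma bernE_indicator_le {p : ι → ℝ} (hp : ∀ i, p i ∈ Set.Icc (0 : ℝ) 1) {F : (ι → Bool) → ℝ}
    (hF : ∀ s, 0 ≤ F s) {b : ℝ} (hb : 0 < b) (P : (ι → Bool) → Prop) [DecidablePred P]
    (hP : ∀ s, P s → b ≤ F s) : bernE p (fun s => if P s then 1 else 0) ≤ bernE p F / b := by
  rw [div_eq_inv_mul, ← bernE_const_mul]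
  apply bernE_mono hp
  intro s
  split_ifs with h
  · rw [← div_eq_inv_mul, le_div_iff₀ hb, one_mul]; exact hP s h
  · exact mul_nonneg (inv_nonneg.2 hb.le) (hF s)

/-- From exp u ≤ 1 + u + u² and 1 + y ≤ exp y. Keeping the factor p, unlike Hoeffding's bound, is
essential for sparse graphs. -/
lemma bernoulli_exp_le {p u : ℝ} (hp : p ∈ Set.Icc (0 : ℝ) 1) (hu : |u| ≤ 1) :
    p * Real.exp (u * (1 - p)) + (1 - p) * Real.exp (u * (0 - p)) ≤ Real.exp (p * u ^ 2) := by
  have h1 : Real.exp (u * (1 - p)) = Real.exp (u * (0 - p)) * Real.exp u := by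
    rw [← Real.exp_add]; ring_nf
  have h2 := (abs_le.1 (Real.abs_exp_sub_one_sub_id_le hu)).2
  have h3 : p * (Real.exp u - 1) + 1 ≤ Real.exp (p * (Real.exp u - 1)) := Real.add_one_le_exp _
  have h4 : p * Real.exp u + (1 - p) ≤ Real.exp (p * (u + u ^ 2)) := by
    calc p * Real.exp u + (1 - p) = p * (Real.exp u - 1) + 1 := by ring
      _ ≤ _ := h3
      _ ≤ _ := by
        apply Real.exp_le_exp.2
        apply mul_le_mul_of_nonneg_left _ hp.1
        linarith
  calc _ = Real.exp (u * (0 - p)) * (p * Real.exp u + (1 - p)) := by rw [h1]; ring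
    _ ≤ Real.exp (u * (0 - p)) * Real.exp (p * (u + u ^ 2)) := by gcongr
    _ = _ := by rw [← Real.exp_add]; ring_nf

/-- A Chernoff bound for weighted sums of independent Bernoulli variables. -/
lemma bernE_chernoff {p : ι → ℝ} (hp : ∀ i, p i ∈ Set.Icc (0 : ℝ) 1) (b : ι → ℝ) (u t : ℝ)
    (hub : ∀ i, |u * b i| ≤ 1) (P : (ι → Bool) → Prop) [DecidablePred P]
    (hP : ∀ s, P s → t ≤ u * ∑ i, b i * (bit (s i) - p i)) :
    bernE p (fun s => if P s then 1 else 0) ≤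
      Real.exp (u ^ 2 * ∑ i, p i * b i ^ 2 - t) := by
  have h1 := bernE_indicator_le hp (F := fun s => ∏ i, Real.exp (u * b i * (bit (s i) - p i)))
    (fun s => Finset.prod_nonneg fun i _ => (Real.exp_pos _).le) (Real.exp_pos t) P (by
      intro s hs
      rw [← Real.exp_sum]
      apply Real.exp_le_exp.2
      refine (hP s hs).trans_eq ?_
      rw [Finset.mul_sum]
      exact Finset.sum_congr rfl fun i _ => by ring)
  refine h1.trans ?_
  rw [bernE_prod p fun i b' => Real.exp (u * b i * (bit b' - p i)), Real.exp_sub]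
  apply div_le_div_of_nonneg_right _ (Real.exp_pos t).le
  rw [Finset.mul_sum, Real.exp_sum]
  apply Finset.prod_le_prod
  · intro i _
    have := hp i
    have h1 := this.1
    have h2 := sub_nonneg.2 this.2
    positivity
  · intro i _
    have := bernoulli_exp_le (hp i) (hub i)
    simp only [bit, if_true, Bool.false_eq_true, if_false]
    refine this.trans_eq ?_
    congr 1; ring

end Bernoulli

/-! ### Trace moments of random matrices -/

section Trace

open scoped Matrix

variable {m : Type*} [Fintype m] [DecidableEq m]

/-- The terms q and 2 r - q are paired. By rearrangement each pair is at most |d|^(2r) + |f|^(2r),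
and the even exponent removes the absolute values. -/
lemma two_mul_sum_pow_mul_pow_le (d f : ℝ) (r : ℕ) :
    2 * ∑ q ∈ Finset.range (2 * r + 1), d ^ q * f ^ (2 * r - q) ≤
      (2 * r + 1) * (d ^ (2 * r) + f ^ (2 * r)) := by
  have hrefl := Finset.sum_range_reflect (fun q => d ^ q * f ^ (2 * r - q)) (2 * r + 1)
  rw [two_mul]
  nth_rewrite 1 [← hrefl]
  rw [← Finset.sum_add_distrib]
  have : ((2 * r + 1 : ℝ)) * (d ^ (2 * r) + f ^ (2 * r)) =
      ∑ _q ∈ Finset.range (2 * r + 1), (d ^ (2 * r) + f ^ (2 * r)) := by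
    simp; ring
  rw [this]
  apply Finset.sum_le_sum
  intro q hq
  obtain ⟨s, hs⟩ : ∃ s, 2 * r = q + s := Nat.exists_eq_add_of_le (by
    have := Finset.mem_range.1 hq; omega)
  have e1 : 2 * r + 1 - 1 - q = s := by omega
  have e2 : 2 * r - s = q := by omega
  have e3 : 2 * r - q = s := by omega
  rw [e1, e2, e3]
  have ev : Even (2 * r) := even_two_mul r
  rw [← ev.pow_abs d, ← ev.pow_abs f, hs, pow_add, pow_add]
  have a1 : d ^ s * f ^ q ≤ |d| ^ s * |f| ^ q := by
    rw [← abs_pow, ← abs_pow, ← abs_mul]; exact le_abs_self _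
  have a2 : d ^ q * f ^ s ≤ |d| ^ q * |f| ^ s := by
    rw [← abs_pow, ← abs_pow, ← abs_mul]; exact le_abs_self _
  have a3 : 0 ≤ (|d| ^ q - |f| ^ q) * (|d| ^ s - |f| ^ s) := by
    rcases le_total |d| |f| with h | h
    · exact mul_nonneg_of_nonpos_of_nonpos
        (sub_nonpos.2 (pow_le_pow_left₀ (abs_nonneg _) h _))
        (sub_nonpos.2 (pow_le_pow_left₀ (abs_nonneg _) h _))
    · exact mul_nonneg
        (sub_nonneg.2 (pow_le_pow_left₀ (abs_nonneg _) h _))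
        (sub_nonneg.2 (pow_le_pow_left₀ (abs_nonneg _) h _))
  nlinarith

lemma conj_diagonal_pow {Q : Matrix m m ℝ} (hQ : Qᵀ * Q = 1) (hQ' : Q * Qᵀ = 1) (d : m → ℝ)
    (k : ℕ) : (Q * Matrix.diagonal d * Qᵀ) ^ k = Q * Matrix.diagonal (d ^ k) * Qᵀ := by
  induction k with
  | zero => simp [hQ']
  | succ k ih =>
    rw [pow_succ, ih]
    calc Q * Matrix.diagonal (d ^ k) * Qᵀ * (Q * Matrix.diagonal d * Qᵀ) =
        Q * Matrix.diagonal (d ^ k) * (Qᵀ * Q) * Matrix.diagonal d * Qᵀ := by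
          simp only [Matrix.mul_assoc]
      _ = Q * (Matrix.diagonal (d ^ k) * Matrix.diagonal d) * Qᵀ := by
          rw [hQ, Matrix.mul_one, Matrix.mul_assoc Q]
      _ = _ := by
          rw [Matrix.diagonal_mul_diagonal]
          rfl

/-- The trace of alternating products, in eigenbases. -/
lemma trace_mul_conj_diagonal {H : Matrix m m ℝ} (hH : H.IsSymm) (Q R : Matrix m m ℝ)
    (d f : m → ℝ) :
    (H * (Q * Matrix.diagonal d * Qᵀ) * H * (R * Matrix.diagonal f * Rᵀ)).trace =
      ∑ j, ∑ k, d j * f k * ((Qᵀ * H * R) j k) ^ 2 := by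
  obtain ⟨G, hG⟩ : ∃ G, G = Qᵀ * H * R := ⟨_, rfl⟩
  have hGt : Gᵀ = Rᵀ * H * Q := by
    rw [hG, Matrix.transpose_mul, Matrix.transpose_mul, Matrix.transpose_transpose, hH.eq,
      Matrix.mul_assoc]
  have h1 : H * (Q * Matrix.diagonal d * Qᵀ) * H * (R * Matrix.diagonal f * Rᵀ) =
      (H * Q * Matrix.diagonal d * G * Matrix.diagonal f) * Rᵀ := by
    rw [hG]; simp only [Matrix.mul_assoc]
  have h2 : Rᵀ * (H * Q * Matrix.diagonal d * G * Matrix.diagonal f) =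
      Gᵀ * Matrix.diagonal d * (G * Matrix.diagonal f) := by
    rw [hGt]; simp only [Matrix.mul_assoc]
  rw [h1, Matrix.trace_mul_comm, h2, ← hG, Matrix.trace]
  rw [Finset.sum_comm]
  apply Finset.sum_congr rfl
  intro k _
  rw [Matrix.diag_apply, Matrix.mul_apply]
  apply Finset.sum_congr rfl
  intro j _
  rw [Matrix.mul_diagonal, Matrix.mul_diagonal, Matrix.transpose_apply]
  ring

/-- In eigenbases of `W` and `Y` every trace is a sum over pairs of eigenvalues with the same
weights, which are squares; the scalar inequality applies to each pair. -/
lemma two_mul_sum_trace_le {H W Y : Matrix m m ℝ} (hH : H.IsSymm) (hW : W.IsSymm) (hY : Y.IsSymm)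
    (r : ℕ) :
    2 * ∑ q ∈ Finset.range (2 * r + 1), (H * W ^ q * H * Y ^ (2 * r - q)).trace ≤
      (2 * r + 1) * ((H * H * W ^ (2 * r)).trace + (H * H * Y ^ (2 * r)).trace) := by
  obtain ⟨Q, d, hQ, hQ', rfl⟩ := exists_orthogonal_diagonalization hW
  obtain ⟨R, f, hR, hR', rfl⟩ := exists_orthogonal_diagonalization hY
  have h1 : ∀ q s, (H * (Q * Matrix.diagonal d * Qᵀ) ^ q * H *
      (R * Matrix.diagonal f * Rᵀ) ^ s).trace =
      ∑ j, ∑ k, d j ^ q * f k ^ s * ((Qᵀ * H * R) j k) ^ 2 := by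
    intro q s
    rw [conj_diagonal_pow hQ hQ', conj_diagonal_pow hR hR', trace_mul_conj_diagonal hH]
    rfl
  have h2 : (H * H * (Q * Matrix.diagonal d * Qᵀ) ^ (2 * r)).trace =
      ∑ j, ∑ k, d j ^ (2 * r) * ((Qᵀ * H * R) j k) ^ 2 := by
    have := h1 (2 * r) 0
    rw [pow_zero, Matrix.mul_one, Matrix.mul_assoc, Matrix.trace_mul_comm, Matrix.mul_assoc,
      Matrix.trace_mul_comm] at this
    simpa using this
  have h3 : (H * H * (R * Matrix.diagonal f * Rᵀ) ^ (2 * r)).trace =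
      ∑ j, ∑ k, f k ^ (2 * r) * ((Qᵀ * H * R) j k) ^ 2 := by
    have := h1 0 (2 * r)
    rw [pow_zero, Matrix.mul_one] at this
    simpa using this
  rw [h2, h3, ← Finset.sum_add_distrib]
  simp only [h1]
  rw [Finset.sum_comm, Finset.mul_sum, Finset.mul_sum]
  apply Finset.sum_le_sum
  intro j _
  rw [Finset.sum_comm, ← Finset.sum_add_distrib, Finset.mul_sum, Finset.mul_sum]
  apply Finset.sum_le_sum
  intro k _
  rw [← Finset.sum_mul, ← add_mul, ← mul_assoc, ← mul_assoc]
  exact mul_le_mul_of_nonneg_right (two_mul_sum_pow_mul_pow_le _ _ r) (sq_nonneg _)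

lemma add_pow_sub_pow {R : Type*} [Ring R] (x e : R) (k : ℕ) :
    (x + e) ^ k - x ^ k = ∑ q ∈ Finset.range k, (x + e) ^ q * e * x ^ (k - 1 - q) := by
  induction k with
  | zero => simp
  | succ k ih =>
    rw [Finset.sum_range_succ]
    have h1 : ∀ q ∈ Finset.range k, (x + e) ^ q * e * x ^ (k + 1 - 1 - q) =
        (x + e) ^ q * e * x ^ (k - 1 - q) * x := by
      intro q hq
      have := Finset.mem_range.1 hq
      rw [mul_assoc _ _ x, ← pow_succ]
      congr 2; omega
    rw [Finset.sum_congr rfl h1, ← Finset.sum_mul, ← ih]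
    simp only [Nat.add_sub_cancel, Nat.sub_self, pow_zero, mul_one]
    rw [pow_succ, pow_succ]
    noncomm_ring

lemma diag_pow_nonneg {X : Matrix m m ℝ} (hX : X.IsSymm) (r : ℕ) (k : m) :
    0 ≤ (X ^ (2 * r)) k k := by
  have hs : (X ^ r).IsSymm := hX.pow r
  rw [two_mul, pow_add, Matrix.mul_apply]
  apply Finset.sum_nonneg
  intro j _
  rw [hs.apply j k]
  exact mul_self_nonneg _

lemma trace_pow_nonneg {X : Matrix m m ℝ} (hX : X.IsSymm) (r : ℕ) : 0 ≤ (X ^ (2 * r)).trace :=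
  Finset.sum_nonneg fun k _ => diag_pow_nonneg hX r k

/-- Every eigenvalue is bounded by the trace of an even power. -/
lemma eigenvalue_pow_le_trace {X : Matrix m m ℝ} (hX : X.IsSymm) (r : ℕ) {v : m → ℝ} {μ : ℝ}
    (hv : v ≠ 0) (h : X *ᵥ v = μ • v) : μ ^ (2 * r) ≤ (X ^ (2 * r)).trace := by
  obtain ⟨Q, d, hQ, hQ', rfl⟩ := exists_orthogonal_diagonalization hX
  rw [conj_diagonal_pow hQ hQ', Matrix.trace_mul_cycle, hQ, Matrix.one_mul, Matrix.trace_diagonal]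
  obtain ⟨u, hu⟩ : ∃ u, u = Qᵀ *ᵥ v := ⟨_, rfl⟩
  have hvu : v = Q *ᵥ u := by rw [hu, Matrix.mulVec_mulVec, hQ', Matrix.one_mulVec]
  have hu0 : u ≠ 0 := by
    rintro rfl
    exact hv (by rw [hvu, Matrix.mulVec_zero])
  obtain ⟨j, hj⟩ := Function.ne_iff.1 hu0
  have h1 : Matrix.diagonal d *ᵥ u = μ • u := by
    have := congrArg (fun w => Qᵀ *ᵥ w) h
    simp only [Matrix.mulVec_smul] at this
    rw [Matrix.mulVec_mulVec, ← Matrix.mul_assoc, ← Matrix.mul_assoc, hQ, Matrix.one_mul,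
      ← Matrix.mulVec_mulVec, ← hu] at this
    exact this
  have h2 := congrFun h1 j
  rw [Matrix.mulVec_diagonal, Pi.smul_apply, smul_eq_mul] at h2
  have h3 : d j = μ := mul_right_cancel₀ hj h2
  rw [← h3]
  exact Finset.single_le_sum (f := fun i => (d ^ (2 * r)) i)
    (fun i _ => (even_two_mul r).pow_nonneg (d i)) (Finset.mem_univ j)

/-- A crude deterministic bound, used only on the event of large degrees, whose probability is small
enough to compensate for it. -/
lemma abs_pow_apply_le {X : Matrix m m ℝ} (hX : ∀ i j, |X i j| ≤ 1) (k : ℕ) (i j : m) :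
    |(X ^ k) i j| ≤ (Fintype.card m : ℝ) ^ k := by
  induction k generalizing j with
  | zero =>
    rw [pow_zero, pow_zero, Matrix.one_apply]
    split_ifs <;> simp
  | succ k ih =>
    rw [pow_succ, Matrix.mul_apply, pow_succ, mul_comm]
    refine (Finset.abs_sum_le_sum_abs _ _).trans ?_
    calc ∑ l, |(X ^ k) i l * X l j| ≤ ∑ _l : m, (Fintype.card m : ℝ) ^ k := by
          apply Finset.sum_le_sum
          intro l _
          rw [abs_mul]
          calc _ ≤ (Fintype.card m : ℝ) ^ k * 1 := by
                gcongr
                · exact ih l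
                · exact hX l j
            _ = _ := mul_one _
      _ = _ := by simp

lemma trace_pow_le {X : Matrix m m ℝ} (hX : ∀ i j, |X i j| ≤ 1) (k : ℕ) :
    (X ^ k).trace ≤ (Fintype.card m : ℝ) ^ (k + 1) := by
  calc (X ^ k).trace ≤ ∑ _i : m, (Fintype.card m : ℝ) ^ k :=
        Finset.sum_le_sum fun i _ => (le_abs_self _).trans (abs_pow_apply_le hX k i i)
    _ = _ := by simp [pow_succ, mul_comm]

end Trace

/-! ### The matrix of centred Bernoulli variables -/

section RandomMatrix

open scoped Matrix

variable {ι m : Type*} [Fintype ι] [DecidableEq ι] [Fintype m] [DecidableEq m]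

/-- A sum of fixed matrices with centred Bernoulli coefficients. -/
def bernMatrix (p : ι → ℝ) (H : ι → Matrix m m ℝ) (s : ι → Bool) : Matrix m m ℝ :=
  ∑ e, (bit (s e) - p e) • H e

omit [DecidableEq ι] [DecidableEq m] [Fintype m] in
lemma bernMatrix_isSymm (p : ι → ℝ) {H : ι → Matrix m m ℝ} (hH : ∀ e, (H e).IsSymm)
    (s : ι → Bool) : (bernMatrix p H s).IsSymm := by
  rw [Matrix.IsSymm, bernMatrix, Matrix.transpose_sum]
  exact Finset.sum_congr rfl fun e _ => by rw [Matrix.transpose_smul, (hH e).eq]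

omit [DecidableEq m] [Fintype m] in
lemma bernMatrix_update (p : ι → ℝ) (H : ι → Matrix m m ℝ) (s : ι → Bool) (e : ι) :
    bernMatrix p H (Function.update s e true) =
      bernMatrix p H (Function.update s e false) + H e := by
  have h : ∀ b, bernMatrix p H (Function.update s e b) =
      (bit b - p e) • H e + ∑ i ∈ Finset.univ.erase e, (bit (s i) - p i) • H i := by
    intro b
    rw [bernMatrix, ← Finset.add_sum_erase _ _ (Finset.mem_univ e), Function.update_self]
    congr 1
    apply Finset.sum_congr rfl
    intro i hi
    rw [Function.update_of_ne (Finset.ne_of_mem_erase hi)]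
  rw [h, h]
  simp only [bit, if_true, Bool.false_eq_true, if_false, sub_smul, one_smul, zero_smul]
  abel

/-- Integration by parts for trace moments. -/
lemma bernE_trace_pow_le {p : ι → ℝ} (hp : ∀ i, p i ∈ Set.Icc (0 : ℝ) 1) {H : ι → Matrix m m ℝ}
    (hH : ∀ e, (H e).IsSymm) (r : ℕ) :
    2 * bernE p (fun s => (bernMatrix p H s ^ (2 * (r + 1))).trace) ≤
      (2 * r + 1) * bernE p (fun s => ∑ e, ((1 - p e) * bit (s e) + p e * (1 - bit (s e))) *
        (H e * H e * bernMatrix p H s ^ (2 * r)).trace) := by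
  have h1 : ∀ s, (bernMatrix p H s ^ (2 * (r + 1))).trace =
      ∑ e, (bit (s e) - p e) * (H e * bernMatrix p H s ^ (2 * r + 1)).trace := by
    intro s
    rw [show 2 * (r + 1) = (2 * r + 1) + 1 by ring, pow_succ']
    nth_rewrite 1 [bernMatrix]
    rw [Finset.sum_mul, Matrix.trace_sum]
    exact Finset.sum_congr rfl fun e _ => by rw [Matrix.smul_mul, Matrix.trace_smul, smul_eq_mul]
  rw [funext h1, bernE_sum, bernE_sum, Finset.mul_sum, Finset.mul_sum]
  apply Finset.sum_le_sum
  intro e _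
  -- Given the other coordinates, E (bit - p) f(bit) = p (1 - p) (f(1) - f(0)). The weight on the
  -- right is chosen so that its conditional expectation is p (1 - p) (g(1) + g(0)).
  rw [bernE_condition p e, bernE_condition p e fun s =>
    ((1 - p e) * bit (s e) + p e * (1 - bit (s e))) *
        (H e * H e * bernMatrix p H s ^ (2 * r)).trace, ← bernE_const_mul, ← bernE_const_mul]
  apply bernE_mono hp
  intro s
  simp only [Function.update_self, bit, if_true, Bool.false_eq_true, if_false]
  rw [bernMatrix_update]
  obtain ⟨X, hX⟩ : ∃ X, X = bernMatrix p H (Function.update s e false) := ⟨_, rfl⟩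
  have hXs : X.IsSymm := by rw [hX]; exact bernMatrix_isSymm p hH _
  rw [← hX]
  have hsum := two_mul_sum_trace_le (hH e) (hXs.add (hH e)) hXs r
  have hdiff : (H e * (X + H e) ^ (2 * r + 1)).trace - (H e * X ^ (2 * r + 1)).trace =
      ∑ q ∈ Finset.range (2 * r + 1), (H e * (X + H e) ^ q * H e * X ^ (2 * r - q)).trace := by
    rw [← Matrix.trace_sub, ← Matrix.mul_sub, add_pow_sub_pow, Finset.mul_sum, Matrix.trace_sum]
    apply Finset.sum_congr rfl
    intro q _
    simp only [Matrix.mul_assoc, Nat.add_sub_cancel]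
  rw [← hdiff] at hsum
  have hpp : 0 ≤ p e * (1 - p e) := mul_nonneg (hp e).1 (sub_nonneg.2 (hp e).2)
  have := mul_le_mul_of_nonneg_left hsum hpp
  linarith

/-- Trace moments of a sum of fixed matrices with centred Bernoulli coefficients, when the
variance proxy is at most `Δ` with high probability. -/
lemma bernE_trace_pow_le_pow {p : ι → ℝ} (hp : ∀ i, p i ∈ Set.Icc (0 : ℝ) 1)
    {H : ι → Matrix m m ℝ} (hH : ∀ e, (H e).IsSymm) {h : ι → m → ℝ}
    (hHH : ∀ e, H e * H e = Matrix.diagonal (h e)) (hh : ∀ e k, 0 ≤ h e k) {Δ L R η : ℝ}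
    (hΔ : 1 ≤ Δ) (hL : ∀ (s : ι → Bool) (k : m), ∑ e, (bit (s e) + p e) * h e k ≤ L) (hL0 : 0 ≤ L) {N : ℕ}
    (hR : ∀ s, ∀ r < N, (bernMatrix p H s ^ (2 * r)).trace ≤ R) (hη : L * R * η ≤ 1)
    (P : (ι → Bool) → Prop) [DecidablePred P]
    (hP : ∀ s : ι → Bool, ¬ P s → ∀ k : m, ∑ e, (bit (s e) + p e) * h e k ≤ Δ)
    (hPη : bernE p (fun s => if P s then 1 else 0) ≤ η) (hR0 : 0 ≤ R) (r : ℕ) (hr : r ≤ N) :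
    bernE p (fun s => (bernMatrix p H s ^ (2 * r)).trace) + 1 ≤
      (2 * N * Δ) ^ r * (Fintype.card m + 1) := by
  induction r with
  | zero => simp [bernE_const]
  | succ r ih =>
    have ih := ih (by omega)
    have hrec := bernE_trace_pow_le hp hH r
    obtain ⟨M, hM⟩ : ∃ M, M = bernE p (fun s => (bernMatrix p H s ^ (2 * r)).trace) := ⟨_, rfl⟩
    have hM0 : 0 ≤ M := by
      rw [hM]; exact bernE_nonneg hp fun s => trace_pow_nonneg (bernMatrix_isSymm p hH s) r
    have hbit : ∀ b : Bool, 0 ≤ bit b ∧ bit b ≤ 1 := by intro b; cases b <;> simp [bit]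
    have hbound : bernE p (fun s => ∑ e, ((1 - p e) * bit (s e) + p e * (1 - bit (s e))) *
        (H e * H e * bernMatrix p H s ^ (2 * r)).trace) ≤ Δ * M + 1 := by
      -- The squares `H e * H e` are diagonal, so the traces see only the nonnegative diagonal of
      -- the even power. The variance proxy is at most Δ off the bad event `P`; on it the crude
      -- bounds L and R are paid for by `hη`.
      have hpt : ∀ s, ∑ e, ((1 - p e) * bit (s e) + p e * (1 - bit (s e))) *
          (H e * H e * bernMatrix p H s ^ (2 * r)).trace ≤
          Δ * (bernMatrix p H s ^ (2 * r)).trace + L * R * (if P s then 1 else 0) := by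
        intro s
        obtain ⟨Z, hZ⟩ : ∃ Z, Z = bernMatrix p H s ^ (2 * r) := ⟨_, rfl⟩
        have hZ0 : ∀ k, 0 ≤ Z k k := by
          rw [hZ]; exact diag_pow_nonneg (bernMatrix_isSymm p hH s) r
        have hZR : Z.trace ≤ R := by rw [hZ]; exact hR s r (by omega)
        rw [← hZ]
        have htr : ∀ e, (H e * H e * Z).trace = ∑ k, h e k * Z k k := by
          intro e
          rw [hHH e, Matrix.trace]
          exact Finset.sum_congr rfl fun k _ => by rw [Matrix.diag_apply, Matrix.diagonal_mul]
        have hsum : ∑ e, ((1 - p e) * bit (s e) + p e * (1 - bit (s e))) * (H e * H e * Z).trace ≤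
            ∑ k, (∑ e, (bit (s e) + p e) * h e k) * Z k k := by
          simp only [Finset.sum_mul]
          rw [Finset.sum_comm]
          apply Finset.sum_le_sum
          intro e _
          rw [htr e, Finset.mul_sum]
          apply Finset.sum_le_sum
          intro k _
          rw [mul_assoc]
          apply mul_le_mul_of_nonneg_right _ (mul_nonneg (hh e k) (hZ0 k))
          nlinarith [hbit (s e), hp e, mul_nonneg (hp e).1 (hbit (s e)).1]
        refine hsum.trans ?_
        by_cases hPs : P s
        · rw [if_pos hPs, mul_one]
          have h1 : ∑ k, (∑ e, (bit (s e) + p e) * h e k) * Z k k ≤ L * Z.trace := by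
            rw [Matrix.trace, Finset.mul_sum]
            exact Finset.sum_le_sum fun k _ => mul_le_mul_of_nonneg_right (hL s k) (hZ0 k)
          have h2 := mul_le_mul_of_nonneg_left hZR hL0
          have h3 : 0 ≤ Z.trace := Finset.sum_nonneg fun k _ => hZ0 k
          nlinarith
        · rw [if_neg hPs, mul_zero, add_zero, Matrix.trace, Finset.mul_sum]
          exact Finset.sum_le_sum fun k _ => mul_le_mul_of_nonneg_right (hP s hPs k) (hZ0 k)
      refine (bernE_mono hp hpt).trans ?_
      rw [bernE_add, bernE_const_mul, bernE_const_mul, ← hM]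
      have := mul_le_mul_of_nonneg_left hPη (mul_nonneg hL0 hR0)
      linarith
    rw [← hM] at ih
    obtain ⟨M', hM'⟩ : ∃ M', M' = bernE p (fun s => (bernMatrix p H s ^ (2 * (r + 1))).trace) :=
      ⟨_, rfl⟩
    rw [← hM'] at hrec ⊢
    have hrN : (r : ℝ) + 1 ≤ N := by exact_mod_cast hr
    have hr0 : (0 : ℝ) ≤ r := Nat.cast_nonneg r
    have h1 : M' ≤ N * (Δ * M + 1) := by
      have hX0 : 0 ≤ Δ * M + 1 := by positivity
      have := mul_le_mul_of_nonneg_left hbound (by positivity : (0 : ℝ) ≤ 2 * r + 1)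
      have h3 : (2 * r + 1) * (Δ * M + 1) ≤ 2 * N * (Δ * M + 1) :=
        mul_le_mul_of_nonneg_right (by linarith) hX0
      linarith
    -- Adding one to the moment makes the recursion purely multiplicative.
    have h2 : M' + 1 ≤ 2 * N * Δ * (M + 1) := by
      have hN1 : (1 : ℝ) ≤ N := by linarith
      have hNΔ : 1 ≤ N * Δ := by nlinarith
      have hNN : (N : ℝ) ≤ N * Δ := by nlinarith
      have : 0 ≤ N * Δ * M := by positivity
      linarith
    calc M' + 1 ≤ 2 * N * Δ * (M + 1) := h2
      _ ≤ 2 * N * Δ * ((2 * N * Δ) ^ r * (Fintype.card m + 1)) := by gcongr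
      _ = _ := by ring

end RandomMatrix

/-! ### Random graphs -/

section Graph

open scoped Matrix

variable {n : ℕ}

/-- The pairs of nodes below the diagonal. -/
abbrev Edge (n : ℕ) : Type := {q : Fin n × Fin n // q.2 < q.1}

/-- The symmetric matrix with the two nonzero entries of an edge. -/
def edgeMatrix (e : Edge n) : Matrix (Fin n) (Fin n) ℝ :=
  Matrix.single e.1.1 e.1.2 1 + Matrix.single e.1.2 e.1.1 1

/-- The indicator of the end points of an edge. -/
def edgeEnds (e : Edge n) (k : Fin n) : ℝ :=
  (if e.1.1 = k then 1 else 0) + if e.1.2 = k then 1 else 0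

lemma edgeMatrix_isSymm (e : Edge n) : (edgeMatrix e).IsSymm := by
  rw [Matrix.IsSymm, edgeMatrix, Matrix.transpose_add, Matrix.transpose_single,
    Matrix.transpose_single, add_comm]

/-- Makes the variance proxy of the trace moments diagonal, with entries the degrees plus the
expected degrees. -/
lemma edgeMatrix_mul_self (e : Edge n) :
    edgeMatrix e * edgeMatrix e = Matrix.diagonal (edgeEnds e) := by
  have hne : e.1.1 ≠ e.1.2 := e.2.ne'
  rw [edgeMatrix, Matrix.add_mul, Matrix.mul_add, Matrix.mul_add,
    Matrix.single_mul_single_of_ne _ _ _ _ hne.symm, Matrix.single_mul_single_of_ne _ _ _ _ hne,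
    Matrix.single_mul_single_same, Matrix.single_mul_single_same]
  ext a b
  simp only [zero_add, add_zero, Matrix.add_apply, Matrix.single_apply, Matrix.diagonal_apply,
    edgeEnds, mul_one]
  by_cases hab : a = b
  · subst hab; simp
  · rw [if_neg hab, if_neg (fun h => hab (h.1.symm.trans h.2)),
      if_neg (fun h => hab (h.1.symm.trans h.2)), add_zero]

lemma edgeEnds_nonneg (e : Edge n) (k : Fin n) : 0 ≤ edgeEnds e k := by
  unfold edgeEnds; split_ifs <;> norm_num

lemma edgeEnds_sq (e : Edge n) (k : Fin n) : edgeEnds e k ^ 2 = edgeEnds e k := by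
  have hne : e.1.1 ≠ e.1.2 := e.2.ne'
  unfold edgeEnds
  split_ifs with h1 h2
  · exact absurd (h1.trans h2.symm) hne
  all_goals norm_num

lemma edgeEnds_le_one (e : Edge n) (k : Fin n) : edgeEnds e k ≤ 1 := by
  nlinarith [edgeEnds_sq e k, sq_nonneg (edgeEnds e k - 1)]

lemma sum_edge_le {f : Fin n × Fin n → ℝ} (hf : ∀ q, 0 ≤ f q) :
    ∑ e : Edge n, f e.1 ≤ ∑ q, f q := by
  rw [← Finset.sum_subtype (Finset.univ.filter fun q : Fin n × Fin n => q.2 < q.1)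
    (fun q => by simp) f]
  exact Finset.sum_le_sum_of_subset_of_nonneg (Finset.subset_univ _) fun q _ _ => hf q

lemma sum_edgeEnds_le (k : Fin n) : ∑ e : Edge n, edgeEnds e k ≤ 2 * n := by
  have := sum_edge_le (n := n) (f := fun q => (if q.1 = k then (1 : ℝ) else 0) +
    if q.2 = k then 1 else 0) (fun q => by split_ifs <;> norm_num)
  refine this.trans_eq ?_
  have h1 : ∑ x : Fin n, ∑ _y : Fin n, (if x = k then (1 : ℝ) else 0) = n := by
    rw [Finset.sum_comm]; simp
  have h2 : ∑ _x : Fin n, ∑ y : Fin n, (if y = k then (1 : ℝ) else 0) = n := by simp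
  rw [Finset.sum_add_distrib, Fintype.sum_prod_type, Fintype.sum_prod_type, h1, h2, two_mul]

lemma card_edge_le (n : ℕ) : (Fintype.card (Edge n) : ℝ) ≤ (n : ℝ) ^ 2 := by
  have := sum_edge_le (n := n) (f := fun _ => 1) (fun _ => zero_le_one)
  simpa [pow_two] using this

lemma dotProduct_edgeMatrix (e : Edge n) (y z : Fin n → ℝ) :
    y ⬝ᵥ (edgeMatrix e *ᵥ z) = y e.1.1 * z e.1.2 + y e.1.2 * z e.1.1 := by
  rw [edgeMatrix, Matrix.add_mulVec, dotProduct_add, Matrix.single_mulVec, Matrix.single_mulVec]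
  simp [Function.update_apply, dotProduct]

lemma dotProduct_bernMatrix (p : Edge n → ℝ) (s : Edge n → Bool) (y z : Fin n → ℝ) :
    y ⬝ᵥ (bernMatrix p edgeMatrix s *ᵥ z) =
      ∑ e, (y e.1.1 * z e.1.2 + y e.1.2 * z e.1.1) * (bit (s e) - p e) := by
  rw [bernMatrix, Matrix.sum_mulVec, dotProduct_sum]
  apply Finset.sum_congr rfl
  intro e _
  rw [Matrix.smul_mulVec, dotProduct_smul, dotProduct_edgeMatrix, smul_eq_mul, mul_comm]

lemma bernMatrix_edge_apply (p : Edge n → ℝ) (s : Edge n → Bool) {i j : Fin n} (h : j < i) :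
    bernMatrix p edgeMatrix s i j = bit (s ⟨(i, j), h⟩) - p ⟨(i, j), h⟩ := by
  rw [bernMatrix, Matrix.sum_apply, Finset.sum_eq_single ⟨(i, j), h⟩]
  · simp [edgeMatrix, h.ne, h.ne']
  · intro e _ hne
    rw [Matrix.smul_apply, edgeMatrix, Matrix.add_apply, Matrix.single_apply, Matrix.single_apply,
      if_neg, if_neg]
    · simp
    · rintro ⟨h1, h2⟩
      have := e.2
      rw [h1, h2] at this
      exact absurd this h.asymm
    · rintro ⟨h1, h2⟩
      exact hne (Subtype.ext (Prod.ext h1 h2))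
  · simp

lemma bernMatrix_edge_diag (p : Edge n → ℝ) (s : Edge n → Bool) (i : Fin n) :
    bernMatrix p edgeMatrix s i i = 0 := by
  rw [bernMatrix, Matrix.sum_apply]
  apply Finset.sum_eq_zero
  intro e _
  have hne : e.1.1 ≠ e.1.2 := e.2.ne'
  rw [Matrix.smul_apply, edgeMatrix, Matrix.add_apply, Matrix.single_apply, Matrix.single_apply,
    if_neg (fun h => hne (h.1.trans h.2.symm)), if_neg (fun h => hne (h.2.trans h.1.symm))]
  simp

lemma abs_bernMatrix_edge_le {p : Edge n → ℝ} (hp : ∀ e, p e ∈ Set.Icc (0 : ℝ) 1)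
    (s : Edge n → Bool) (i j : Fin n) : |bernMatrix p edgeMatrix s i j| ≤ 1 := by
  have key : ∀ {i j : Fin n}, j < i → |bernMatrix p edgeMatrix s i j| ≤ 1 := by
    intro i j h
    rw [bernMatrix_edge_apply p s h, abs_le]
    have := hp ⟨(i, j), h⟩
    cases s ⟨(i, j), h⟩ <;> simp only [bit, if_true, Bool.false_eq_true, if_false] <;>
      constructor <;> linarith [this.1, this.2]
  rcases lt_trichotomy j i with h | h | h
  · exact key h
  · rw [h, bernMatrix_edge_diag]; simp
  · rw [← (bernMatrix_isSymm p edgeMatrix_isSymm s).apply i j]; exact key h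

/-- The bilinear forms of the noise matrix at indicator vectors are uniformly small with high
probability. -/
lemma bernE_cut_le {p : Edge n → ℝ} (hp : ∀ e, p e ∈ Set.Icc (0 : ℝ) 1) {c lam K : ℝ}
    (hlam : 1 ≤ lam) (hc : 0 ≤ c) (hn : 0 < n) (hpc : ∀ e, p e ≤ c * lam / n)
    (P : (Edge n → Bool) → Prop) [DecidablePred P]
    (hP : ∀ s, P s → ∃ u v : Fin n → Bool, K * n * √lam ≤
      |(fun i => bit (u i)) ⬝ᵥ (bernMatrix p edgeMatrix s *ᵥ fun i => bit (v i))|) :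
    bernE p (fun s => if P s then 1 else 0) ≤ 2 * Real.exp (n * (c + 2 - K / 2)) := by
  classical
  have hn0 : (0 : ℝ) < n := by exact_mod_cast hn
  have hl0 : 0 < lam := by linarith
  have hsq1 : 1 ≤ √lam := by rw [Real.one_le_sqrt]; exact hlam
  have hss : √lam * √lam = lam := Real.mul_self_sqrt hl0.le
  have hbit : ∀ b : Bool, 0 ≤ bit b ∧ bit b ≤ 1 := by intro b; cases b <;> simp [bit]
  obtain ⟨b, hb⟩ : ∃ b : (Fin n → Bool) × (Fin n → Bool) → Edge n → ℝ, b = fun q e =>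
    bit (q.1 e.1.1) * bit (q.2 e.1.2) + bit (q.1 e.1.2) * bit (q.2 e.1.1) := ⟨_, rfl⟩
  have hb2 : ∀ q e, 0 ≤ b q e ∧ b q e ≤ 2 := by
    intro q e
    rw [hb]
    have h1 := hbit (q.1 e.1.1)
    have h2 := hbit (q.2 e.1.2)
    have h3 := hbit (q.1 e.1.2)
    have h4 := hbit (q.2 e.1.1)
    constructor
    · exact add_nonneg (mul_nonneg h1.1 h2.1) (mul_nonneg h3.1 h4.1)
    · have := mul_le_mul h1.2 h2.2 h2.1 zero_le_one
      have := mul_le_mul h3.2 h4.2 h4.1 zero_le_one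
      linarith
  obtain ⟨t, ht⟩ : ∃ t, t = K * n / 2 := ⟨_, rfl⟩
  -- With |u| = 1/(2√lam) and b ≤ 2 the Chernoff bound applies, the variance term is at most n c,
  -- and the threshold K n √lam becomes K n / 2. Both signs of u are needed for the two tails.
  have chern : ∀ q (u : ℝ), |u| = 1 / (2 * √lam) →
      bernE p (fun s => if t ≤ u * ∑ e, b q e * (bit (s e) - p e) then 1 else 0) ≤
        Real.exp (n * c - K * n / 2) := by
    intro q u hu
    refine (bernE_chernoff hp (b q) u t ?_ _ fun s hs => hs).trans ?_
    · intro e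
      rw [abs_mul, hu, abs_of_nonneg (hb2 q e).1, div_mul_eq_mul_div, one_mul,
        div_le_one (by positivity)]
      linarith [(hb2 q e).2]
    · apply Real.exp_le_exp.2
      rw [ht]
      have hu2 : u ^ 2 = 1 / (4 * lam) := by
        rw [← sq_abs, hu, div_pow, mul_pow, pow_two √lam, hss]; norm_num
      have hsum : ∑ e, p e * b q e ^ 2 ≤ (n : ℝ) ^ 2 * (c * lam / n * 4) := by
        have h0 : 0 ≤ c * lam / n := by positivity
        calc ∑ e, p e * b q e ^ 2 ≤ ∑ _e : Edge n, c * lam / n * 4 := by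
              apply Finset.sum_le_sum
              intro e _
              have := hb2 q e
              apply mul_le_mul (hpc e) _ (sq_nonneg _) h0
              nlinarith
          _ = Fintype.card (Edge n) * (c * lam / n * 4) := by simp
          _ ≤ _ := by
              apply mul_le_mul_of_nonneg_right (card_edge_le n)
              linarith
      rw [hu2]
      have : 1 / (4 * lam) * ((n : ℝ) ^ 2 * (c * lam / n * 4)) = n * c := by
        field_simp
      have h4 : 0 ≤ 1 / (4 * lam) := by positivity
      have := mul_le_mul_of_nonneg_left hsum h4
      linarith
  obtain ⟨a, ha⟩ : ∃ a, a = 1 / (2 * √lam) := ⟨_, rfl⟩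
  have ha0 : 0 < a := by rw [ha]; positivity
  have hpt : ∀ s, (if P s then (1 : ℝ) else 0) ≤
      ∑ q : (Fin n → Bool) × (Fin n → Bool),
        ((if t ≤ a * ∑ e, b q e * (bit (s e) - p e) then 1 else 0) +
          if t ≤ -a * ∑ e, b q e * (bit (s e) - p e) then 1 else 0) := by
    intro s
    have hnn : ∀ q : (Fin n → Bool) × (Fin n → Bool), (0 : ℝ) ≤
        ((if t ≤ a * ∑ e, b q e * (bit (s e) - p e) then 1 else 0) +
          if t ≤ -a * ∑ e, b q e * (bit (s e) - p e) then 1 else 0) := by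
      intro q; split_ifs <;> norm_num
    split_ifs with hs
    · obtain ⟨u, v, huv⟩ := hP s hs
      refine le_trans ?_ (Finset.single_le_sum (fun q _ => hnn q) (Finset.mem_univ (u, v)))
      rw [dotProduct_bernMatrix] at huv
      have hbs : ∑ e, (bit (u e.1.1) * bit (v e.1.2) + bit (u e.1.2) * bit (v e.1.1)) *
          (bit (s e) - p e) = ∑ e, b (u, v) e * (bit (s e) - p e) := by rw [hb]
      rw [hbs] at huv
      have hta : t = a * (K * n * √lam) := by
        rw [ht, ha]; field_simp
      rcases le_abs.1 huv with h | h
      · rw [if_pos (by rw [hta]; exact mul_le_mul_of_nonneg_left h ha0.le)]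
        split_ifs <;> norm_num
      · rw [add_comm, if_pos (by
          rw [hta, neg_mul, ← mul_neg]; exact mul_le_mul_of_nonneg_left h ha0.le)]
        split_ifs <;> norm_num
    · exact Finset.sum_nonneg fun q _ => hnn q
  refine (bernE_mono hp hpt).trans ?_
  rw [bernE_sum]
  have habs : |a| = 1 / (2 * √lam) := by rw [abs_of_pos ha0, ha]
  calc _ ≤ ∑ _q : (Fin n → Bool) × (Fin n → Bool), 2 * Real.exp (n * c - K * n / 2) := by
        apply Finset.sum_le_sum
        intro q _
        rw [bernE_add, two_mul]
        exact add_le_add (chern q a habs) (chern q (-a) (by rw [abs_neg, habs]))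
    _ = 2 * ((2 : ℝ) ^ n * 2 ^ n * Real.exp (n * c - K * n / 2)) := by
        simp [Fintype.card_prod]; ring
    _ ≤ 2 * (Real.exp (2 * n) * Real.exp (n * c - K * n / 2)) := by
        have h2 : (2 : ℝ) ^ n ≤ Real.exp n := by
          have := Real.exp_one_gt_d9
          rw [← mul_one (n : ℝ), Real.exp_nat_mul]
          exact pow_le_pow_left₀ (by norm_num) (by linarith) n
        have : (2 : ℝ) ^ n * 2 ^ n ≤ Real.exp (2 * n) := by
          rw [two_mul, Real.exp_add]
          exact mul_le_mul h2 h2 (by positivity) (Real.exp_pos _).le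
        gcongr
    _ = _ := by rw [← Real.exp_add]; ring_nf

/-- The degrees are uniformly `O(lam)` with high probability. -/
lemma bernE_degree_le {p : Edge n → ℝ} (hp : ∀ e, p e ∈ Set.Icc (0 : ℝ) 1) {c lam : ℝ}
    (hlam : 0 ≤ lam) (hc : 0 ≤ c) (hn : 0 < n) (hpc : ∀ e, p e ≤ c * lam / n)
    (P : (Edge n → Bool) → Prop) [DecidablePred P]
    (hP : ∀ s, P s → ∃ k, (6 * c + 11) * lam ≤ ∑ e, (bit (s e) + p e) * edgeEnds e k) :
    bernE p (fun s => if P s then 1 else 0) ≤ n * Real.exp (-(11 * lam)) := by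
  classical
  have hn0 : (0 : ℝ) < n := by exact_mod_cast hn
  have hmean : ∀ k, ∑ e, p e * edgeEnds e k ≤ 2 * c * lam := by
    intro k
    calc ∑ e, p e * edgeEnds e k ≤ ∑ e : Edge n, c * lam / n * edgeEnds e k :=
          Finset.sum_le_sum fun e _ => mul_le_mul_of_nonneg_right (hpc e) (edgeEnds_nonneg e k)
      _ = c * lam / n * ∑ e : Edge n, edgeEnds e k := by rw [Finset.mul_sum]
      _ ≤ c * lam / n * (2 * n) := by
          apply mul_le_mul_of_nonneg_left (sum_edgeEnds_le k); positivity
      _ = _ := by field_simp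
  -- Expected degrees are at most 2 c lam and are counted twice in the proxy, which leaves 6 c + 11
  -- - 4 c for the fluctuation. The variance takes 2 c lam more from the exponent.
  obtain ⟨t, ht⟩ : ∃ t, t = (2 * c + 11) * lam := ⟨_, rfl⟩
  have chern : ∀ k, bernE p (fun s => if t ≤ 1 * ∑ e, edgeEnds e k * (bit (s e) - p e)
      then 1 else 0) ≤ Real.exp (-(11 * lam)) := by
    intro k
    refine (bernE_chernoff hp (fun e => edgeEnds e k) 1 t ?_ _ fun s hs => hs).trans ?_
    · intro e
      rw [one_mul, abs_of_nonneg (edgeEnds_nonneg e k)]; exact edgeEnds_le_one e k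
    · apply Real.exp_le_exp.2
      simp only [edgeEnds_sq]
      have := hmean k
      rw [ht]; linarith
  have hpt : ∀ s, (if P s then (1 : ℝ) else 0) ≤
      ∑ k : Fin n, if t ≤ 1 * ∑ e, edgeEnds e k * (bit (s e) - p e) then 1 else 0 := by
    intro s
    have hnn : ∀ k : Fin n, (0 : ℝ) ≤
        if t ≤ 1 * ∑ e, edgeEnds e k * (bit (s e) - p e) then 1 else 0 := by
      intro k; split_ifs <;> norm_num
    split_ifs with hs
    · obtain ⟨k, hk⟩ := hP s hs
      refine le_trans ?_ (Finset.single_le_sum (fun q _ => hnn q) (Finset.mem_univ k))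
      rw [if_pos]
      have : ∑ e, (bit (s e) + p e) * edgeEnds e k =
          ∑ e, edgeEnds e k * (bit (s e) - p e) + 2 * ∑ e, p e * edgeEnds e k := by
        rw [Finset.mul_sum, ← Finset.sum_add_distrib]
        exact Finset.sum_congr rfl fun e _ => by ring
      have := hmean k
      rw [ht]; linarith
    · exact Finset.sum_nonneg fun q _ => hnn q
  refine (bernE_mono hp hpt).trans ?_
  rw [bernE_sum]
  calc _ ≤ ∑ _k : Fin n, Real.exp (-(11 * lam)) := Finset.sum_le_sum fun k _ => chern k
    _ = _ := by simp

/-- A high trace moment of the noise matrix is small with high probability. -/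
lemma bernE_trace_gt_le {p : Edge n → ℝ} (hp : ∀ e, p e ∈ Set.Icc (0 : ℝ) 1) {c lam δ : ℝ}
    (hlam : 1 ≤ lam) (hlog : Real.log n ^ 2 ≤ lam) (hc : 0 ≤ c) (hn : 2 ≤ n)
    (hpc : ∀ e, p e ≤ c * lam / n) (hδ : 0 < δ) (hδ1 : δ ≤ 1)
    (P : (Edge n → Bool) → Prop) [DecidablePred P]
    (hP : ∀ s, P s → (2 * ⌈Real.log n⌉₊ * ((6 * c + 11) * lam) * (2 / δ * Real.exp 1)) ^
      ⌈Real.log n⌉₊ ≤ (bernMatrix p edgeMatrix s ^ (2 * ⌈Real.log n⌉₊)).trace) :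
    bernE p (fun s => if P s then 1 else 0) ≤ δ := by
  classical
  obtain ⟨N, hN⟩ : ∃ N, N = ⌈Real.log n⌉₊ := ⟨_, rfl⟩
  rw [← hN] at hP
  have hn1 : (2 : ℝ) ≤ n := by exact_mod_cast hn
  have hn0 : (0 : ℝ) < n := by linarith
  have hl2 : (0.69 : ℝ) ≤ Real.log 2 := by have := Real.log_two_gt_d9; linarith
  have hℓ2 : Real.log 2 ≤ Real.log n := Real.log_le_log (by norm_num) hn1
  have hℓ : (0.69 : ℝ) ≤ Real.log n := hl2.trans hℓ2
  have hNl : Real.log n ≤ N := by rw [hN]; exact Nat.le_ceil _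
  have hNu : (N : ℝ) ≤ Real.log n + 1 := by
    rw [hN]; exact (Nat.ceil_lt_add_one (by linarith)).le
  have hN0 : 0 < N := by
    have : (0 : ℝ) < N := by linarith
    exact_mod_cast this
  obtain ⟨Δ, hΔ⟩ : ∃ Δ, Δ = (6 * c + 11) * lam := ⟨_, rfl⟩
  rw [← hΔ] at hP
  have hΔ1 : 1 ≤ Δ := by rw [hΔ]; nlinarith
  have hbit : ∀ b : Bool, 0 ≤ bit b ∧ bit b ≤ 1 := by intro b; cases b <;> simp [bit]
  have hdeg := bernE_degree_le hp (by linarith) hc (by omega) hpc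
    (fun s => ∃ k, (6 * c + 11) * lam ≤ ∑ e, (bit (s e) + p e) * edgeEnds e k) (fun s hs => hs)
  have hX := abs_bernMatrix_edge_le hp
  have hmom := bernE_trace_pow_le_pow hp edgeMatrix_isSymm edgeMatrix_mul_self edgeEnds_nonneg
    (Δ := Δ) (L := 4 * n) (R := (n : ℝ) ^ (2 * N)) (η := n * Real.exp (-(11 * lam))) hΔ1
    (by
      intro s k
      calc ∑ e, (bit (s e) + p e) * edgeEnds e k ≤ ∑ e : Edge n, 2 * edgeEnds e k := by
            apply Finset.sum_le_sum
            intro e _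
            apply mul_le_mul_of_nonneg_right _ (edgeEnds_nonneg e k)
            linarith [(hbit (s e)).2, (hp e).2]
        _ = 2 * ∑ e : Edge n, edgeEnds e k := by rw [Finset.mul_sum]
        _ ≤ _ := by linarith [sum_edgeEnds_le k])
    (by positivity) (N := N)
    (by
      intro s r hr
      refine (trace_pow_le (hX s) (2 * r)).trans ?_
      rw [Fintype.card_fin]
      exact pow_le_pow_right₀ (by linarith) (by omega))
    (by
      -- For ℓ = log n the exponent is at most 2ℓ² + 6ℓ - 11 lam, negative because ℓ ≥ 0.69 and ℓ² ≤
      -- lam; this explains the 11.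
      have e1 : 4 * (n : ℝ) * n ^ (2 * N) * (n * Real.exp (-(11 * lam))) =
          Real.exp (2 * Real.log 2 + (2 * N + 2) * Real.log n - 11 * lam) := by
        rw [sub_eq_add_neg, Real.exp_add, Real.exp_add]
        have : (2 * (N : ℝ) + 2) * Real.log n = ((2 * N + 2 : ℕ) : ℝ) * Real.log n := by
          push_cast; ring
        rw [this, Real.exp_nat_mul, Real.exp_log hn0, two_mul (Real.log 2), Real.exp_add,
          Real.exp_log (by norm_num)]
        ring
      rw [e1, ← Real.exp_zero]
      apply Real.exp_le_exp.2
      nlinarith)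
    (fun s => ∃ k, (6 * c + 11) * lam ≤ ∑ e, (bit (s e) + p e) * edgeEnds e k)
    (by
      intro s hs k
      by_contra hcon
      exact hs ⟨k, by rw [← hΔ]; exact (not_le.1 hcon).le⟩)
    hdeg (by positivity) N le_rfl
  have hbase : 0 < 2 * N * Δ := by
    have : (0 : ℝ) < N := by exact_mod_cast hN0
    positivity
  have hfac : 0 < 2 / δ * Real.exp 1 := by positivity
  refine (bernE_indicator_le hp
    (fun s => trace_pow_nonneg (bernMatrix_isSymm p edgeMatrix_isSymm s) N)
    (pow_pos (mul_pos hbase hfac) N) P hP).trans ?_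
  rw [div_le_iff₀ (pow_pos (mul_pos hbase hfac) N)]
  rw [Fintype.card_fin] at hmom
  -- A moment order of at least log n absorbs the dimension, since n ≤ exp N, at the cost of a
  -- constant factor in the base.
  have h1 : (n : ℝ) + 1 ≤ δ * (2 / δ * Real.exp 1) ^ N := by
    have hexp : (n : ℝ) ≤ Real.exp 1 ^ N := by
      rw [← Real.exp_nat_mul, mul_one]
      calc (n : ℝ) = Real.exp (Real.log n) := (Real.exp_log hn0).symm
        _ ≤ _ := Real.exp_le_exp.2 hNl
    have h2δ : 2 / δ ≤ (2 / δ) ^ N := by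
      apply le_self_pow₀ _ hN0.ne'
      rw [le_div_iff₀ hδ]; linarith
    calc (n : ℝ) + 1 ≤ 2 * n := by linarith
      _ = δ * (2 / δ * n) := by field_simp
      _ ≤ δ * ((2 / δ) ^ N * Real.exp 1 ^ N) := by gcongr
      _ = _ := by rw [mul_pow]
  calc _ ≤ (2 * N * Δ) ^ N * ((n : ℝ) + 1) := by linarith
    _ ≤ (2 * N * Δ) ^ N * (δ * (2 / δ * Real.exp 1) ^ N) := by gcongr
    _ = _ := by rw [mul_pow (2 * N * Δ)]; ring

/-- The noise matrix has small bilinear forms at indicator vectors and a small trace moment. -/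
def IsGoodNoise (K C lam : ℝ) (X : Matrix (Fin n) (Fin n) ℝ) : Prop :=
  (∀ u v : Fin n → Bool,
    |(fun i => bit (u i)) ⬝ᵥ (X *ᵥ fun i => bit (v i))| ≤ K * n * √lam) ∧
  (X ^ (2 * ⌈Real.log n⌉₊)).trace ≤
    (2 * ⌈Real.log n⌉₊ * (C * lam)) ^ ⌈Real.log n⌉₊

/-- The noise matrix is good with high probability. -/
lemma exists_bernE_not_isGoodNoise_le {c δ : ℝ} (hc : 0 ≤ c) (hδ : 0 < δ) (hδ1 : δ ≤ 1) :
    ∃ K C : ℝ, 1 ≤ K ∧ 0 < C ∧ ∀ (n : ℕ) (lam : ℝ) (p : Edge n → ℝ), 2 ≤ n → 1 ≤ lam →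
      Real.log n ^ 2 ≤ lam → (∀ e, p e ∈ Set.Icc (0 : ℝ) 1) → (∀ e, p e ≤ c * lam / n) →
      ∀ (P : (Edge n → Bool) → Prop) [DecidablePred P],
        (∀ s, P s → ¬ IsGoodNoise K C lam (bernMatrix p edgeMatrix s)) →
        bernE p (fun s => if P s then 1 else 0) ≤ δ := by
  classical
  have hlogδ : 0 ≤ Real.log (4 / δ) := by
    apply Real.log_nonneg
    rw [le_div_iff₀ hδ]; linarith
  -- K makes the exponent of the union bound equal to -n log (4 / δ). Each of the two failure
  -- probabilities gets δ / 2.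
  refine ⟨2 * (c + 2 + Real.log (4 / δ)), (6 * c + 11) * (2 / (δ / 2) * Real.exp 1), by linarith,
    by positivity, ?_⟩
  intro n lam p hn hlam hlog hp hpc P _ hP
  have hn1 : (1 : ℝ) ≤ n := by
    have : 1 ≤ n := by omega
    exact_mod_cast this
  obtain ⟨Q₁, hQ₁⟩ : ∃ Q₁ : (Edge n → Bool) → Prop, Q₁ = fun s => ∃ u v : Fin n → Bool,
    2 * (c + 2 + Real.log (4 / δ)) * n * √lam ≤
      |(fun i => bit (u i)) ⬝ᵥ (bernMatrix p edgeMatrix s *ᵥ fun i => bit (v i))| := ⟨_, rfl⟩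
  obtain ⟨Q₂, hQ₂⟩ : ∃ Q₂ : (Edge n → Bool) → Prop, Q₂ = fun s =>
    (2 * ⌈Real.log n⌉₊ * ((6 * c + 11) * lam) * (2 / (δ / 2) * Real.exp 1)) ^
      ⌈Real.log n⌉₊ ≤ (bernMatrix p edgeMatrix s ^ (2 * ⌈Real.log n⌉₊)).trace := ⟨_, rfl⟩
  have h1 := bernE_cut_le hp (K := 2 * (c + 2 + Real.log (4 / δ))) hlam hc (by omega) hpc Q₁
    (fun s hs => by rwa [hQ₁] at hs)
  have h2 := bernE_trace_gt_le hp hlam hlog hc hn hpc (half_pos hδ) (by linarith) Q₂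
    (fun s hs => by rwa [hQ₂] at hs)
  have h3 : 2 * Real.exp (n * (c + 2 - 2 * (c + 2 + Real.log (4 / δ)) / 2)) ≤ δ / 2 := by
    have : Real.exp (n * (c + 2 - 2 * (c + 2 + Real.log (4 / δ)) / 2)) ≤
        Real.exp (-Real.log (4 / δ)) := by
      apply Real.exp_le_exp.2
      nlinarith
    rw [Real.exp_neg, Real.exp_log (by positivity), inv_div] at this
    linarith
  have hpt : ∀ s, (if P s then (1 : ℝ) else 0) ≤
      (if Q₁ s then 1 else 0) + if Q₂ s then 1 else 0 := by
    intro s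
    have hor : P s → Q₁ s ∨ Q₂ s := by
      intro hs
      by_contra hcon
      rw [not_or] at hcon
      apply hP s hs
      rw [hQ₁, hQ₂] at hcon
      push Not at hcon
      refine ⟨fun u v => (hcon.1 u v).le, hcon.2.le.trans_eq ?_⟩
      congr 1; ring
    by_cases hPs : P s
    · rw [if_pos hPs]
      rcases hor hPs with h | h
      · rw [if_pos h]; split_ifs <;> norm_num
      · rw [if_pos h]; split_ifs <;> norm_num
    · rw [if_neg hPs]; split_ifs <;> norm_num
  refine (bernE_mono hp hpt).trans ?_
  rw [bernE_add]
  linarith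

/-- A good noise matrix has spectral norm `O(lam ^ (3 / 4))`. -/
lemma IsGoodNoise.sq_mulVec_le {K C lam : ℝ} {X : Matrix (Fin n) (Fin n) ℝ}
    (h : IsGoodNoise K C lam X) (hX : X.IsSymm) (hC : 0 < C) (hn : 2 ≤ n)
    (hlam : 0 < lam) (hlog : Real.log n ^ 2 ≤ lam) (x : Fin n → ℝ) :
    (X *ᵥ x) ⬝ᵥ (X *ᵥ x) ≤ 6 * C * lam * √lam * (x ⬝ᵥ x) := by
  obtain ⟨N, hN⟩ : ∃ N, N = ⌈Real.log n⌉₊ := ⟨_, rfl⟩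
  have h2 := h.2
  rw [← hN] at h2
  have hn1 : (2 : ℝ) ≤ n := by exact_mod_cast hn
  have hl2 : (0.69 : ℝ) ≤ Real.log 2 := by have := Real.log_two_gt_d9; linarith
  have hℓ2 : Real.log 2 ≤ Real.log n := Real.log_le_log (by norm_num) hn1
  have hℓ : (0.69 : ℝ) ≤ Real.log n := hl2.trans hℓ2
  have hNl : Real.log n ≤ N := by rw [hN]; exact Nat.le_ceil _
  have hNu : (N : ℝ) ≤ Real.log n + 1 := by
    rw [hN]; exact (Nat.ceil_lt_add_one (by linarith)).le
  have hN0 : 0 < N := by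
    have : (0 : ℝ) < N := by linarith
    exact_mod_cast this
  have hls : Real.log n ≤ √lam := Real.le_sqrt_of_sq_le hlog
  have hB0 : 0 ≤ 2 * N * (C * lam) := by positivity
  -- The logarithm lost in the trace method is replaced by √lam, using log n ≤ √lam.
  have hB : 2 * N * (C * lam) ≤ 6 * C * lam * √lam := by
    have : 2 * (N : ℝ) ≤ 6 * √lam := by linarith
    have h4 := mul_le_mul_of_nonneg_right this (by positivity : 0 ≤ C * lam)
    linarith
  have hev := sq_mulVec_le_of_eigenvalues hX (b := √(2 * N * (C * lam))) (by
    intro v μ hv hμ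
    have h3 := (eigenvalue_pow_le_trace hX N hv hμ).trans h2
    rw [pow_mul] at h3
    have h4 := le_of_pow_le_pow_left₀ hN0.ne' hB0 h3
    exact Real.abs_le_sqrt h4) x
  rw [Real.sq_sqrt hB0] at hev
  exact hev.trans (mul_le_mul_of_nonneg_right hB (dotProduct_self_nonneg' x))

end Graph

/-! ### The conditional law of the graph -/

section Law

open scoped Matrix

variable {n : ℕ}

/-- The edge probabilities given the degree parameters. -/
def edgeProb (n₁ : ℕ) (lam r w : ℝ) (θ : Fin n → ℝ) (e : Edge n) : ℝ :=
  meanMatrix n₁ lam r w θ e.1.1 e.1.2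

open Classical in
/-- The edges of a graph given by its adjacency matrix. -/
def edgePattern (A : Matrix (Fin n) (Fin n) ℝ) (e : Edge n) : Bool := decide (A e.1.1 e.1.2 = 1)

/-- Extension of an edge pattern by `false` on and above the diagonal. -/
def extendPattern (s : Edge n → Bool) (i j : Fin n) : Bool :=
  if h : j < i then s ⟨(i, j), h⟩ else false

lemma extendPattern_edge (s : Edge n → Bool) (e : Edge n) :
    extendPattern s e.1.1 e.1.2 = s e := by
  rw [extendPattern, dif_pos e.2]

lemma graphProb_extendPattern (n₁ : ℕ) (lam r w : ℝ) (θ : Fin n → ℝ) (s : Edge n → Bool) :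
    graphProb n₁ lam r w θ (extendPattern s) = bernWeight (edgeProb n₁ lam r w θ) s := by
  obtain ⟨f, hf⟩ : ∃ f : Fin n × Fin n → ℝ, f = fun q => if extendPattern s q.1 q.2 then
    meanMatrix n₁ lam r w θ q.1 q.2 else 1 - meanMatrix n₁ lam r w θ q.1 q.2 := ⟨_, rfl⟩
  have h1 : bernWeight (edgeProb n₁ lam r w θ) s = ∏ e : Edge n, f e.1 := by
    apply Finset.prod_congr rfl
    intro e _
    rw [hf]
    simp only [extendPattern_edge]
    rfl
  have h2 : graphProb n₁ lam r w θ (extendPattern s) = ∏ i, ∏ j ∈ Finset.Iio i, f (i, j) := by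
    rw [hf]; rfl
  rw [h1, h2, ← Finset.prod_subtype (Finset.univ.filter fun q : Fin n × Fin n => q.2 < q.1)
    (fun q => by simp) f, Finset.prod_filter, Fintype.prod_prod_type]
  apply Finset.prod_congr rfl
  intro i _
  rw [← Finset.prod_filter]
  congr 1
  ext j; simp

lemma continuous_meanMatrix_apply (n₁ : ℕ) (lam r w : ℝ) (i j : Fin n) :
    Continuous fun θ : Fin n → ℝ => meanMatrix n₁ lam r w θ i j := by
  simp only [meanMatrix, Matrix.of_apply]
  fun_prop

lemma continuous_edgeProb (n₁ : ℕ) (lam r w : ℝ) (e : Edge n) :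
    Continuous fun θ : Fin n → ℝ => edgeProb n₁ lam r w θ e :=
  continuous_meanMatrix_apply n₁ lam r w _ _

lemma continuous_bernWeight (n₁ : ℕ) (lam r w : ℝ) (s : Edge n → Bool) :
    Continuous fun θ : Fin n → ℝ => bernWeight (edgeProb n₁ lam r w θ) s := by
  unfold bernWeight
  refine continuous_finsetProd _ fun e _ => ?_
  split_ifs
  · exact continuous_edgeProb n₁ lam r w e
  · exact continuous_const.sub (continuous_edgeProb n₁ lam r w e)

lemma measurableSet_isGoodNoise (n₁ : ℕ) (lam r w K C : ℝ) (s : Edge n → Bool) :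
    MeasurableSet {θ : Fin n → ℝ |
      IsGoodNoise K C lam (bernMatrix (edgeProb n₁ lam r w θ) edgeMatrix s)} := by
  have hX : Continuous fun θ : Fin n → ℝ =>
      bernMatrix (edgeProb n₁ lam r w θ) edgeMatrix s := by
    unfold bernMatrix
    refine continuous_finsetSum _ fun e _ => ?_
    exact (continuous_const.sub (continuous_edgeProb n₁ lam r w e)).smul continuous_const
  apply IsClosed.measurableSet
  simp only [IsGoodNoise, Set.ofPred_and, Set.ofPred_forall]
  refine IsClosed.inter (isClosed_iInter fun u => isClosed_iInter fun v => ?_) ?_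
  · refine isClosed_le (Continuous.abs ?_) continuous_const
    exact continuous_const.dotProduct (hX.matrix_mulVec continuous_const)
  · exact isClosed_le (hX.pow _).matrix_trace continuous_const

variable {Ω : Type*} [MeasurableSpace Ω] {Pr : Measure Ω} [IsProbabilityMeasure Pr] {n₁ : ℕ}
  {lam r w ξ : ℝ} {ν : Measure ℝ} {θ : Ω → Fin n → ℝ} {A : Ω → Matrix (Fin n) (Fin n) ℝ}

omit [MeasurableSpace Ω] in
lemma setOf_edgePattern_eq (h : ∀ x i j, A x i j = 0 ∨ A x i j = 1) (s : Edge n → Bool) (x : Ω) :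
    edgePattern (A x) = s ↔
      ∀ i j, j < i → A x i j = if extendPattern s i j then 1 else 0 := by
  constructor
  · rintro rfl i j hij
    rw [extendPattern, dif_pos hij, edgePattern]
    rcases h x i j with h' | h' <;> simp [h']
  · intro hs
    ext e
    have := hs e.1.1 e.1.2 e.2
    rw [extendPattern_edge] at this
    rw [edgePattern, this]
    cases s e <;> simp

omit [IsProbabilityMeasure Pr] in
lemma measurableSet_edgePattern_eq (h : IsModel Pr n n₁ lam r w ξ ν θ A) (s : Edge n → Bool) :
    MeasurableSet {x | edgePattern (A x) = s} := by
  simp only [setOf_edgePattern_eq h.zero_one_A, Set.ofPred_forall]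
  refine MeasurableSet.iInter fun i => MeasurableSet.iInter fun j => MeasurableSet.iInter fun _ => ?_
  exact h.measurable_A i j (measurableSet_singleton _)

open Classical in
/-- An event of small conditional probability has small probability. -/
lemma prob_le_of_conditional (h : IsModel Pr n n₁ lam r w ξ ν θ A) {G : Set (Fin n → ℝ)}
    (hG : MeasurableSet G) (hGp : ∀ t ∈ G, ∀ e, edgeProb n₁ lam r w t e ∈ Set.Icc (0 : ℝ) 1)
    {B : (Fin n → ℝ) → (Edge n → Bool) → Prop} (hB : ∀ s, MeasurableSet {t | B t s}) {δ : ℝ}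
    (hδ : 0 ≤ δ)
    (hBδ : ∀ t ∈ G, bernE (edgeProb n₁ lam r w t) (fun s => if B t s then 1 else 0) ≤ δ) :
    Pr.real {x | θ x ∈ G ∧ B (θ x) (edgePattern (A x))} ≤ δ := by
  have hθ : Measurable θ := measurable_pi_iff.2 h.measurable_θ
  -- The bad parameter set depends on the edge pattern. There are finitely many patterns, so `law_A`
  -- is applied to each one and the integrals are summed to the conditional probability.
  obtain ⟨S, hS⟩ : ∃ S : (Edge n → Bool) → Set (Fin n → ℝ), S = fun s => G ∩ {t | B t s} :=
    ⟨_, rfl⟩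
  have hSm : ∀ s, MeasurableSet (S s) := fun s => by rw [hS]; exact hG.inter (hB s)
  have hcover : {x | θ x ∈ G ∧ B (θ x) (edgePattern (A x))} ⊆ ⋃ s : Edge n → Bool,
      {x | θ x ∈ S s ∧ ∀ i j, j < i → A x i j = if extendPattern s i j then 1 else 0} := by
    rintro x ⟨h1, h2⟩
    rw [Set.mem_iUnion]
    refine ⟨edgePattern (A x), ?_, ?_⟩
    · rw [hS]; exact ⟨h1, h2⟩
    · exact (setOf_edgePattern_eq h.zero_one_A _ x).1 rfl
  have hint : ∀ s, ∫ x in θ ⁻¹' S s, graphProb n₁ lam r w (θ x) (extendPattern s) ∂Pr =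
      ∫ x, (S s).indicator (fun t => bernWeight (edgeProb n₁ lam r w t) s) (θ x) ∂Pr := by
    intro s
    rw [← integral_indicator (hθ (hSm s))]
    apply integral_congr_ae
    filter_upwards with x
    simp only [Set.indicator, Set.mem_preimage, graphProb_extendPattern]
  have hpoint : ∀ t, ∑ s, (S s).indicator (fun t => bernWeight (edgeProb n₁ lam r w t) s) t ≤ δ := by
    intro t
    by_cases ht : t ∈ G
    · refine le_trans (le_of_eq ?_) (hBδ t ht)
      apply Finset.sum_congr rfl
      intro s _
      simp only [Set.indicator, hS, Set.mem_inter_iff, ht, true_and, Set.mem_ofPred_eq, mul_ite,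
        mul_one, mul_zero]
    · refine le_trans (le_of_eq (Finset.sum_eq_zero fun s _ => ?_)) hδ
      exact Set.indicator_of_notMem (fun hts => ht (by rw [hS] at hts; exact hts.1)) _
  have hnn : ∀ s t, 0 ≤ (S s).indicator (fun t => bernWeight (edgeProb n₁ lam r w t) s) t := by
    intro s t
    apply Set.indicator_apply_nonneg
    intro ht
    rw [hS] at ht
    exact bernWeight_nonneg (hGp t ht.1) s
  have hintegrable : ∀ s, Integrable (fun x =>
      (S s).indicator (fun t => bernWeight (edgeProb n₁ lam r w t) s) (θ x)) Pr := by
    intro s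
    have hm : Measurable fun x =>
        (S s).indicator (fun t => bernWeight (edgeProb n₁ lam r w t) s) (θ x) :=
      ((continuous_bernWeight n₁ lam r w s).measurable.indicator (hSm s)).comp hθ
    refine Integrable.of_bound hm.aestronglyMeasurable δ ?_
    filter_upwards with x
    rw [Real.norm_of_nonneg (hnn s _)]
    exact (Finset.single_le_sum (f := fun s => (S s).indicator (fun t =>
      bernWeight (edgeProb n₁ lam r w t) s) (θ x)) (fun s _ => hnn s _)
      (Finset.mem_univ s)).trans (hpoint _)
  calc Pr.real {x | θ x ∈ G ∧ B (θ x) (edgePattern (A x))} ≤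
      Pr.real (⋃ s : Edge n → Bool,
        {x | θ x ∈ S s ∧ ∀ i j, j < i → A x i j = if extendPattern s i j then 1 else 0}) :=
        measureReal_mono hcover
    _ ≤ ∑ s : Edge n → Bool, Pr.real
        {x | θ x ∈ S s ∧ ∀ i j, j < i → A x i j = if extendPattern s i j then 1 else 0} :=
        measureReal_iUnion_fintype_le _
    _ = ∑ s, ∫ x, (S s).indicator (fun t => bernWeight (edgeProb n₁ lam r w t) s) (θ x) ∂Pr := by
        apply Finset.sum_congr rfl
        intro s _
        rw [h.law_A (S s) (hSm s) (extendPattern s), hint]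
    _ = ∫ x, ∑ s, (S s).indicator (fun t => bernWeight (edgeProb n₁ lam r w t) s) (θ x) ∂Pr :=
        (integral_finsetSum _ fun s _ => hintegrable s).symm
    _ ≤ ∫ _x, δ ∂Pr := by
        apply integral_mono (integrable_finsetSum _ fun s _ => hintegrable s)
          (integrable_const _)
        intro x
        exact hpoint (θ x)
    _ = δ := by simp

/-- The degree parameters that are admissible in the model. -/
def admissible (n : ℕ) (lam r w ξ : ℝ) : Set (Fin n → ℝ) :=
  {t | (∀ i, t i ∈ Set.Icc (1 / ξ) ξ) ∧ ∀ i j k l, t i * t j * blockProb n lam r w k l ≤ 1}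

lemma measurableSet_admissible (n : ℕ) (lam r w ξ : ℝ) :
    MeasurableSet (admissible n lam r w ξ) := by
  apply IsClosed.measurableSet
  simp only [admissible, Set.ofPred_and, Set.ofPred_forall]
  refine IsClosed.inter (isClosed_iInter fun i => ?_) (isClosed_iInter fun i =>
    isClosed_iInter fun j => isClosed_iInter fun k => isClosed_iInter fun l => ?_)
  · exact isClosed_Icc.preimage (continuous_apply i)
  · exact isClosed_le (by fun_prop) continuous_const

omit [IsProbabilityMeasure Pr] in
lemma ae_mem_admissible (h : IsModel Pr n n₁ lam r w ξ ν θ A) :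
    ∀ᵐ x ∂Pr, θ x ∈ admissible n lam r w ξ := by
  have h1 : ∀ i, ∀ᵐ x ∂Pr, θ x i ∈ Set.Icc (1 / ξ) ξ := by
    intro i
    have := h.bound_ν
    rw [← h.law_θ i] at this
    exact ae_of_ae_map (h.measurable_θ i).aemeasurable this
  filter_upwards [ae_all_iff.2 h1, h.prob_le_one] with x hx hx'
  exact ⟨hx, hx'⟩

/-- The event that the degree parameters are admissible and the noise is good. -/
def goodEvent (n₁ : ℕ) (lam r w ξ K C : ℝ) (θ : Ω → Fin n → ℝ)
    (A : Ω → Matrix (Fin n) (Fin n) ℝ) : Set Ω :=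
  {x | θ x ∈ admissible n lam r w ξ ∧
    IsGoodNoise K C lam (bernMatrix (edgeProb n₁ lam r w (θ x)) edgeMatrix (edgePattern (A x)))}

omit [IsProbabilityMeasure Pr] in
lemma measurableSet_goodEvent (h : IsModel Pr n n₁ lam r w ξ ν θ A) (K C : ℝ) :
    MeasurableSet (goodEvent n₁ lam r w ξ K C θ A) := by
  have hθ : Measurable θ := measurable_pi_iff.2 h.measurable_θ
  have : goodEvent n₁ lam r w ξ K C θ A = θ ⁻¹' admissible n lam r w ξ ∩ ⋃ s : Edge n → Bool,
      (θ ⁻¹' {t | IsGoodNoise K C lam (bernMatrix (edgeProb n₁ lam r w t) edgeMatrix s)} ∩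
        {x | edgePattern (A x) = s}) := by
    ext x
    simp only [goodEvent, Set.mem_ofPred_eq, Set.mem_inter_iff, Set.mem_preimage, Set.mem_iUnion,
      exists_eq_right']
  rw [this]
  exact (hθ (measurableSet_admissible n lam r w ξ)).inter <| MeasurableSet.iUnion fun s =>
    (hθ (measurableSet_isGoodNoise n₁ lam r w K C s)).inter (measurableSet_edgePattern_eq h s)

lemma blockProb_bounds (hr : 0 ≤ r) (hw : 0 ≤ w) (hlam : 0 ≤ lam) (k l : Fin 2) :
    0 ≤ blockProb n lam r w k l ∧ blockProb n lam r w k l ≤ lam / n * (1 + r + w) := by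
  have h0 : 0 ≤ lam / n := by positivity
  have key : ∀ y : ℝ, 0 ≤ y → y ≤ 1 + r + w → 0 ≤ lam / n * y ∧ lam / n * y ≤
      lam / n * (1 + r + w) := fun y h1 h2 =>
    ⟨mul_nonneg h0 h1, mul_le_mul_of_nonneg_left h2 h0⟩
  fin_cases k <;> fin_cases l <;>
    simp only [blockProb, Matrix.smul_apply, Matrix.of_apply, Matrix.cons_val', Matrix.cons_val_zero,
      Matrix.cons_val_one, smul_eq_mul, Matrix.cons_val_fin_one, Fin.zero_eta, Fin.mk_one,
      Fin.isValue] <;>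
    apply key <;> linarith

lemma meanMatrix_mem_Icc (hr : 0 ≤ r) (hw : 0 ≤ w) (hlam : 0 ≤ lam) (hξ : 0 < ξ)
    {t : Fin n → ℝ} (ht : t ∈ admissible n lam r w ξ) (i j : Fin n) :
    meanMatrix n₁ lam r w t i j ∈ Set.Icc (0 : ℝ) 1 ∧
      meanMatrix n₁ lam r w t i j ≤ ξ ^ 2 * (1 + r + w) * lam / n := by
  have h0 : ∀ i, 0 ≤ t i := fun i => le_trans (by positivity) (ht.1 i).1
  obtain ⟨b0, b1⟩ := blockProb_bounds (n := n) hr hw hlam (comm n₁ i) (comm n₁ j)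
  simp only [meanMatrix, Matrix.of_apply]
  refine ⟨⟨mul_nonneg (mul_nonneg (h0 i) (h0 j)) b0, ht.2 i j _ _⟩, ?_⟩
  calc t i * t j * blockProb n lam r w (comm n₁ i) (comm n₁ j) ≤
      ξ * ξ * (lam / n * (1 + r + w)) := by
        gcongr
        · exact h0 j
        · exact (ht.1 i).2
        · exact (ht.1 j).2
    _ = _ := by ring

lemma prob_goodEvent_ge (h : IsModel Pr n n₁ lam r w ξ ν θ A) {K C δ : ℝ} (hr : 0 ≤ r)
    (hw : 0 ≤ w) (hlam : 0 ≤ lam) (hξ : 0 < ξ) (hδ : 0 ≤ δ)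
    (hgood : ∀ p : Edge n → ℝ, (∀ e, p e ∈ Set.Icc (0 : ℝ) 1) →
      (∀ e, p e ≤ ξ ^ 2 * (1 + r + w) * lam / n) → ∀ (P : (Edge n → Bool) → Prop) [DecidablePred P],
      (∀ s, P s → ¬ IsGoodNoise K C lam (bernMatrix p edgeMatrix s)) →
      bernE p (fun s => if P s then 1 else 0) ≤ δ) :
    1 - δ ≤ Pr.real (goodEvent n₁ lam r w ξ K C θ A) := by
  classical
  have hE := measurableSet_goodEvent h K C
  have hbad := prob_le_of_conditional h (measurableSet_admissible n lam r w ξ)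
    (fun t ht e => (meanMatrix_mem_Icc hr hw hlam hξ ht _ _).1)
    (B := fun t s => ¬ IsGoodNoise K C lam (bernMatrix (edgeProb n₁ lam r w t) edgeMatrix s))
    (fun s => (measurableSet_isGoodNoise n₁ lam r w K C s).compl) hδ
    (fun t ht => @hgood _ (fun e => (meanMatrix_mem_Icc hr hw hlam hξ ht _ _).1)
      (fun e => (meanMatrix_mem_Icc hr hw hlam hξ ht _ _).2) _
      (fun s => Classical.propDecidable _) fun s hs => hs)
  have hcompl : Pr.real (goodEvent n₁ lam r w ξ K C θ A)ᶜ ≤ δ := by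
    refine le_trans (le_of_eq (measureReal_congr ?_)) hbad
    filter_upwards [ae_mem_admissible h] with x hx
    apply propext
    change ¬ (θ x ∈ admissible n lam r w ξ ∧ _) ↔ (θ x ∈ admissible n lam r w ξ ∧ _)
    tauto
  rw [probReal_compl_eq_one_sub hE] at hcompl
  linarith

/-! ### Consequences of good noise -/

/-- Isolates the arbitrary diagonal of `A`: its contribution has entries of absolute value at most
1, negligible against the noise. -/
lemma sub_meanMatrix_eq {B : Matrix (Fin n) (Fin n) ℝ} (hB : B.IsSymm)
    (h01 : ∀ i j, B i j = 0 ∨ B i j = 1) (n₁ : ℕ) (lam r w : ℝ) (t : Fin n → ℝ) :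
    B - meanMatrix n₁ lam r w t =
      bernMatrix (edgeProb n₁ lam r w t) edgeMatrix (edgePattern B) +
        Matrix.diagonal fun i => B i i - meanMatrix n₁ lam r w t i i := by
  have key : ∀ {i j : Fin n}, j < i → (B - meanMatrix n₁ lam r w t) i j =
      bernMatrix (edgeProb n₁ lam r w t) edgeMatrix (edgePattern B) i j := by
    intro i j hij
    rw [bernMatrix_edge_apply _ _ hij, Matrix.sub_apply]
    congr 1
    rw [edgePattern]
    rcases h01 i j with h | h <;> simp [h, bit]
  ext i j
  rw [Matrix.add_apply]
  rcases lt_trichotomy j i with h | h | h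
  · rw [key h, Matrix.diagonal_apply_ne _ h.ne', add_zero]
  · rw [h, bernMatrix_edge_diag, Matrix.diagonal_apply_eq, zero_add, Matrix.sub_apply]
  · rw [Matrix.diagonal_apply_ne _ h.ne, add_zero,
      ← (bernMatrix_isSymm _ edgeMatrix_isSymm _).apply i j, ← key h,
      ((hB.sub (meanMatrix_isSymm n₁ lam r w t))).apply i j]

lemma abs_diag_sub_le (hr : 0 ≤ r) (hw : 0 ≤ w) (hlam : 0 ≤ lam) (hξ : 0 < ξ)
    {B : Matrix (Fin n) (Fin n) ℝ} (h01 : ∀ i j, B i j = 0 ∨ B i j = 1) {t : Fin n → ℝ}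
    (ht : t ∈ admissible n lam r w ξ) (i : Fin n) :
    |B i i - meanMatrix n₁ lam r w t i i| ≤ 1 := by
  have := (meanMatrix_mem_Icc (n₁ := n₁) hr hw hlam hξ ht i i).1
  rw [abs_le]
  rcases h01 i i with h | h <;> rw [h] <;> constructor <;> linarith [this.1, this.2]

lemma IsGoodNoise.abs_form_sub_le {K C : ℝ} (hr : 0 ≤ r) (hw : 0 ≤ w) (hlam : 1 ≤ lam)
    (hξ : 0 < ξ) {B : Matrix (Fin n) (Fin n) ℝ} (hB : B.IsSymm)
    (h01 : ∀ i j, B i j = 0 ∨ B i j = 1) {t : Fin n → ℝ} (ht : t ∈ admissible n lam r w ξ)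
    (h : IsGoodNoise K C lam (bernMatrix (edgeProb n₁ lam r w t) edgeMatrix (edgePattern B)))
    {y z : Fin n → ℝ} (hy : ∀ i, y i = 0 ∨ y i = 1) (hz : ∀ i, z i = 0 ∨ z i = 1) :
    |y ⬝ᵥ (B *ᵥ z) - y ⬝ᵥ (meanMatrix n₁ lam r w t *ᵥ z)| ≤ (K + 1) * n * √lam := by
  classical
  have hbit : ∀ {y : Fin n → ℝ}, (∀ i, y i = 0 ∨ y i = 1) →
      y = fun i => bit (decide (y i = 1)) := by
    intro y hy
    ext i
    rcases hy i with h | h <;> simp [h, bit]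
  have h1 := h.1 (fun i => decide (y i = 1)) (fun i => decide (z i = 1))
  rw [← hbit hy, ← hbit hz] at h1
  rw [← dotProduct_sub, ← Matrix.sub_mulVec, sub_meanMatrix_eq hB h01, Matrix.add_mulVec,
    dotProduct_add]
  have h2 : |y ⬝ᵥ ((Matrix.diagonal fun i => B i i - meanMatrix n₁ lam r w t i i) *ᵥ z)| ≤ n := by
    refine (Finset.abs_sum_le_sum_abs _ _).trans ?_
    calc _ ≤ ∑ _i : Fin n, (1 : ℝ) := by
          apply Finset.sum_le_sum
          intro i _
          rw [Matrix.mulVec_diagonal, abs_mul, abs_mul]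
          have hd := abs_diag_sub_le (n₁ := n₁) hr hw (by linarith) hξ h01 ht i
          rcases hy i with e | e <;> rcases hz i with e' | e' <;> rw [e, e'] <;> simp [hd]
      _ = n := by simp
  have hsq1 : 1 ≤ √lam := by rw [Real.one_le_sqrt]; exact hlam
  have hn0 : (0 : ℝ) ≤ n := Nat.cast_nonneg n
  refine (abs_add_le _ _).trans ?_
  have : (n : ℝ) * 1 ≤ n * √lam := mul_le_mul_of_nonneg_left hsq1 hn0
  linarith

lemma IsGoodNoise.sq_sub_mulVec_le {K C : ℝ} (hr : 0 ≤ r) (hw : 0 ≤ w) (hlam : 1 ≤ lam)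
    (hξ : 0 < ξ) {B : Matrix (Fin n) (Fin n) ℝ} (hB : B.IsSymm)
    (h01 : ∀ i j, B i j = 0 ∨ B i j = 1) {t : Fin n → ℝ} (ht : t ∈ admissible n lam r w ξ)
    (h : IsGoodNoise K C lam (bernMatrix (edgeProb n₁ lam r w t) edgeMatrix (edgePattern B)))
    (hC : 0 < C) (hn : 2 ≤ n) (hlog : Real.log n ^ 2 ≤ lam) (x : Fin n → ℝ) :
    ((B - meanMatrix n₁ lam r w t) *ᵥ x) ⬝ᵥ ((B - meanMatrix n₁ lam r w t) *ᵥ x) ≤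
      (12 * C + 2) * (lam * √lam) * (x ⬝ᵥ x) := by
  rw [sub_meanMatrix_eq hB h01, Matrix.add_mulVec]
  have h1 := h.sq_mulVec_le (bernMatrix_isSymm _ edgeMatrix_isSymm _) hC hn (by linarith) hlog x
  obtain ⟨a, ha⟩ : ∃ a, a = bernMatrix (edgeProb n₁ lam r w t) edgeMatrix (edgePattern B) *ᵥ x :=
    ⟨_, rfl⟩
  obtain ⟨d, hd⟩ : ∃ d, d = (Matrix.diagonal fun i => B i i - meanMatrix n₁ lam r w t i i) *ᵥ x :=
    ⟨_, rfl⟩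
  rw [← ha] at h1 ⊢
  rw [← hd]
  have h2 : d ⬝ᵥ d ≤ x ⬝ᵥ x := by
    apply Finset.sum_le_sum
    intro i _
    rw [hd, Matrix.mulVec_diagonal]
    have hb := abs_diag_sub_le (n₁ := n₁) hr hw (by linarith) hξ h01 ht i
    have : (B i i - meanMatrix n₁ lam r w t i i) ^ 2 ≤ 1 := by
      rw [← sq_abs]; exact pow_le_one₀ (abs_nonneg _) hb
    nlinarith [mul_self_nonneg (x i)]
  have h3 := dotProduct_self_nonneg' (a - d)
  have hsq1 : 1 ≤ √lam := by rw [Real.one_le_sqrt]; exact hlam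
  have h4 : 1 ≤ lam * √lam := by nlinarith
  have h5 := mul_le_mul_of_nonneg_right h4 (dotProduct_self_nonneg' x)
  simp only [sub_dotProduct, dotProduct_sub, add_dotProduct, dotProduct_add] at h3 ⊢
  linarith

end Law

/-! ### The main theorem -/

section Main

open scoped Matrix

variable {n : ℕ}

/-- Halving the smaller proportion leaves room for the rounding error in n₁, which is less than 1 ≤
ρ n. -/
lemma community_sizes {n₁ : ℕ} {π₁ ρ : ℝ} (h1 : 2 * ρ ≤ π₁) (h2 : 2 * ρ ≤ 1 - π₁)
    (h : |(n₁ : ℝ) - n * π₁| < 1) (hn : 1 ≤ ρ * n) :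
    n₁ ≤ n ∧ ρ * n ≤ n₁ ∧ ρ * n ≤ n - n₁ := by
  rw [abs_lt] at h
  have hn0 : (0 : ℝ) ≤ n := Nat.cast_nonneg n
  have e1 := mul_le_mul_of_nonneg_right h1 hn0
  have e2 := mul_le_mul_of_nonneg_right h2 hn0
  have e3 : ρ * n ≤ n - n₁ := by linarith
  refine ⟨?_, by linarith, e3⟩
  have : (n₁ : ℝ) ≤ n := by linarith
  exact_mod_cast this

/-- The probability constraint in the first block, with θ ≥ 1 / ξ, caps lam at order n. -/
lemma lam_le_of_admissible {lam r w ξ : ℝ} (hξ : 0 < ξ) (hlam : 0 ≤ lam) (hn : 0 < n)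
    {t : Fin n → ℝ} (ht : t ∈ admissible n lam r w ξ) : lam ≤ ξ ^ 2 * n := by
  have hn0 : (0 : ℝ) < n := by exact_mod_cast hn
  have h := ht.2 ⟨0, hn⟩ ⟨0, hn⟩ 0 0
  have hl := (ht.1 ⟨0, hn⟩).1
  simp only [blockProb, Matrix.smul_apply, Matrix.of_apply, Matrix.cons_val', Matrix.cons_val_zero,
    smul_eq_mul, Matrix.cons_val_fin_one, mul_one] at h
  have h1 : 1 / ξ * (1 / ξ) * (lam / n) ≤ 1 := by
    have ht0 : 0 ≤ t ⟨0, hn⟩ := le_trans (by positivity) hl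
    exact le_trans (by gcongr) h
  have h2 : 1 / ξ * (1 / ξ) * (lam / n) = lam / (ξ ^ 2 * n) := by field_simp
  rwa [h2, div_le_one (by positivity)] at h1

/-- The squared residual only needs η² ≤ η here; the factor 4 is the squared distance of opposite
labels. -/
lemma four_mul_le_of_residual {ξ D M ℓ m s η : ℝ} (hξ : 1 ≤ ξ) (hD : 0 ≤ D) (hℓ : 0 ≤ ℓ)
    (hs : 0 ≤ s) (hη0 : 0 ≤ η) (hη : η ≤ 1) (hM : 4 * D * ξ ^ 2 ≤ M)
    (h : m ≤ D * ℓ * (ξ ^ 2 * η ^ 2 + s)) : 4 * m ≤ M * ℓ * (s + η) := by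
  have h2 : η ^ 2 ≤ η := by nlinarith
  have h3 : ξ ^ 2 * η ^ 2 + s ≤ ξ ^ 2 * (s + η) := by
    have e1 : ξ ^ 2 * η ^ 2 ≤ ξ ^ 2 * η := by gcongr
    have e2 : 1 * s ≤ ξ ^ 2 * s := mul_le_mul_of_nonneg_right (one_le_pow₀ hξ) hs
    linarith
  have h4 := mul_le_mul_of_nonneg_left h3 (mul_nonneg hD hℓ)
  calc 4 * m ≤ 4 * (D * ℓ * (ξ ^ 2 * (s + η))) := by linarith
    _ = 4 * D * ξ ^ 2 * ℓ * (s + η) := by ring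
    _ ≤ M * ℓ * (s + η) := by gcongr

end Main

end

end DCSBM

-- The good event involves only θ and `A`; on it all further bounds are deterministic, so they hold
-- simultaneously for all `U`, `V` and e.
set_option maxHeartbeats 1000000 in
theorem theorem2 (r w π₁ ξ δ : ℝ) (hr : 0 ≤ r) (hw : 0 ≤ w) (hrw : r ^ 2 ≠ w)
    (hπ : π₁ ∈ Set.Ioo (0 : ℝ) 1) (hξ : 1 ≤ ξ) (hδ : δ ∈ Set.Ioo (0 : ℝ) 1) :
    ∃ M : ℝ, 0 < M ∧
      ∀ lam : ℕ → ℝ, (∀ n, 0 < lam n) →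
        (fun n : ℕ => Real.log n ^ 2) =O[Filter.atTop] lam →
      ∀ n : ℕ, 2 ≤ n → ∀ n₁ : ℕ, |(n₁ : ℝ) - n * π₁| < 1 →
      ∀ (Ω : Type*) [MeasurableSpace Ω] (Pr : MeasureTheory.Measure Ω)
        [MeasureTheory.IsProbabilityMeasure Pr] (ν : MeasureTheory.Measure ℝ)
        (θ : Ω → Fin n → ℝ) (A : Ω → Matrix (Fin n) (Fin n) ℝ),
        DCSBM.IsModel Pr n n₁ (lam n) r w ξ ν θ A →
      ∃ E : Set Ω, MeasurableSet E ∧ 1 - δ ≤ Pr.real E ∧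
        ∀ x ∈ E, ∀ (U : Matrix (Fin 2) (Fin n) ℝ) (e : Fin n → ℝ),
          DCSBM.IsEstimate (A x) U e →
          (∀ V : Matrix (Fin 2) (Fin n) ℝ,
            DCSBM.IsLeadingEigenvectors abs (DCSBM.meanMatrix n₁ (lam n) r w (θ x)) V →
            1 / (n : ℝ) * min (DCSBM.sqNorm (DCSBM.trueLabel n n₁ - e))
                (DCSBM.sqNorm (DCSBM.trueLabel n n₁ + e)) ≤
              M * Real.log n * (lam n ^ (-(1 / 2) : ℝ) + DCSBM.specNorm (U - V))) ∧
          ((DCSBM.IsLeadingEigenvectors abs (A x) U ∨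
              (r ^ 2 < w ∧ DCSBM.IsLeadingEigenvectors id (A x) U)) →
            DCSBM.misclustered (DCSBM.trueLabel n n₁) e ≤
              M * Real.log n / Real.sqrt (lam n)) := by
  open DCSBM in
  have hξ0 : 0 < ξ := by linarith
  obtain ⟨ρ, hρ⟩ : ∃ ρ, ρ = min π₁ (1 - π₁) / 2 := ⟨_, rfl⟩
  have hρ0 : 0 < ρ := by
    rw [hρ]; exact half_pos (lt_min hπ.1 (by linarith [hπ.2]))
  have hρ1 : 2 * ρ ≤ π₁ := by
    have := min_le_left π₁ (1 - π₁)
    linarith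
  have hρ2 : 2 * ρ ≤ 1 - π₁ := by
    have := min_le_right π₁ (1 - π₁)
    linarith
  obtain ⟨K, C, hK, hC, hnoise⟩ := exists_bernE_not_isGoodNoise_le
    (c := ξ ^ 2 * (1 + r + w)) (by positivity) hδ.1 hδ.2.le
  obtain ⟨D, hD, hmis⟩ := exists_misclustered_le (K := K + 1) hr hw hrw hξ hρ0 (by linarith)
  obtain ⟨Y, hY⟩ : ∃ Y, Y = 4 * ((1 + r + w) / |w - r ^ 2| * (ξ / ρ)) ^ 2 * (12 * C + 2) :=
    ⟨_, rfl⟩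
  have hY0 : 0 ≤ Y := by rw [hY]; positivity
  have hξρ : 0 < ξ / ρ := by positivity
  -- The first two summands make the nontrivial case imply log² n ≤ lam, lam ≥ 1 and ρ n ≥ 1; the
  -- other two serve the two assertions.
  obtain ⟨M, hM⟩ : ∃ M, M = 3 + 3 * (ξ / ρ) + 4 * D * ξ ^ 2 + D * (Y + 1) := ⟨_, rfl⟩
  have hDξ : 0 ≤ 4 * D * ξ ^ 2 := by positivity
  have hDY : 0 ≤ D * (Y + 1) := by positivity
  refine ⟨M, by rw [hM]; positivity, ?_⟩
  intro lam hlam _ n hn n₁ hn₁ Ω _ Pr _ ν θ A hmodel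
  have hl0 := hlam n
  have hsq0 : 0 < √(lam n) := Real.sqrt_pos.2 hl0
  have hn1 : (2 : ℝ) ≤ n := by exact_mod_cast hn
  have hn0 : (0 : ℝ) < n := by linarith
  have hℓ : (0.69 : ℝ) ≤ Real.log n := by
    have := Real.log_two_gt_d9
    have := Real.log_le_log (by norm_num) hn1
    linarith
  have hrpow : lam n ^ (-(1 / 2) : ℝ) = 1 / √(lam n) := by
    rw [Real.rpow_neg hl0.le, ← Real.sqrt_eq_rpow, one_div]
  rw [hrpow]
  have hspec : ∀ W : Matrix (Fin 2) (Fin n) ℝ, 0 ≤ specNorm W := by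
    intro W
    open scoped Matrix.Norms.L2Operator in
    exact norm_nonneg W
  have hM3 : 3 ≤ M := by rw [hM]; linarith
  -- When the bound is at least 2 it holds on the whole space, since four times the misclustered
  -- fraction never exceeds 2. Otherwise √lam exceeds M log n / 2, which forces lam and n to be
  -- large.
  by_cases hbig : 2 ≤ M * Real.log n / √(lam n)
  · refine ⟨Set.univ, MeasurableSet.univ, by simp [hδ.1.le], ?_⟩
    intro x _ U e he
    have hhalf := misclustered_le_half (trueLabel_mem n n₁) he.1.1
    refine ⟨fun V _ => ?_, fun _ => by linarith⟩
    rw [min_sqNorm_eq (trueLabel_mem n n₁) he.1.1, mul_add, mul_one_div]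
    have : 0 ≤ M * Real.log n * specNorm (U - V) := by
      have := hspec (U - V)
      positivity
    linarith
  rw [not_le, div_lt_iff₀ hsq0] at hbig
  have hlogM : 0.69 * M ≤ M * Real.log n := by nlinarith
  have hsq1 : 1 ≤ √(lam n) := by linarith
  have hlam1 : 1 ≤ lam n := by rwa [Real.one_le_sqrt] at hsq1
  have hss := Real.sq_sqrt hl0.le
  have hlog : Real.log n ^ 2 ≤ lam n := by
    rw [← hss]
    apply pow_le_pow_left₀ (by linarith)
    nlinarith
  refine ⟨goodEvent n₁ (lam n) r w ξ K C θ A, measurableSet_goodEvent hmodel K C,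
    prob_goodEvent_ge hmodel hr hw hl0.le hξ0 hδ.1.le
      (fun p hp hpc P _ hP => hnoise n (lam n) p hn hlam1 hlog hp hpc P hP), ?_⟩
  rintro x ⟨hadm, hgood⟩ U e he
  have hlamn := lam_le_of_admissible hξ0 hl0.le (by omega) hadm
  have hρn : 1 ≤ ρ * n := by
    have h1 : ξ / ρ ≤ √(lam n) := by
      have : 3 * (ξ / ρ) ≤ M := by rw [hM]; linarith
      linarith
    have h2 : (ξ / ρ) ^ 2 ≤ lam n := by
      rw [← hss]; exact pow_le_pow_left₀ hξρ.le h1 2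
    have h3 : (ξ / ρ) ^ 2 ≤ ξ ^ 2 * n := h2.trans hlamn
    rw [div_pow, div_le_iff₀ (by positivity), mul_assoc] at h3
    have h4 : 1 ≤ n * ρ ^ 2 := by
      have : ξ ^ 2 * 1 ≤ ξ ^ 2 * (n * ρ ^ 2) := by linarith
      exact le_of_mul_le_mul_left this (by positivity)
    have h5 : ρ ≤ 1 := by linarith [hπ.2]
    have h6 : 0 < ρ * n := by positivity
    nlinarith
  obtain ⟨hnn, hs1, hs2⟩ := community_sizes hρ1 hρ2 hn₁ hρn
  have hsym := hmodel.symm_A x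
  have h01 := hmodel.zero_one_A x
  have hθl : ∀ i, 1 / ξ ≤ θ x i := fun i => (hadm.1 i).1
  have hθu : ∀ i, θ x i ≤ ξ := fun i => (hadm.1 i).2
  have hO : ∀ f : Fin n → ℝ, (∀ i, f i = -1 ∨ f i = 1) →
      |O11 (A x) f - O11 (meanMatrix n₁ (lam n) r w (θ x)) f| ≤ (K + 1) * n * √(lam n) ∧
      |O12 (A x) f - O12 (meanMatrix n₁ (lam n) r w (θ x)) f| ≤ (K + 1) * n * √(lam n) ∧
      |O22 (A x) f - O22 (meanMatrix n₁ (lam n) r w (θ x)) f| ≤ (K + 1) * n * √(lam n) := by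
    intro f hf
    have hy := labelSet_mem hf
    have hy' : ∀ i, (1 - labelSet f) i = 0 ∨ (1 - labelSet f) i = 1 := by
      intro i
      rcases hy i with h | h <;> simp [h]
    rw [O11_eq, O11_eq, O12_eq, O12_eq, O22_eq, O22_eq]
    exact ⟨hgood.abs_form_sub_le hr hw hlam1 hξ0 hsym h01 hadm hy hy,
      hgood.abs_form_sub_le hr hw hlam1 hξ0 hsym h01 hadm hy hy',
      hgood.abs_form_sub_le hr hw hlam1 hξ0 hsym h01 hadm hy' hy'⟩
  have hest := fun a κ => hmis n hn n₁ (lam n) (θ x) (A x) hnn hs1 hs2 hlam1 hlamn hθl hθu hsym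
    (fun i j => by rcases h01 i j with h | h <;> rw [h]; exact zero_le_one) hO U e a κ he
  constructor
  · intro V hV
    rw [min_sqNorm_eq (trueLabel_mem n n₁) he.1.1]
    have hη0 := hspec (U - V)
    -- If the eigenvectors are at distance at least 1, the right-hand side is already at least 2.
    rcases le_total (specNorm (U - V)) 1 with hη | hη
    · obtain ⟨a, ha⟩ := exists_residual_le_of_mean hr hw hrw hξ hρ0 hl0 (by omega) hnn hs1 hs2 hθl
        hθu U V hV
      exact four_mul_le_of_residual hξ hD.le (by linarith) (by positivity) hη0 hη
        (by rw [hM]; linarith) (hest a _ ha)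
    · have hhalf := misclustered_le_half (trueLabel_mem n n₁) he.1.1
      have h1 : 2 ≤ M * Real.log n := by linarith
      have h2 : 1 ≤ 1 / √(lam n) + specNorm (U - V) := by
        have : 0 ≤ 1 / √(lam n) := by positivity
        linarith
      nlinarith
  · intro hU
    have hb : ∀ v, ((A x - meanMatrix n₁ (lam n) r w (θ x)).mulVec v) ⬝ᵥ
        ((A x - meanMatrix n₁ (lam n) r w (θ x)).mulVec v) ≤
        √((12 * C + 2) * (lam n * √(lam n))) ^ 2 * (v ⬝ᵥ v) := by
      intro v
      rw [Real.sq_sqrt (by positivity)]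
      exact hgood.sq_sub_mulVec_le hr hw hlam1 hξ0 hsym h01 hadm hC hn hlog v
    obtain ⟨a, ha⟩ := exists_residual_le_of_perturbation hr hw hrw hξ hρ0 hl0 (by omega) hnn hs1
      hs2 hθl hsym (Real.sqrt_nonneg _) hb U hU
    -- The squared noise norm is of order lam^(3/2); divided by lam² it is of order 1/√lam, the rate
    -- wanted.
    have hκ : 4 * ((1 + r + w) / |w - r ^ 2| * (ξ / ρ)) ^ 2 *
        (√((12 * C + 2) * (lam n * √(lam n))) ^ 2 / lam n ^ 2) = Y / √(lam n) := by
      rw [Real.sq_sqrt (by positivity), hY]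
      have : lam n ^ 2 = lam n * (√(lam n) * √(lam n)) := by
        rw [Real.mul_self_sqrt hl0.le, pow_two]
      rw [this]
      field_simp
    rw [hκ] at ha
    refine (hest a _ ha).trans ?_
    have : D * Real.log n * (Y / √(lam n) + 1 / √(lam n)) =
        D * (Y + 1) * Real.log n / √(lam n) := by ring
    rw [this]
    have : D * (Y + 1) ≤ M := by rw [hM]; linarith
    gcongr
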